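/- Let $C\subset\mathbb{P}^2_{\mathbb C}$ be the Klein quartic $x^3y+y^3z+z^3x=0$, a smooth plane quartic, and let $H$ be the divisor class cut out on $C$ by a line. A theta characteristic of $C$ is a divisor class $\eta$ of degree $2$ with $2\eta\sim H$ (here $H$ is the canonical class); it is even if $h^0(C,\eta)$ is even. A heptagon is a tuple of seven distinct labelled lines $L_1,\dots,L_7$ in $\mathbb{P}^2_{\mathbb C}$, no three of which meet in a point. Its residual points are the $14$ points $p_{ij}=L_i\cap L_j$ with $i\neq j$ not consecutive modulo $7$. Its adjoint quartic is the unique quartic curve that contains all residual points. If the adjoint quartic is the smooth curve $C$, the theta characteristic associated with the heptagon is the class $\eta$ determined by $\sum_{p \text{ residual}} p\sim 3H+\eta$ on $C$. **Theorem.** Among the even theta characteristics of $C$ there is exactly one, $\eta_{\rm sym}$, that is invariant under all automorphisms of the curve $C$, and there is a heptagon whose adjoint quartic is $C$ and whose associated theta characteristic is $\eta_{\rm sym}$. Moreover, for every primitive seventh root of unity $\zeta$, such a heptagon can be built from an orbit of the automorphism $\varphi:[x,y,z]\mapsto[\zeta^4x,\zeta^2y,\zeta z]$ of order $7$: there is a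 point $p_1\in C$ such that the points $p_i=\varphi^{i-1}(p_1)$, $i=1,\dots,7$, are distinct and the heptagon consists of the lines $L_i=\overline{p_{i-2}\,p_i}$, with indices modulo $7$. -/

import Mathlib

open scoped LinearAlgebra.Projectivization

/-- The complex projective plane. Lines are represented by points of the dual plane, which is
identified with the plane by coordinates: the point `p` lies on the line `L` iff
`Projectivization.orthogonal p L`. -/
abbrev PPlane : Type := ℙ ℂ (Fin 3 → ℂ)

/-- Polynomials in three variables. -/
abbrev Poly3 : Type := MvPolynomial (Fin 3) ℂ

/-- The form `F` vanishes at the point `p` (meaningful for homogeneous `F`). -/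
def VanishesAt (F : Poly3) (p : PPlane) : Prop := MvPolynomial.eval p.rep F = 0

/-- Points of the plane curve `f = 0`. -/
def CurvePt (f : Poly3) : Type := {p : PPlane // VanishesAt f p}

/-- The curve `f = 0` has no singular points. -/
def IsSmoothForm (f : Poly3) : Prop :=
  ∀ v : Fin 3 → ℂ, v ≠ 0 → MvPolynomial.eval v f = 0 →
    ∃ i, MvPolynomial.eval v (MvPolynomial.pderiv i f) ≠ 0

/-! ## Heptagons and adjoint quartics -/

/-- A heptagon: seven distinct lines, labelled cyclically (label `7` is `0 : ZMod 7`),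
no three of which meet in a point. -/
structure Heptagon where
  line : ZMod 7 → PPlane
  line_injective : Function.Injective line
  no_three_concurrent : ∀ i j k : ZMod 7, i ≠ j → i ≠ k → j ≠ k →
    ¬ ∃ p : PPlane, p.orthogonal (line i) ∧ p.orthogonal (line j) ∧ p.orthogonal (line k)

open Classical in
/-- The residual arrangement: the intersection points `L i ∩ L j` with `i`, `j` distinct and not
cyclically consecutive. -/
noncomputable def Heptagon.residual (P : Heptagon) : Finset PPlane :=
  (Finset.univ.filter fun ij : ZMod 7 × ZMod 7 =>
    ij.1 ≠ ij.2 ∧ ij.2 ≠ ij.1 + 1 ∧ ij.1 ≠ ij.2 + 1).image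
      fun ij => Projectivization.cross (P.line ij.1) (P.line ij.2)

/-- The curve `f = 0` is the adjoint quartic of `P`: the unique quartic curve that contains the
residual arrangement. -/
def Heptagon.IsAdjoint (P : Heptagon) (f : Poly3) : Prop :=
  f ≠ 0 ∧ f.IsHomogeneous 4 ∧ (∀ p ∈ P.residual, VanishesAt f p) ∧
    ∀ g : Poly3, g.IsHomogeneous 4 → (∀ p ∈ P.residual, VanishesAt g p) →
      ∃ c : ℂ, g = MvPolynomial.C c * f

/-! ## Orders of vanishing -/

/-- Restriction of polynomials to the line through the origin that is the point `p`. -/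
noncomputable def restrictToPoint (p : PPlane) : Poly3 →+* Polynomial ℂ :=
  (MvPolynomial.aeval fun i => Polynomial.C (p.rep i) * Polynomial.X).toRingHom

/-- The homogeneous prime ideal of the point `p`: the polynomials that vanish on the line through
the origin that is `p`. -/
noncomputable def pointIdeal (p : PPlane) : Ideal Poly3 := RingHom.ker (restrictToPoint p)

instance (p : PPlane) : (pointIdeal p).IsPrime := RingHom.ker_isPrime _

/-- The local ring `S_𝔭` of the homogeneous coordinate ring `S = ℂ[x, y, z] / (f)` of the curve at
the homogeneous prime `𝔭` of the point `p`. -/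
abbrev coordLocalRing (f : Poly3) (p : PPlane) : Type :=
  Localization.AtPrime (pointIdeal p) ⧸
    Ideal.span {algebraMap Poly3 (Localization.AtPrime (pointIdeal p)) f}

/-- The order of vanishing at `p` of the form `F` on the curve `f = 0`, that is, the intersection
multiplicity at `p` of the two curves, as the length of `S_𝔭 / (F)` over `S_𝔭`. -/
noncomputable def vanishingOrder (f F : Poly3) (p : PPlane) : ℕ :=
  (Ring.ord (coordLocalRing f p)
    (Ideal.Quotient.mk _ (algebraMap Poly3 (Localization.AtPrime (pointIdeal p)) F))).toNat

/-! ## Divisors, linear equivalence, and sections (for a smooth curve `f = 0`) -/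

/-- Divisors on the curve. -/
abbrev CurveDiv (f : Poly3) : Type := CurvePt f →₀ ℤ

/-- The total ring of fractions of the homogeneous coordinate ring (a field, if `f` is
irreducible). It contains the function field as the set of quotients of forms of equal degree. -/
abbrev FracRing (f : Poly3) : Type := FractionRing (Poly3 ⧸ Ideal.span {f})

/-- `u` is a nonzero rational function `F / G` on the curve, with `F`, `G` forms of equal degree
that do not vanish identically on the curve, and `E = div u = div F - div G`. -/
def IsDivisorOf (f : Poly3) (u : FracRing f) (E : CurveDiv f) : Prop :=
  ∃ (d : ℕ) (F G : Poly3), F.IsHomogeneous d ∧ G.IsHomogeneous d ∧ ¬ f ∣ F ∧ ¬ f ∣ G ∧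
    u * algebraMap (Poly3 ⧸ Ideal.span {f}) (FracRing f) (Ideal.Quotient.mk _ G) =
      algebraMap (Poly3 ⧸ Ideal.span {f}) (FracRing f) (Ideal.Quotient.mk _ F) ∧
    ∀ p : CurvePt f, E p = (vanishingOrder f F p.1 : ℤ) - (vanishingOrder f G p.1 : ℤ)

/-- Linear equivalence: `D₁ - D₂` is the divisor of a nonzero rational function. -/
def LinEquiv (f : Poly3) (D₁ D₂ : CurveDiv f) : Prop :=
  ∃ u : FracRing f, IsDivisorOf f u (D₁ - D₂)

/-- `h` is a representative of the class `H`: the divisor cut out on the curve by a line. -/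
def IsLineSection (f : Poly3) (h : CurveDiv f) : Prop :=
  ∃ l : Poly3, l.IsHomogeneous 1 ∧ l ≠ 0 ∧ ∀ p : CurvePt f, h p = (vanishingOrder f l p.1 : ℤ)

/-- `L(D)`: the rational functions `u` with `u = 0` or `div u + D ≥ 0`. -/
def sections (f : Poly3) (D : CurveDiv f) : Set (FracRing f) :=
  {u | u = 0 ∨ ∃ E : CurveDiv f, IsDivisorOf f u E ∧ 0 ≤ E + D}

/-- `h⁰(D)`, the complex dimension of `L(D)`. (On a smooth curve `L(D)` is a linear subspace and
so equal to its span.) -/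
noncomputable def h0 (f : Poly3) (D : CurveDiv f) : ℕ :=
  Module.finrank ℂ (Submodule.span ℂ (sections f D))

/-! ## Theta characteristics of a smooth plane quartic -/

/-- `η` represents a theta characteristic of the smooth plane quartic `f = 0`, whose canonical
class is `H`: it has degree `2`, and `2η ∼ H`. -/
def IsTheta (f : Poly3) (η : CurveDiv f) : Prop :=
  (η.sum fun _ n => n) = 2 ∧ ∃ h : CurveDiv f, IsLineSection f h ∧ LinEquiv f (2 • η) h

/-- Even theta characteristics. -/
def IsEvenTheta (f : Poly3) (η : CurveDiv f) : Prop := IsTheta f η ∧ Even (h0 f η)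

/-- `σ` is a morphism from the curve to itself: near every point it is given by three forms of
equal degree without a common zero there. -/
def IsRegularMap (f : Poly3) (σ : CurvePt f → CurvePt f) : Prop :=
  ∀ p : CurvePt f, ∃ (d : ℕ) (F : Fin 3 → Poly3) (e : ℕ) (G : Poly3),
    (∀ i, (F i).IsHomogeneous d) ∧ G.IsHomogeneous e ∧ ¬ VanishesAt G p.1 ∧
    ∀ q : CurvePt f, ¬ VanishesAt G q.1 →
      ∃ hq : (fun i => MvPolynomial.eval q.1.rep (F i)) ≠ 0,
        (σ q).1 = Projectivization.mk ℂ (fun i => MvPolynomial.eval q.1.rep (F i)) hq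

/-- Automorphisms of the curve as an algebraic variety. -/
def IsCurveAut (f : Poly3) (σ : Equiv.Perm (CurvePt f)) : Prop :=
  IsRegularMap f σ ∧ IsRegularMap f σ.symm

/-- The class of `η` is invariant under all automorphisms of the curve. -/
def IsAutInvariant (f : Poly3) (η : CurveDiv f) : Prop :=
  ∀ σ : Equiv.Perm (CurvePt f), IsCurveAut f σ → LinEquiv f (Finsupp.mapDomain σ η) η

open Classical in
/-- The divisor `R` on the curve `f = 0` that is the sum of the residual points of `P` (all of
which lie on the curve if the curve is the adjoint of `P`). -/
noncomputable def Heptagon.residualDivisor (P : Heptagon) (f : Poly3) : CurveDiv f :=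
  ∑ p ∈ P.residual.subtype (VanishesAt f), Finsupp.single (p : CurvePt f) 1

/-- The class of `η` is the theta characteristic associated with the heptagon `P` with adjoint
`f = 0`: the class determined by `R ∼ 3H + η`. -/
def Heptagon.IsAssociatedTheta (P : Heptagon) (f : Poly3) (η : CurveDiv f) : Prop :=
  ∃ h : CurveDiv f, IsLineSection f h ∧ LinEquiv f (P.residualDivisor f) (3 • h + η)

/-! ## The Klein quartic -/

/-- The Klein quartic `x³y + y³z + z³x`. -/
noncomputable def kleinQuartic : Poly3 :=
  MvPolynomial.X 0 ^ 3 * MvPolynomial.X 1 + MvPolynomial.X 1 ^ 3 * MvPolynomial.X 2 +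
    MvPolynomial.X 2 ^ 3 * MvPolynomial.X 0

/-- The linear map `(x, y, z) ↦ (ζ⁴x, ζ²y, ζz)`. -/
noncomputable def kleinPhiLinear (ζ : ℂ) : (Fin 3 → ℂ) →ₗ[ℂ] (Fin 3 → ℂ) :=
  Matrix.toLin' (Matrix.diagonal ![ζ ^ 4, ζ ^ 2, ζ])

theorem kleinPhiLinear_injective {ζ : ℂ} (hζ : ζ ≠ 0) :
    Function.Injective (kleinPhiLinear ζ) := by
  intro v w h
  have key : ∀ i, (![ζ ^ 4, ζ ^ 2, ζ] : Fin 3 → ℂ) i ≠ 0 := by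
    intro i; fin_cases i <;> simp [hζ]
  funext i
  have hi := congrFun h i
  simp only [kleinPhiLinear, Matrix.toLin'_apply, Matrix.mulVec_diagonal] at hi
  exact mul_left_cancel₀ (key i) hi

/-- The projective transformation `φ : [x, y, z] ↦ [ζ⁴x, ζ²y, ζz]`. -/
noncomputable def kleinPhi (ζ : ℂ) (hζ : ζ ≠ 0) : PPlane → PPlane :=
  Projectivization.map (kleinPhiLinear ζ) (kleinPhiLinear_injective hζ)

/-! Write A, B, C for the coordinate points `coordPt 0`, `coordPt 1`, `coordPt 2`. The coordinate
lines cut out 3C + B, 3A + C and 3B + A, so these three divisors all have class H and 7A ~ 7B ~ 7C.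
The invariant theta characteristic is η = C + 2B - A (`etaSym`); the relations give 2η ~ H.

Foundations. The local ring of the cone over the curve at a point is a discrete valuation ring whose
maximal ideal is generated by any transversal form (`maximalIdeal_eq_span`). Forms cut out complete
linear systems: if div F ≥ div G, then F is a multiple of G modulo the quartic
(`exists_eq_mul_of_ordAt_le`). This replaces Riemann–Roch throughout. Automorphisms preserve
principal divisors (`mapDomain_mem_principalDivisors`).

Uniqueness. The function x²y/z³ separates the orbits of φ away from A, B, C, and the cubics x²y =
cz³ show that every orbit, counted with seven points, has class 7A (`kleinClass_orbitDiv`). Summing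
an invariant class D over the powers of φ gives 7D ~ deg(D)·7A. Two invariant theta characteristics
thus agree after multiplication by 7 and by 2, hence agree.

Evenness. A nonzero section of η would give a nonzero conic tangent to the curve at A, B and C;
there is none, so h⁰(η) = 0.

Invariance. The automorphism group is never determined. The explicit automorphisms (the powers of φ,
the cyclic rotation, and an involution with entries in ℚ(ζ)) fix the class of η. The relations 2C +
B ~ 3A and its rotations force an arbitrary automorphism σ to send A, B, C to flexes
(`isFlex_of_kleinClass_eq`). Every flex is the image of A under a composite g of explicit
automorphisms (`IsFlex.exists_fixesEta`), so g⁻¹σ fixes A for a suitable g. The same relations then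
force it to fix B and C, hence η itself (`mapDomain_etaSym_eq`).

Heptagon. Let the lines be an orbit of φ in the dual plane, starting at (y, x, xy). The residual
points form two orbits of φ, and lying on the curve is one linear condition on x²y and y³/x for each
orbit; these two conditions have an explicit solution. Quartics split into seven weight spaces under
φ, one of dimension three and six of dimension two, and the two orbits leave only the multiples of
the Klein quartic. Both orbits have class 7A, and 14A ~ 3H + η. -/

section

open MvPolynomial Matrix

/-! ## Homogeneous polynomials and substitutions -/

/-- The scalar lives in an algebra because it is itself a polynomial in the projection to a line and
in the comparison of two representations of a map. -/
theorem aeval_mul_left_of_isHomogeneous {A : Type*} [CommRing A] [Algebra ℂ A]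
    {H : Poly3} {d : ℕ} (hH : H.IsHomogeneous d) (c : A) (a : Fin 3 → A) :
    aeval (fun i => c * a i) H = c ^ d * aeval a H := by
  rw [aeval_def, aeval_def, eval₂_eq, eval₂_eq, Finset.mul_sum]
  refine Finset.sum_congr rfl fun e he => ?_
  have hd : ∑ i ∈ e.support, e i = d := by
    rw [hH.degree_eq_sum_deg_support he]
  simp only [mul_pow, Finset.prod_mul_distrib, Finset.prod_pow_eq_pow_sum, hd]
  ring

theorem eval_smul_of_isHomogeneous {H : Poly3} {d : ℕ} (hH : H.IsHomogeneous d) (c : ℂ)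
    (v : Fin 3 → ℂ) : eval (c • v) H = c ^ d * eval v H := by
  have := aeval_mul_left_of_isHomogeneous hH c v
  rwa [← coe_aeval_eq_eval, ← coe_aeval_eq_eval]

theorem sum_mul_eval_pderiv {H : Poly3} {d : ℕ} (hH : H.IsHomogeneous d) (v : Fin 3 → ℂ) :
    ∑ i, v i * eval v (pderiv i H) = d * eval v H := by
  have := congrArg (eval v) hH.sum_X_mul_pderiv
  simpa using this

/-- The gradient of a polynomial at a vector. -/
noncomputable def gradientAt (F : Poly3) (v : Fin 3 → ℂ) : Fin 3 → ℂ := fun i => eval v (pderiv i F)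

theorem gradientAt_smul {F : Poly3} {d : ℕ} (hF : F.IsHomogeneous d) (c : ℂ) (v : Fin 3 → ℂ) :
    gradientAt F (c • v) = c ^ (d - 1) • gradientAt F v := by
  funext i
  exact eval_smul_of_isHomogeneous hF.pderiv c v

theorem dotProduct_gradientAt {F : Poly3} {d : ℕ} (hF : F.IsHomogeneous d) (v : Fin 3 → ℂ) :
    v ⬝ᵥ gradientAt F v = d * eval v F := sum_mul_eval_pderiv hF v

theorem vanishesAt_mk {F : Poly3} {d : ℕ} (hF : F.IsHomogeneous d) {v : Fin 3 → ℂ} (hv : v ≠ 0) :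
    VanishesAt F (Projectivization.mk ℂ v hv) ↔ eval v F = 0 := by
  obtain ⟨a, ha⟩ := Projectivization.exists_smul_eq_mk_rep ℂ v hv
  rw [VanishesAt, ← ha]
  change eval ((a : ℂ) • v) F = 0 ↔ _
  rw [eval_smul_of_isHomogeneous hF]
  simp

theorem vanishesAt_mul {F G : Poly3} {p : PPlane} :
    VanishesAt (F * G) p ↔ VanishesAt F p ∨ VanishesAt G p := by
  simp [VanishesAt]

/-! ## The prime ideal of a point -/

theorem eval_restrictToPoint (p : PPlane) (F : Poly3) (t : ℂ) :
    Polynomial.eval t (restrictToPoint p F) = eval (t • p.rep) F := by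
  have : (Polynomial.evalRingHom t).comp (restrictToPoint p) = eval (t • p.rep) := by
    apply MvPolynomial.ringHom_ext
    · intro r; simp [restrictToPoint]
    · intro i
      simp only [restrictToPoint, RingHom.comp_apply, AlgHom.toRingHom_eq_coe, RingHom.coe_coe, aeval_X,
        Polynomial.coe_evalRingHom, Polynomial.eval_mul, Polynomial.eval_C, Polynomial.eval_X, eval_X,
        Pi.smul_apply, smul_eq_mul]
      exact mul_comm _ _
  exact RingHom.congr_fun this F

theorem mem_pointIdeal {p : PPlane} {F : Poly3} :
    F ∈ pointIdeal p ↔ ∀ t : ℂ, eval (t • p.rep) F = 0 := by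
  rw [pointIdeal, RingHom.mem_ker]
  constructor
  · intro h t; rw [← eval_restrictToPoint, h, Polynomial.eval_zero]
  · intro h; apply Polynomial.funext; intro t; rw [eval_restrictToPoint, h, Polynomial.eval_zero]

theorem mem_pointIdeal_iff_vanishesAt {p : PPlane} {F : Poly3} {d : ℕ} (hF : F.IsHomogeneous d) :
    F ∈ pointIdeal p ↔ VanishesAt F p := by
  rw [mem_pointIdeal]
  constructor
  · intro h; simpa [VanishesAt] using h 1
  · intro h t
    rw [eval_smul_of_isHomogeneous hF, show eval p.rep F = 0 from h, mul_zero]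

theorem exists_eval_ne_zero_of_notMem {p : PPlane} {F : Poly3} (hF : F ∉ pointIdeal p) :
    ∃ t : ℂ, t ≠ 0 ∧ eval (t • p.rep) F ≠ 0 := by
  have h0 : restrictToPoint p F ≠ 0 := fun h => hF h
  by_contra! h
  -- The factor `X` covers t = 0, where nothing is known about F.
  have : Polynomial.X * restrictToPoint p F = 0 := by
    apply Polynomial.funext
    intro t
    by_cases ht : t = 0
    · simp [ht]
    · simp [eval_restrictToPoint, h t ht]
  simp [h0] at this

/-- The linear form `X i - (v i / v k) X k`, which vanishes at `v`. -/
noncomputable def deviation (v : Fin 3 → ℂ) (k i : Fin 3) : Poly3 :=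
  X i - C (v i) * (C (v k)⁻¹ * X k)

/-- Projection onto the line through `v` along the plane `X k = 0`. -/
noncomputable def projectToLine (v : Fin 3 → ℂ) (k : Fin 3) : Poly3 →ₐ[ℂ] Poly3 :=
  aeval fun i => C (v i) * (C (v k)⁻¹ * X k)

theorem deviation_self {v : Fin 3 → ℂ} {k : Fin 3} (hk : v k ≠ 0) : deviation v k k = 0 := by
  rw [deviation, ← mul_assoc, ← C_mul, mul_inv_cancel₀ hk, C_1, one_mul, sub_self]

theorem projectToLine_apply {v : Fin 3 → ℂ} {k : Fin 3} {H : Poly3} {d : ℕ}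
    (hH : H.IsHomogeneous d) :
    projectToLine v k H = C (eval v H) * (C (v k)⁻¹ * X k) ^ d := by
  have h := aeval_mul_left_of_isHomogeneous hH (C (v k)⁻¹ * X k : Poly3) (fun i => C (v i))
  simp only [mul_comm (C (v k)⁻¹ * X k : Poly3) (C _)] at h
  rw [projectToLine, h, mul_comm]
  congr 1
  have := MvPolynomial.aeval_algebraMap_apply (σ := Fin 3) (R := ℂ) (A := ℂ) Poly3 v H
  exact this

theorem sub_projectToLine_mem (v : Fin 3 → ℂ) (k : Fin 3) (F : Poly3) :
    F - projectToLine v k F ∈ Ideal.span (Set.range (deviation v k)) := by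
  rw [← Ideal.Quotient.eq]
  have : (Ideal.Quotient.mkₐ ℂ (Ideal.span (Set.range (deviation v k)))) =
      (Ideal.Quotient.mkₐ ℂ (Ideal.span (Set.range (deviation v k)))).comp
        (projectToLine v k) := by
    apply MvPolynomial.algHom_ext
    intro i
    simp only [projectToLine, AlgHom.comp_apply, aeval_X, Ideal.Quotient.mkₐ_eq_mk]
    rw [Ideal.Quotient.eq]
    exact Ideal.subset_span ⟨i, rfl⟩
  exact congrArg (fun g => g F) this

/-- Induction on multiplication by a variable: the new error is the old one times a projected
variable, plus a product of two elements of the ideal. -/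
theorem taylor_mem_sq (v : Fin 3 → ℂ) (k : Fin 3) (F : Poly3) :
    F - projectToLine v k F - ∑ i, projectToLine v k (pderiv i F) * deviation v k i ∈
      Ideal.span (Set.range (deviation v k)) ^ 2 := by
  set I := Ideal.span (Set.range (deviation v k)) with hI
  set θ := projectToLine v k with hθ
  induction F using MvPolynomial.induction_on with
  | C a => simp [hθ, projectToLine, algebraMap_eq]
  | add F G hF hG =>
    have : F + G - θ (F + G) - ∑ i, θ (pderiv i (F + G)) * deviation v k i =
        (F - θ F - ∑ i, θ (pderiv i F) * deviation v k i) +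
          (G - θ G - ∑ i, θ (pderiv i G) * deviation v k i) := by
      simp only [map_add, add_mul, Finset.sum_add_distrib]
      ring
    rw [this]
    exact Ideal.add_mem _ hF hG
  | mul_X F j hF =>
    have hj : deviation v k j ∈ I := Ideal.subset_span ⟨j, rfl⟩
    have h1 : (F - θ F) * deviation v k j ∈ I ^ 2 := by
      rw [pow_two]
      exact Ideal.mul_mem_mul (sub_projectToLine_mem v k F) hj
    have hX : θ (X j) = X j - deviation v k j := by
      simp [hθ, projectToLine, deviation]
    have hd : ∀ i, θ (pderiv i (F * X j)) * deviation v k i =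
        (if i = j then θ F * deviation v k i else 0) +
          θ (pderiv i F) * deviation v k i * θ (X j) := by
      intro i
      rw [Derivation.leibniz, pderiv_X, smul_eq_mul, smul_eq_mul, map_add, map_mul, map_mul]
      split_ifs with h
      · subst h; rw [Pi.single_eq_same, map_one]; ring
      · rw [Pi.single_eq_of_ne (Ne.symm h), map_zero]; ring
    have hs : F * X j - θ (F * X j) - ∑ i, θ (pderiv i (F * X j)) * deviation v k i =
        (F - θ F) * deviation v k j +
          (F - θ F - ∑ i, θ (pderiv i F) * deviation v k i) * θ (X j) := by
      simp only [hd]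
      rw [Finset.sum_add_distrib, Finset.sum_ite_eq' Finset.univ j, if_pos (Finset.mem_univ j),
        ← Finset.sum_mul, map_mul, hX]
      ring
    rw [hs]
    exact Ideal.add_mem _ h1 (Ideal.mul_mem_right _ _ hF)

/-- A polynomial that vanishes on the line projects to zero on it, and a polynomial differs from its
projection by an element of the span. -/
theorem pointIdeal_eq_span (p : PPlane) {k : Fin 3} (hk : p.rep k ≠ 0) :
    pointIdeal p = Ideal.span (Set.range (deviation p.rep k)) := by
  apply le_antisymm
  · intro F hF
    have h1 := sub_projectToLine_mem p.rep k F
    have h2 : projectToLine p.rep k F = 0 := by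
      apply MvPolynomial.funext
      intro x
      have : (eval x).comp (projectToLine p.rep k).toRingHom =
          eval (((p.rep k)⁻¹ * x k) • p.rep) := by
        apply MvPolynomial.ringHom_ext
        · intro r; simp [projectToLine, algebraMap_eq]
        · intro i; simp [projectToLine, mul_comm]
      have h3 := RingHom.congr_fun this F
      rw [mem_pointIdeal.1 hF] at h3
      simpa using h3
    rwa [h2, sub_zero] at h1
  · rw [Ideal.span_le]
    rintro _ ⟨i, rfl⟩
    rw [SetLike.mem_coe, mem_pointIdeal]
    intro t
    simp only [deviation, map_sub, map_mul, eval_X, eval_C, Pi.smul_apply, smul_eq_mul]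
    field_simp
    ring

/-- First order Taylor expansion at a point of the plane. -/
theorem sub_linearPart_mem_sq {p : PPlane} {k : Fin 3} (hk : p.rep k ≠ 0) {F : Poly3} {d : ℕ}
    (hF : F.IsHomogeneous d) (h0 : VanishesAt F p) :
    F - (C (p.rep k)⁻¹ * X k) ^ (d - 1) * ∑ i, C (gradientAt F p.rep i) * deviation p.rep k i ∈
      pointIdeal p ^ 2 := by
  have := taylor_mem_sq p.rep k F
  rw [← pointIdeal_eq_span p hk, projectToLine_apply hF, show eval p.rep F = 0 from h0, C_0,
    zero_mul, sub_zero] at this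
  convert this using 2
  rw [Finset.mul_sum]
  refine Finset.sum_congr rfl fun i _ => ?_
  rw [projectToLine_apply hF.pderiv, gradientAt]
  ring

/-! ## The local rings of a smooth plane quartic -/

/-- `f` is a prime quartic form without singular points. -/
structure IsSmoothQuartic (f : Poly3) : Prop where
  prime : Prime f
  homogeneous : f.IsHomogeneous 4
  smooth : IsSmoothForm f

/-- `π` exhibits `Q` as the local ring of the cone over the curve `f = 0` at the point `p`. -/
structure IsLocalAt (f : Poly3) (p : PPlane) {Q : Type*} [CommRing Q] (π : Poly3 →+* Q) : Prop where
  isUnit : ∀ s ∉ pointIdeal p, IsUnit (π s)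
  surj : ∀ x : Q, ∃ a s : Poly3, s ∉ pointIdeal p ∧ x * π s = π a
  eq_zero_iff : ∀ F : Poly3, π F = 0 ↔ ∃ s ∉ pointIdeal p, ∃ g, s * F = g * f

/-- The local ring of the cone over the curve `f = 0` at the point `p`. -/
def CurveLocalRing (f : Poly3) (p : PPlane) : Type := coordLocalRing f p

noncomputable instance (f : Poly3) (p : PPlane) : CommRing (CurveLocalRing f p) :=
  inferInstanceAs (CommRing (Localization.AtPrime (pointIdeal p) ⧸
    Ideal.span {algebraMap Poly3 (Localization.AtPrime (pointIdeal p)) f}))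

instance (f : Poly3) (p : PPlane) : IsNoetherianRing (CurveLocalRing f p) :=
  inferInstanceAs (IsNoetherianRing (Localization.AtPrime (pointIdeal p) ⧸
    Ideal.span {algebraMap Poly3 (Localization.AtPrime (pointIdeal p)) f}))

/-- The map from the localization at the ideal of a point to the local ring of the cone. -/
noncomputable def localizationToLocal (f : Poly3) (p : PPlane) :
    Localization.AtPrime (pointIdeal p) →+* CurveLocalRing f p :=
  Ideal.Quotient.mk (Ideal.span {algebraMap Poly3 (Localization.AtPrime (pointIdeal p)) f})

/-- The map from polynomials to the local ring of the cone over the curve at the point `p`. -/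
noncomputable def toLocal (f : Poly3) (p : PPlane) : Poly3 →+* CurveLocalRing f p :=
  (localizationToLocal f p).comp (algebraMap Poly3 (Localization.AtPrime (pointIdeal p)))

theorem localizationToLocal_surjective (f : Poly3) (p : PPlane) :
    Function.Surjective (localizationToLocal f p) := Ideal.Quotient.mk_surjective

theorem localizationToLocal_eq_zero_iff {f : Poly3} {p : PPlane}
    {x : Localization.AtPrime (pointIdeal p)} : localizationToLocal f p x = 0 ↔
      x ∈ Ideal.span {algebraMap Poly3 (Localization.AtPrime (pointIdeal p)) f} :=
  Ideal.Quotient.eq_zero_iff_mem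

theorem isLocalAt_toLocal (f : Poly3) (p : PPlane) : IsLocalAt f p (toLocal f p) where
  isUnit s hs := by
    have := (IsLocalization.AtPrime.isUnit_to_map_iff (Localization.AtPrime (pointIdeal p))
      (pointIdeal p) s).2 hs
    exact RingHom.isUnit_map (localizationToLocal f p) this
  surj x := by
    obtain ⟨y, rfl⟩ := localizationToLocal_surjective f p x
    obtain ⟨⟨a, s⟩, h⟩ := IsLocalization.surj (pointIdeal p).primeCompl y
    refine ⟨a, s, s.2, ?_⟩
    rw [toLocal, RingHom.comp_apply, RingHom.comp_apply, ← h, map_mul]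
  eq_zero_iff F := by
    rw [toLocal, RingHom.comp_apply, localizationToLocal_eq_zero_iff, Ideal.mem_span_singleton']
    constructor
    · rintro ⟨x, hx⟩
      obtain ⟨⟨a, s⟩, h⟩ := IsLocalization.surj (pointIdeal p).primeCompl x
      simp only at h
      have h2 : algebraMap Poly3 (Localization.AtPrime (pointIdeal p)) (s * F) =
          algebraMap Poly3 _ (a * f) := by
        rw [map_mul, map_mul, ← hx, ← h]; ring
      obtain ⟨t, ht⟩ := (IsLocalization.eq_iff_exists (pointIdeal p).primeCompl _).1 h2
      exact ⟨t * s, (t * s).2, t * a, by linear_combination ht⟩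
    · rintro ⟨s, hs, g, h⟩
      obtain ⟨u, hu⟩ := (IsLocalization.AtPrime.isUnit_to_map_iff
        (Localization.AtPrime (pointIdeal p)) (pointIdeal p) s).2 hs
      refine ⟨↑u⁻¹ * algebraMap _ _ g, ?_⟩
      rw [mul_assoc, ← map_mul, ← h, map_mul, ← hu, Units.inv_mul_cancel_left]

section Local

variable {f : Poly3} {p : PPlane} {Q : Type*} [CommRing Q] {π : Poly3 →+* Q}
  (hπ : IsLocalAt f p π)

include hπ

theorem IsLocalAt.self_eq_zero : π f = 0 :=
  (hπ.eq_zero_iff f).2 ⟨1, (Ideal.ne_top_iff_one _).1 Ideal.IsPrime.ne_top', 1, rfl⟩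

/-- Clearing denominators turns every question about the local ring into an identity between
polynomials. -/
theorem IsLocalAt.mem_map_iff {I : Ideal Poly3} {F : Poly3} :
    π F ∈ I.map π ↔ ∃ s ∉ pointIdeal p, ∃ a ∈ I, ∃ g, s * F = a + g * f := by
  constructor
  · intro h
    have key : ∀ x ∈ I.map π, ∃ s ∉ pointIdeal p, ∃ a ∈ I, x * π s = π a := by
      intro x hx
      refine Submodule.span_induction ?_ ?_ ?_ ?_ hx
      · rintro _ ⟨a, ha, rfl⟩
        exact ⟨1, (Ideal.ne_top_iff_one _).1 Ideal.IsPrime.ne_top', a, ha, by simp⟩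
      · exact ⟨1, (Ideal.ne_top_iff_one _).1 Ideal.IsPrime.ne_top', 0, I.zero_mem, by simp⟩
      · rintro x y _ _ ⟨s, hs, a, ha, h⟩ ⟨t, ht, b, hb, h'⟩
        refine ⟨s * t, fun h => (Ideal.IsPrime.mem_or_mem inferInstance h).elim hs ht, a * t + b * s,
          I.add_mem (I.mul_mem_right _ ha) (I.mul_mem_right _ hb), ?_⟩
        rw [map_mul, map_add, map_mul, map_mul, ← h, ← h']
        ring
      · rintro c x _ ⟨s, hs, a, ha, h⟩
        obtain ⟨b, t, ht, hb⟩ := hπ.surj c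
        refine ⟨s * t, fun h => (Ideal.IsPrime.mem_or_mem inferInstance h).elim hs ht, b * a,
          I.mul_mem_left _ ha, ?_⟩
        rw [smul_eq_mul, map_mul, map_mul, ← h, ← hb]
        ring
    obtain ⟨s, hs, a, ha, h⟩ := key _ h
    rw [← map_mul, ← sub_eq_zero, ← map_sub, hπ.eq_zero_iff] at h
    obtain ⟨t, ht, g, h⟩ := h
    exact ⟨t * s, fun h => (Ideal.IsPrime.mem_or_mem inferInstance h).elim ht hs, t * a, I.mul_mem_left _ ha,
      g, by linear_combination h⟩
  · rintro ⟨s, hs, a, ha, g, h⟩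
    have h1 := congrArg π h
    rw [map_mul, map_add, map_mul, hπ.self_eq_zero, mul_zero, add_zero] at h1
    have h2 : π s * π F ∈ I.map π := h1 ▸ Ideal.mem_map_of_mem _ ha
    exact (Ideal.unit_mul_mem_iff_mem _ (hπ.isUnit s hs)).1 h2

theorem IsLocalAt.dvd_iff {F G : Poly3} :
    π G ∣ π F ↔ ∃ s ∉ pointIdeal p, ∃ a g, s * F = a * G + g * f := by
  rw [← Ideal.mem_span_singleton, ← Set.image_singleton, ← Ideal.map_span, hπ.mem_map_iff]
  constructor
  · rintro ⟨s, hs, a, ha, g, h⟩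
    obtain ⟨b, rfl⟩ := Ideal.mem_span_singleton'.1 ha
    exact ⟨s, hs, b, g, h⟩
  · rintro ⟨s, hs, a, g, h⟩
    exact ⟨s, hs, a * G, Ideal.mem_span_singleton'.2 ⟨a, rfl⟩, g, h⟩

namespace IsSmoothQuartic

variable (hf : IsSmoothQuartic f) (hp : VanishesAt f p)

omit hπ in
include hf in
theorem mem_pointIdeal (hp : VanishesAt f p) : f ∈ pointIdeal p :=
  (mem_pointIdeal_iff_vanishesAt hf.homogeneous).2 hp

include hf hp

/-- Because f lies in the prime ideal of p, a denominator s is never divisible by f, so primality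
removes it. -/
theorem local_eq_zero_iff {F : Poly3} : π F = 0 ↔ f ∣ F := by
  constructor
  · intro h
    obtain ⟨s, hs, g, h⟩ := (hπ.eq_zero_iff F).1 h
    refine (hf.prime.dvd_or_dvd ⟨g, h.trans (mul_comm _ _)⟩).resolve_left fun ⟨c, hc⟩ => hs ?_
    rw [hc]
    exact Ideal.mul_mem_right _ _ (hf.mem_pointIdeal hp)
  · rintro ⟨c, rfl⟩
    rw [map_mul, hπ.self_eq_zero, zero_mul]

theorem local_isUnit_iff {F : Poly3} : IsUnit (π F) ↔ F ∉ pointIdeal p := by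
  refine ⟨fun h hF => ?_, hπ.isUnit F⟩
  obtain ⟨s, hs, a, ha, g, h⟩ := hπ.mem_map_iff.1
    ((Ideal.eq_top_of_isUnit_mem _ (Ideal.mem_map_of_mem π hF) h).symm ▸
      Submodule.mem_top : π 1 ∈ (pointIdeal p).map π)
  rw [mul_one] at h
  exact hs (h ▸ Ideal.add_mem _ ha (Ideal.mul_mem_left _ _ (hf.mem_pointIdeal hp)))

theorem local_isDomain : IsDomain Q := by
  have : Nontrivial Q := by
    refine ⟨0, 1, fun h => ?_⟩
    rw [← map_one π, eq_comm, hf.local_eq_zero_iff hπ hp] at h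
    exact hf.prime.not_isUnit (isUnit_of_dvd_one h)
  refine @NoZeroDivisors.to_isDomain Q _ _ ⟨fun {x y} h => ?_⟩
  obtain ⟨a, s, hs, hx⟩ := hπ.surj x
  obtain ⟨b, t, ht, hy⟩ := hπ.surj y
  have hab : π (a * b) = 0 := by
    rw [map_mul, ← hx, ← hy]; linear_combination (π s * π t) * h
  rw [hf.local_eq_zero_iff hπ hp] at hab
  rcases hf.prime.dvd_or_dvd hab with h | h
  · left
    rw [← hf.local_eq_zero_iff hπ hp, ← hx] at h
    exact ((hπ.isUnit s hs).mul_left_eq_zero).1 h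
  · right
    rw [← hf.local_eq_zero_iff hπ hp, ← hy] at h
    exact ((hπ.isUnit t ht).mul_left_eq_zero).1 h

theorem local_mem_map_iff_not_isUnit {x : Q} : x ∈ (pointIdeal p).map π ↔ ¬ IsUnit x := by
  obtain ⟨a, s, hs, h⟩ := hπ.surj x
  rw [← Ideal.mul_unit_mem_iff_mem _ (hπ.isUnit s hs), h]
  have hx : IsUnit x ↔ IsUnit (π a) := by
    rw [← h, (hπ.isUnit s hs).mul_right_iff] 
  rw [hx]
  constructor
  · intro h1 h2
    rw [hf.local_isUnit_iff hπ hp] at h2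
    obtain ⟨s, hs, b, hb, g, h⟩ := hπ.mem_map_iff.1 h1
    have : s * a ∈ pointIdeal p :=
      h ▸ Ideal.add_mem _ hb (Ideal.mul_mem_left _ _ (hf.mem_pointIdeal hp))
    exact (Ideal.IsPrime.mem_or_mem inferInstance this).elim hs h2
  · intro h
    rw [hf.local_isUnit_iff hπ hp, not_not] at h
    exact Ideal.mem_map_of_mem _ h

theorem local_isLocalRing : IsLocalRing Q := by
  have := hf.local_isDomain hπ hp
  refine IsLocalRing.of_nonunits_add fun x y hx hy => ?_
  rw [mem_nonunits_iff, ← hf.local_mem_map_iff_not_isUnit hπ hp] at *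
  exact Ideal.add_mem _ hx hy

theorem map_pointIdeal [IsLocalRing Q] : (pointIdeal p).map π = IsLocalRing.maximalIdeal Q := by
  ext x
  rw [hf.local_mem_map_iff_not_isUnit hπ hp, IsLocalRing.mem_maximalIdeal, mem_nonunits_iff]

omit hπ in
theorem gradientAt_ne_zero : gradientAt f p.rep ≠ 0 := by
  obtain ⟨i, hi⟩ := hf.smooth p.rep p.rep_nonzero hp
  exact fun h => hi (congrFun h i)

/-- A form that meets the curve transversally at `p` generates the maximal ideal. -/
theorem maximalIdeal_eq_span {F : Poly3} {d : ℕ} (hF : F.IsHomogeneous d) (h0 : VanishesAt F p)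
    (hc : gradientAt F p.rep ⨯₃ gradientAt f p.rep ≠ 0) [IsLocalRing Q] [IsNoetherianRing Q] :
    IsLocalRing.maximalIdeal Q = Ideal.span {π F} := by
  obtain ⟨k, hk⟩ : ∃ k, p.rep k ≠ 0 := by
    by_contra! h; exact p.rep_nonzero (funext h)
  set m := IsLocalRing.maximalIdeal Q with hm
  set a := gradientAt F p.rep with ha
  set b := gradientAt f p.rep with hb
  have hmap := hf.map_pointIdeal hπ hp
  have hsq : ∀ x ∈ pointIdeal p ^ 2, π x ∈ m ^ 2 := fun x hx => by
    rw [hm, ← hmap, ← Ideal.map_pow]; exact Ideal.mem_map_of_mem _ hx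
  have hFm : π F ∈ m := by
    rw [hm, ← hmap]
    exact Ideal.mem_map_of_mem _ ((mem_pointIdeal_iff_vanishesAt hF).2 h0)
  have hn : (C (p.rep k)⁻¹ * X k : Poly3) ∉ pointIdeal p := by
    rw [mem_pointIdeal_iff_vanishesAt ((isHomogeneous_X _ _).C_mul _), VanishesAt]
    simp [hk]
  have hun : ∀ e, IsUnit (π ((C (p.rep k)⁻¹ * X k) ^ e)) := fun e => by
    rw [map_pow]; exact (hπ.isUnit _ hn).pow e
  -- Modulo m² a form equals its linear part up to a unit. So the linear part of F lies in (F) + m²,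
  -- and that of f lies in m² because f is zero in the local ring.
  have hA : π (∑ i, C (a i) * deviation p.rep k i) ∈ Ideal.span {π F} ⊔ m ^ 2 := by
    have := hsq _ (sub_linearPart_mem_sq hk hF h0)
    rw [map_sub, map_mul] at this
    rw [← Ideal.unit_mul_mem_iff_mem _ (hun (d - 1))]
    have h2 := Submodule.sub_mem _ (Ideal.mem_sup_left (Ideal.mem_span_singleton_self
      (π F))) (Ideal.mem_sup_right this)
    convert h2 using 1
    ring
  have hB : π (∑ i, C (b i) * deviation p.rep k i) ∈ Ideal.span {π F} ⊔ m ^ 2 := by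
    have := hsq _ (sub_linearPart_mem_sq hk hf.homogeneous hp)
    rw [map_sub, map_mul, hπ.self_eq_zero, zero_sub, neg_mem_iff,
      Ideal.unit_mul_mem_iff_mem _ (hun _)] at this
    exact Ideal.mem_sup_right this
  have hva : p.rep ⬝ᵥ a = 0 := by
    rw [ha, dotProduct_gradientAt hF, show eval p.rep F = 0 from h0, mul_zero]
  have hvb : p.rep ⬝ᵥ b = 0 := by
    rw [hb, dotProduct_gradientAt hf.homogeneous, show eval p.rep f = 0 from hp, mul_zero]
  -- Both gradients are orthogonal to the vector of p by Euler's formula, so their cross product is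
  -- a nonzero multiple of it, and its k-th coordinate is not zero.
  have hck : (a ⨯₃ b) k ≠ 0 := by
    intro h
    apply hc
    have key : ∀ i, (a ⨯₃ b) i * p.rep k = 0 := by
      intro i
      have : (a ⨯₃ b) i * p.rep k = (a ⨯₃ b) k * p.rep i := by
        simp only [dotProduct, Fin.sum_univ_three] at hva hvb
        fin_cases k <;> fin_cases i <;> simp [cross_apply] <;> 
          first
          | linear_combination (a 0) * hvb - (b 0) * hva
          | linear_combination (a 1) * hvb - (b 1) * hva
          | linear_combination (a 2) * hvb - (b 2) * hva
          | linear_combination -(a 0) * hvb + (b 0) * hva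
          | linear_combination -(a 1) * hvb + (b 1) * hva
          | linear_combination -(a 2) * hvb + (b 2) * hva
      rw [this, h, zero_mul]
    funext i
    exact (mul_eq_zero.1 (key i)).resolve_right hk
  have hdev : ∀ i, π (deviation p.rep k i) ∈ Ideal.span {π F} ⊔ m ^ 2 := by
    intro i
    have hu : IsUnit (π (C ((a ⨯₃ b) k))) := 
      ((Ne.isUnit hck).map C).map _
    rw [← Ideal.unit_mul_mem_iff_mem _ hu]
    -- Cramer's rule: the k-th deviation is zero, and the two linear parts determine the other two
    -- with determinant (a × b) k up to sign.
    obtain ⟨r, s, hrs⟩ : ∃ r s : ℂ, C ((a ⨯₃ b) k) * deviation p.rep k i =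
        C r * (∑ i, C (a i) * deviation p.rep k i) + C s * ∑ i, C (b i) * deviation p.rep k i := by
      have hz := deviation_self hk
      simp only [Fin.sum_univ_three]
      fin_cases k <;> simp only [Fin.zero_eta, Fin.mk_one, Fin.reduceFinMk, Fin.isValue] at hz ⊢ <;>
        rw [hz] <;> fin_cases i <;>
        simp only [Fin.zero_eta, Fin.mk_one, Fin.reduceFinMk, Fin.isValue, hz, cross_apply,
          Matrix.cons_val, map_sub, map_mul]
      · exact ⟨0, 0, by simp⟩
      · exact ⟨b 2, -a 2, by rw [map_neg]; ring⟩
      · exact ⟨-b 1, a 1, by rw [map_neg]; ring⟩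
      · exact ⟨-b 2, a 2, by rw [map_neg]; ring⟩
      · exact ⟨0, 0, by simp⟩
      · exact ⟨b 0, -a 0, by rw [map_neg]; ring⟩
      · exact ⟨b 1, -a 1, by rw [map_neg]; ring⟩
      · exact ⟨-b 0, a 0, by rw [map_neg]; ring⟩
      · exact ⟨0, 0, by simp⟩
    rw [← map_mul, hrs, map_add, map_mul, map_mul]
    exact Ideal.add_mem _ (Ideal.mul_mem_left _ _ hA) (Ideal.mul_mem_left _ _ hB)
  apply le_antisymm
  -- Nakayama: it is enough that m ≤ (F) + m².
  · apply Submodule.le_of_le_smul_of_le_jacobson_bot (I := m) (IsNoetherian.noetherian m)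
      (IsLocalRing.maximalIdeal_le_jacobson _)
    rw [smul_eq_mul, ← pow_two]
    have hle : (pointIdeal p).map π ≤ Ideal.span {π F} ⊔ m ^ 2 := by
      rw [pointIdeal_eq_span p hk, Ideal.map_span, Ideal.span_le]
      rintro _ ⟨_, ⟨i, rfl⟩, rfl⟩
      exact hdev i
    rw [hmap] at hle
    exact hle
  · rw [Ideal.span_le, Set.singleton_subset_iff]; exact hFm

end IsSmoothQuartic

end Local

/-! ## Orders of vanishing with values in `ℕ∞` -/

/-- The order of vanishing at `p` of `F` on the curve `f = 0`; it is `⊤` if `F` vanishes on the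
curve. -/
noncomputable def ordAt (f F : Poly3) (p : PPlane) : ℕ∞ :=
  Ring.ord (CurveLocalRing f p) (toLocal f p F)

theorem vanishingOrder_eq_toNat (f F : Poly3) (p : PPlane) :
    vanishingOrder f F p = (ordAt f F p).toNat := rfl

/-- With b j ≠ 0 take a = e_j × v; then a × b = b j • v, because v is orthogonal to b. -/
theorem exists_transversal_linearForm {v b : Fin 3 → ℂ} (hv : v ≠ 0) (hb : b ≠ 0)
    (hvb : v ⬝ᵥ b = 0) : ∃ a : Fin 3 → ℂ, v ⬝ᵥ a = 0 ∧ a ⨯₃ b ≠ 0 := by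
  obtain ⟨j, hj⟩ : ∃ j, b j ≠ 0 := by by_contra! h; exact hb (funext h)
  refine ⟨(Pi.single j 1 : Fin 3 → ℂ) ⨯₃ v, dot_cross_self _ _, fun h => hv ?_⟩
  have key : ((Pi.single j 1 : Fin 3 → ℂ) ⨯₃ v) ⨯₃ b = b j • v := by
    simp only [dotProduct, Fin.sum_univ_three] at hvb
    funext i
    fin_cases j <;> fin_cases i <;> simp [cross_apply] <;>
      first | ring1 | linear_combination hvb | linear_combination -hvb
  rw [key] at h
  exact (smul_eq_zero.1 h).resolve_left hj

/-- The linear form with the coefficient vector `a`. -/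
noncomputable def linearForm (a : Fin 3 → ℂ) : Poly3 := ∑ i, C (a i) * X i

theorem linearForm_isHomogeneous (a : Fin 3 → ℂ) : (linearForm a).IsHomogeneous 1 :=
  IsHomogeneous.sum _ _ _ fun _ _ => (isHomogeneous_X _ _).C_mul _

theorem eval_linearForm (a v : Fin 3 → ℂ) : eval v (linearForm a) = v ⬝ᵥ a := by
  simp [linearForm, dotProduct, mul_comm]

theorem gradientAt_linearForm (a v : Fin 3 → ℂ) : gradientAt (linearForm a) v = a := by
  funext j
  simp [gradientAt, linearForm, Derivation.leibniz, pderiv_X, Pi.single_apply]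

theorem eq_linearForm {l : Poly3} (hl : l.IsHomogeneous 1) (v : Fin 3 → ℂ) :
    l = linearForm (gradientAt l v) := by
  have h := hl.sum_X_mul_pderiv
  rw [one_smul] at h
  have hc : ∀ i, pderiv i l = C (gradientAt l v i) := by
    intro i
    have h0 : (pderiv i l).IsHomogeneous 0 := hl.pderiv
    have h1 := totalDegree_eq_zero_iff_eq_C.1 ((totalDegree_zero_iff_isHomogeneous _).2 h0)
    rw [gradientAt, h1, eval_C]
  conv_lhs => rw [← h]
  simp only [linearForm, hc, mul_comm]

theorem linearForm_ne_zero {a : Fin 3 → ℂ} (ha : a ≠ 0) : linearForm a ≠ 0 := fun h => ha (by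
  rw [← gradientAt_linearForm a 0, h]; funext i; simp [gradientAt])

theorem not_dvd_of_isHomogeneous {f F : Poly3} {m n : ℕ} (hf : f.IsHomogeneous m)
    (hF : F.IsHomogeneous n) (hF0 : F ≠ 0) (hmn : n < m) : ¬ f ∣ F := by
  rintro ⟨g, rfl⟩
  have hf0 : f ≠ 0 := left_ne_zero_of_mul hF0
  have := totalDegree_mul_of_isDomain hf0 (right_ne_zero_of_mul hF0)
  rw [hF.totalDegree hF0, hf.totalDegree hf0] at this
  omega

namespace IsSmoothQuartic

variable {f : Poly3} (hf : IsSmoothQuartic f) {p : PPlane} (hp : VanishesAt f p)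

include hf hp

theorem curveLocalRing_isDomain : IsDomain (CurveLocalRing f p) :=
  hf.local_isDomain (isLocalAt_toLocal f p) hp

theorem curveLocalRing_isLocalRing : IsLocalRing (CurveLocalRing f p) :=
  hf.local_isLocalRing (isLocalAt_toLocal f p) hp

theorem exists_transversal : ∃ a : Fin 3 → ℂ, p.rep ⬝ᵥ a = 0 ∧
    a ⨯₃ gradientAt f p.rep ≠ 0 := by
  refine exists_transversal_linearForm p.rep_nonzero (hf.gradientAt_ne_zero hp) ?_
  rw [dotProduct_gradientAt hf.homogeneous, show eval p.rep f = 0 from hp, mul_zero]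

/-- A Noetherian local domain with principal maximal ideal. It is not a field, since the generator
is a line and a quartic does not divide a linear form. -/
theorem isDiscreteValuationRing [IsDomain (CurveLocalRing f p)] :
    IsDiscreteValuationRing (CurveLocalRing f p) := by
  have := hf.curveLocalRing_isLocalRing hp
  obtain ⟨a, ha, hc⟩ := hf.exists_transversal hp
  have hv : VanishesAt (linearForm a) p := (eval_linearForm a p.rep).trans ha
  have hm := hf.maximalIdeal_eq_span (isLocalAt_toLocal f p) hp (linearForm_isHomogeneous a) hv
    (by rwa [gradientAt_linearForm])
  have ha0 : a ≠ 0 := by rintro rfl; simp at hc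
  have hfield : ¬ IsField (CurveLocalRing f p) := by
    rw [IsLocalRing.isField_iff_maximalIdeal_eq, hm, Ideal.span_singleton_eq_bot,
      hf.local_eq_zero_iff (isLocalAt_toLocal f p) hp]
    exact not_dvd_of_isHomogeneous hf.homogeneous (linearForm_isHomogeneous a)
      (linearForm_ne_zero ha0) (by norm_num)
  have htfae := (IsDiscreteValuationRing.TFAE (CurveLocalRing f p) hfield).out 0 4
  exact htfae.2 ⟨⟨_, hm⟩⟩

theorem ordAt_mul (F G : Poly3) : ordAt f (F * G) p = ordAt f F p + ordAt f G p := by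
  have := hf.curveLocalRing_isDomain hp
  have := hf.isDiscreteValuationRing hp
  simp only [ordAt, Ring.ord_eq_addVal, map_mul, IsDiscreteValuationRing.addVal_mul]

theorem ordAt_pow (F : Poly3) (n : ℕ) : ordAt f (F ^ n) p = n • ordAt f F p := by
  have := hf.curveLocalRing_isDomain hp
  have := hf.isDiscreteValuationRing hp
  simp only [ordAt, Ring.ord_eq_addVal, map_pow, IsDiscreteValuationRing.addVal_pow]

theorem ordAt_eq_top_iff {F : Poly3} : ordAt f F p = ⊤ ↔ f ∣ F := by
  have := hf.curveLocalRing_isDomain hp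
  have := hf.isDiscreteValuationRing hp
  rw [ordAt, Ring.ord_eq_addVal, IsDiscreteValuationRing.addVal_eq_top_iff,
    hf.local_eq_zero_iff (isLocalAt_toLocal f p) hp]

theorem ordAt_eq_zero_iff_notMem {F : Poly3} : ordAt f F p = 0 ↔ F ∉ pointIdeal p := by
  have := hf.curveLocalRing_isDomain hp
  have := hf.isDiscreteValuationRing hp
  rw [ordAt, Ring.ord_eq_addVal, IsDiscreteValuationRing.addVal_eq_zero_iff,
    hf.local_isUnit_iff (isLocalAt_toLocal f p) hp]

theorem ordAt_eq_zero_iff {F : Poly3} {d : ℕ} (hF : F.IsHomogeneous d) :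
    ordAt f F p = 0 ↔ ¬ VanishesAt F p := by
  rw [hf.ordAt_eq_zero_iff_notMem hp, mem_pointIdeal_iff_vanishesAt hF]

theorem min_ordAt_le_add (F G : Poly3) : min (ordAt f F p) (ordAt f G p) ≤ ordAt f (F + G) p := by
  have := hf.curveLocalRing_isDomain hp
  have := hf.isDiscreteValuationRing hp
  simp only [ordAt, Ring.ord_eq_addVal, map_add]
  exact IsDiscreteValuationRing.addVal_add

theorem ordAt_le_iff {F G : Poly3} : ordAt f G p ≤ ordAt f F p ↔
    ∃ s ∉ pointIdeal p, ∃ a g, s * F = a * G + g * f := by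
  have := hf.curveLocalRing_isDomain hp
  have := hf.isDiscreteValuationRing hp
  rw [ordAt, ordAt, Ring.ord_eq_addVal, Ring.ord_eq_addVal,
    IsDiscreteValuationRing.addVal_le_iff_dvd, (isLocalAt_toLocal f p).dvd_iff]

omit hf hp in
theorem _root_.ordAt_congr {f F G : Poly3} (p : PPlane) (h : f ∣ F - G) :
    ordAt f F p = ordAt f G p := by
  obtain ⟨g, hg⟩ := h
  have : toLocal f p F = toLocal f p G := by
    rw [← sub_eq_zero, ← map_sub, hg, map_mul, (isLocalAt_toLocal f p).self_eq_zero, zero_mul]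
  rw [ordAt, ordAt, this]

theorem ordAt_eq_one {F : Poly3} {d : ℕ} (hF : F.IsHomogeneous d) (h0 : VanishesAt F p)
    (hc : gradientAt F p.rep ⨯₃ gradientAt f p.rep ≠ 0) : ordAt f F p = 1 := by
  have := hf.curveLocalRing_isDomain hp
  have := hf.isDiscreteValuationRing hp
  rw [ordAt, Ring.ord_eq_addVal]
  apply IsDiscreteValuationRing.addVal_uniformizer
  rw [IsDiscreteValuationRing.irreducible_iff_uniformizer]
  exact hf.maximalIdeal_eq_span (isLocalAt_toLocal f p) hp hF h0 hc

theorem exists_ordAt_eq_one : ∃ l : Poly3, l.IsHomogeneous 1 ∧ ordAt f l p = 1 := by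
  obtain ⟨a, ha, hc⟩ := hf.exists_transversal hp
  exact ⟨linearForm a, linearForm_isHomogeneous a, hf.ordAt_eq_one hp (linearForm_isHomogeneous a)
    ((eval_linearForm a p.rep).trans ha) (by rwa [gradientAt_linearForm])⟩

/-- Describes orders by powers of the ideal of the point, a form that can be pulled back along
substitutions. -/
theorem le_ordAt_iff {F : Poly3} {n : ℕ} : n ≤ ordAt f F p ↔
    ∃ s ∉ pointIdeal p, ∃ a ∈ pointIdeal p ^ n, ∃ g, s * F = a + g * f := by
  have := hf.curveLocalRing_isDomain hp
  have := hf.isDiscreteValuationRing hp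
  obtain ⟨a, ha, hc⟩ := hf.exists_transversal hp
  have hv : VanishesAt (linearForm a) p := (eval_linearForm a p.rep).trans ha
  have hc' : gradientAt (linearForm a) p.rep ⨯₃ gradientAt f p.rep ≠ 0 := by
    rwa [gradientAt_linearForm]
  have hm := hf.maximalIdeal_eq_span (isLocalAt_toLocal f p) hp (linearForm_isHomogeneous a) hv hc'
  have h1 : (n : ℕ∞) = ordAt f (linearForm a ^ n) p := by
    rw [hf.ordAt_pow hp, hf.ordAt_eq_one hp (linearForm_isHomogeneous a) hv hc', nsmul_one]
  rw [← (isLocalAt_toLocal f p).mem_map_iff, Ideal.map_pow,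
    hf.map_pointIdeal (isLocalAt_toLocal f p) hp, hm, Ideal.span_singleton_pow,
    Ideal.mem_span_singleton, h1, ordAt, ordAt, Ring.ord_eq_addVal, Ring.ord_eq_addVal,
    IsDiscreteValuationRing.addVal_le_iff_dvd, map_pow]

/-- A form whose gradient is proportional to that of `f` at a common zero vanishes doubly. -/
theorem two_le_ordAt {F : Poly3} {d : ℕ} (hF : F.IsHomogeneous d) (h0 : VanishesAt F p) {c : ℂ}
    (hc : gradientAt F p.rep = c • gradientAt f p.rep) : 2 ≤ ordAt f F p := by
  obtain ⟨k, hk⟩ : ∃ k, p.rep k ≠ 0 := by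
    by_contra! h; exact p.rep_nonzero (funext h)
  set n : Poly3 := C (p.rep k)⁻¹ * X k with hn
  have hnot : n ∉ pointIdeal p := by
    rw [mem_pointIdeal_iff_vanishesAt ((isHomogeneous_X _ _).C_mul _), VanishesAt]
    simp [hk]
  have h1 := sub_linearPart_mem_sq hk hF h0
  have h2 := sub_linearPart_mem_sq hk hf.homogeneous hp
  have hsum : ∑ i, C (gradientAt F p.rep i) * deviation p.rep k i =
      C c * ∑ i, C (gradientAt f p.rep i) * deviation p.rep k i := by
    rw [Finset.mul_sum]
    refine Finset.sum_congr rfl fun i _ => ?_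
    rw [hc, Pi.smul_apply, smul_eq_mul, C_mul, mul_assoc]
  rw [hsum, ← hn] at h1
  rw [← hn] at h2
  set E := ∑ i, C (gradientAt f p.rep i) * deviation p.rep k i
  -- The linear parts of n³F and c·n^(d-1)·f coincide, so their difference lies in the square of the
  -- ideal; n³ is the denominator.
  refine (hf.le_ordAt_iff hp (n := 2)).2 ⟨n ^ 3, fun h => hnot (Ideal.IsPrime.mem_of_pow_mem
    inferInstance _ h), _, Ideal.sub_mem _ (Ideal.mul_mem_left _ (n ^ 3) h1)
      (Ideal.mul_mem_left _ (n ^ (d - 1) * C c) h2), n ^ (d - 1) * C c, ?_⟩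
  ring

end IsSmoothQuartic

/-! ## The Klein quartic is a smooth quartic -/

theorem kleinQuartic_isHomogeneous : kleinQuartic.IsHomogeneous 4 := by
  have h : ∀ i j : Fin 3, (X i ^ 3 * X j : Poly3).IsHomogeneous 4 := fun i j =>
    (isHomogeneous_X_pow i 3).mul (isHomogeneous_X _ j)
  exact ((h 0 1).add (h 1 2)).add (h 2 0)

theorem eval_kleinQuartic (v : Fin 3 → ℂ) :
    eval v kleinQuartic = v 0 ^ 3 * v 1 + v 1 ^ 3 * v 2 + v 2 ^ 3 * v 0 := by
  simp [kleinQuartic]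

theorem gradientAt_kleinQuartic (v : Fin 3 → ℂ) : gradientAt kleinQuartic v =
    ![3 * v 0 ^ 2 * v 1 + v 2 ^ 3, v 0 ^ 3 + 3 * v 1 ^ 2 * v 2, v 1 ^ 3 + 3 * v 2 ^ 2 * v 0] := by
  funext i
  fin_cases i <;>
    simp [gradientAt, kleinQuartic, Derivation.leibniz, Derivation.leibniz_pow, pderiv_X] <;> ring

theorem kleinQuartic_isSmoothForm : IsSmoothForm kleinQuartic := by
  intro v hv h0
  by_contra! h
  have hg : ∀ i, gradientAt kleinQuartic v i = 0 := h
  rw [gradientAt_kleinQuartic] at hg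
  have h1 := hg 0
  have h2 := hg 1
  have h3 := hg 2
  simp only [Matrix.cons_val] at h1 h2 h3
  -- The forms x·f_x, y·f_y, z·f_z are combinations of the three monomials of f with a circulant
  -- matrix of determinant 28; this inverts it.
  have h4 : v 0 ^ 3 * v 1 = 0 := by
    linear_combination (9 / 28 * v 0) * h1 + (1 / 28 * v 1) * h2 - (3 / 28 * v 2) * h3
  apply hv
  have h5 : v 0 = 0 ∨ v 1 = 0 := by simpa using h4
  have h6 : v 2 = 0 := by
    rcases h5 with h | h <;> simpa [h] using h1
  have h7 : v 0 = 0 := by simpa [h6] using h2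
  have h8 : v 1 = 0 := by simpa [h6] using h3
  funext i
  fin_cases i <;> assumption

/-- Eisenstein for y·x³ + z³·x + y³z as a polynomial in x over ℂ[y, z], at the prime z. -/
theorem kleinQuartic_prime : Prime kleinQuartic := by
  rw [← irreducible_iff_prime, ← MulEquiv.irreducible_iff (finSuccEquiv ℂ 2)]
  set y : MvPolynomial (Fin 2) ℂ := X 0 with hy
  set z : MvPolynomial (Fin 2) ℂ := X 1 with hz
  have hyz : ¬ y ∣ z := by
    rintro ⟨c, hc⟩
    simpa [hy, hz] using congrArg (eval ![0, 1]) hc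
  have hzy : ¬ z ∣ y := by
    rintro ⟨c, hc⟩
    simpa [hy, hz] using congrArg (eval ![1, 0]) hc
  have hyp : Prime y := X_prime
  have hzp : Prime z := X_prime
  have he : finSuccEquiv ℂ 2 kleinQuartic =
      Polynomial.C y * Polynomial.X ^ 3 + Polynomial.C 0 * Polynomial.X ^ 2 +
        Polynomial.C (z ^ 3) * Polynomial.X + Polynomial.C (y ^ 3 * z) := by
    have h1 : finSuccEquiv ℂ 2 (X 1) = Polynomial.C y := finSuccEquiv_X_succ (j := 0)
    have h2 : finSuccEquiv ℂ 2 (X 2) = Polynomial.C z := finSuccEquiv_X_succ (j := 1)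
    simp only [kleinQuartic, map_add, map_mul, map_pow, finSuccEquiv_X_zero, h1, h2]
    simp only [map_zero]
    ring
  rw [he]
  have hdeg := Polynomial.degree_cubic (a := y) (b := 0) (c := z ^ 3) (d := y ^ 3 * z) hyp.ne_zero
  have hcoeff : ∀ a b c d : MvPolynomial (Fin 2) ℂ, ∀ P : Polynomial (MvPolynomial (Fin 2) ℂ),
      P = Polynomial.C a * Polynomial.X ^ 3 + Polynomial.C b * Polynomial.X ^ 2 +
        Polynomial.C c * Polynomial.X + Polynomial.C d →
      P.coeff 0 = d ∧ P.coeff 1 = c ∧ P.coeff 2 = b ∧ P.coeff 3 = a := by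
    rintro a b c d P rfl
    simp [Polynomial.coeff_X, Polynomial.coeff_C]
  obtain ⟨hc0, hc1, hc2, hc3⟩ := hcoeff y 0 (z ^ 3) (y ^ 3 * z) _ rfl
  apply Polynomial.irreducible_of_eisenstein_criterion (P := Ideal.span {z})
    ((Ideal.span_singleton_prime hzp.ne_zero).2 hzp)
  · rw [Polynomial.leadingCoeff_cubic hyp.ne_zero, Ideal.mem_span_singleton]
    exact hzy
  · intro n hn
    rw [hdeg] at hn
    have hn' : n < 3 := by exact_mod_cast hn
    rw [Ideal.mem_span_singleton]
    interval_cases n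
    · rw [hc0]; exact dvd_mul_left _ _
    · rw [hc1]; exact dvd_pow_self _ (by norm_num)
    · rw [hc2]; exact dvd_zero _
  · rw [hdeg]; norm_num
  · rw [hc0, Ideal.span_singleton_pow, Ideal.mem_span_singleton, pow_two, mul_comm (y ^ 3)]
    rintro h
    exact hzy (hzp.dvd_of_dvd_pow ((mul_dvd_mul_iff_left hzp.ne_zero).1 h))
  -- Primitivity: a common divisor of the coefficients divides the prime y and also z³, so it is a
  -- unit.
  · intro r hr
    rw [Polynomial.C_dvd_iff_dvd_coeff] at hr
    have h1 := hr 3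
    have h2 := hr 1
    rw [hc3] at h1
    rw [hc1] at h2
    rcases hyp.irreducible.dvd_iff.1 h1 with h | h
    · exact h
    · exact absurd (hyp.dvd_of_dvd_pow (h.dvd.trans h2)) hyz

theorem kleinQuartic_isSmoothQuartic : IsSmoothQuartic kleinQuartic :=
  ⟨kleinQuartic_prime, kleinQuartic_isHomogeneous, kleinQuartic_isSmoothForm⟩

/-! ## Forms that vanish on the curve -/

theorem aeval_eq_eval_complex (v : Fin 3 → ℂ) (P : Poly3) : aeval v P = eval v P := by
  rw [← coe_aeval_eq_eval]
  rfl

/-- Nullstellensatz for the prime ideal (f). -/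
theorem IsSmoothQuartic.dvd_of_forall_eval_eq_zero {f : Poly3} (hf : IsSmoothQuartic f) {F : Poly3}
    (h : ∀ v : Fin 3 → ℂ, eval v f = 0 → eval v F = 0) : f ∣ F := by
  have hrad := vanishingIdeal_zeroLocus_eq_radical (K := ℂ) (Ideal.span {f})
  rw [((Ideal.span_singleton_prime hf.prime.ne_zero).2 hf.prime).radical] at hrad
  rw [← Ideal.mem_span_singleton, ← hrad, mem_vanishingIdeal_iff]
  intro v hv
  have h0 := (mem_zeroLocus_iff.1 hv) f (Ideal.mem_span_singleton_self f)
  rw [aeval_eq_eval_complex] at h0 ⊢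
  exact h v h0

theorem IsSmoothQuartic.dvd_of_forall_vanishesAt {f : Poly3} (hf : IsSmoothQuartic f) {F : Poly3}
    {d : ℕ} (hF : F.IsHomogeneous d) (hd : d ≠ 0)
    (h : ∀ p : PPlane, VanishesAt f p → VanishesAt F p) : f ∣ F := by
  refine hf.dvd_of_forall_eval_eq_zero fun v hv => ?_
  -- The affine cone also contains the origin; a form of positive degree vanishes there.
  by_cases hv0 : v = 0
  · have := eval_smul_of_isHomogeneous hF 0 v
    simpa [hv0, hd] using this
  · rw [← vanishesAt_mk hF hv0]
    exact h _ ((vanishesAt_mk hf.homogeneous hv0).2 hv)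

/-! ## Completeness of the linear systems cut out by forms -/

theorem homogeneousComponent_mul_of_isHomogeneous {a G : Poly3} {n : ℕ} (hG : G.IsHomogeneous n)
    (k : ℕ) : homogeneousComponent (k + n) (a * G) = homogeneousComponent k a * G := by
  conv_lhs => rw [← sum_homogeneousComponent a, Finset.sum_mul, map_sum]
  have h : ∀ i, homogeneousComponent (k + n) (homogeneousComponent i a * G) =
      if i = k then homogeneousComponent k a * G else 0 := by
    intro i
    rw [homogeneousComponent_of_mem ((homogeneousComponent_isHomogeneous i a).mul hG)]
    by_cases h : i = k
    · subst h; simp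
    · rw [if_neg (by omega), if_neg h]
  simp only [h, Finset.sum_ite_eq', Finset.mem_range]
  split_ifs with hk
  · rfl
  · rw [homogeneousComponent_eq_zero _ _ (by omega), zero_mul]

section

attribute [local instance] MvPolynomial.gradedAlgebra

theorem dvd_homogeneousComponent {f P : Poly3} {d : ℕ} (hf : f.IsHomogeneous d) (h : f ∣ P)
    (n : ℕ) : f ∣ homogeneousComponent n P := by
  rw [← Ideal.mem_span_singleton] at h ⊢
  refine homogeneousComponent_mem_of_mem (Ideal.homogeneous_span _ _ ?_) h n
  rintro x rfl
  exact ⟨d, hf⟩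

end

theorem sub_aeval_mem {I : Ideal Poly3} {g : Fin 3 → Poly3} (h : ∀ i, X i - g i ∈ I) (P : Poly3) :
    P - aeval g P ∈ I := by
  rw [← Ideal.Quotient.eq]
  have : Ideal.Quotient.mkₐ ℂ I = (Ideal.Quotient.mkₐ ℂ I).comp (aeval g) := by
    apply MvPolynomial.algHom_ext
    intro i
    simp only [AlgHom.comp_apply, aeval_X, Ideal.Quotient.mkₐ_eq_mk]
    rw [Ideal.Quotient.eq]
    exact h i
  exact congrArg (fun g => g P) this

/-- The forms x - z, f, y - z are a regular sequence: on the common zeros of x - z and y - z the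
quartic becomes 3z⁴, which is not zero. Below, θ sets x = z and τ sets y = z. -/
theorem kleinQuartic_regular_sequence {a b c : Poly3}
    (h : (X 1 - X 2) * a = (X 0 - X 2) * b + c * kleinQuartic) :
    ∃ a' c', a = (X 0 - X 2) * a' + c' * kleinQuartic := by
  set θ : Poly3 →ₐ[ℂ] Poly3 := aeval ![X 2, X 1, X 2] with hθ
  set τ : Poly3 →ₐ[ℂ] Poly3 := aeval ![X 0, X 2, X 2] with hτ
  have hs : ∀ P : Poly3, (X 0 - X 2 : Poly3) ∣ P - θ P := fun P => by
    rw [← Ideal.mem_span_singleton]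
    apply sub_aeval_mem
    intro i
    fin_cases i <;> simp
  have ht : ∀ P : Poly3, (X 1 - X 2 : Poly3) ∣ P - τ P := fun P => by
    rw [← Ideal.mem_span_singleton]
    apply sub_aeval_mem
    intro i
    fin_cases i <;> simp
  have h1 := congrArg θ h
  simp only [map_mul, map_add, map_sub] at h1
  rw [show θ (X 0) = X 2 by simp [hθ], show θ (X 1) = X 1 by simp [hθ],
    show θ (X 2) = X 2 by simp [hθ], sub_self, zero_mul, zero_add] at h1
  have h2 := congrArg τ h1
  simp only [map_mul, map_sub] at h2
  rw [show τ (X 1) = X 2 by simp [hτ], show τ (X 2) = X 2 by simp [hτ], sub_self, zero_mul] at h2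
  have hf : τ (θ kleinQuartic) = C 3 * X 2 ^ 4 := by
    simp [hθ, hτ, kleinQuartic]
    rw [show (C 3 : Poly3) = 3 from map_ofNat C 3]
    ring
  rw [hf] at h2
  have h3 : τ (θ c) = 0 := by
    refine (mul_eq_zero.1 h2.symm).resolve_right (mul_ne_zero ?_ (pow_ne_zero _ (X_ne_zero 2)))
    rw [Ne, C_eq_zero]
    norm_num
  obtain ⟨c', hc'⟩ := ht (θ c)
  rw [h3, sub_zero] at hc'
  have h4 : θ a = c' * θ kleinQuartic := by
    have hne : (X 1 - X 2 : Poly3) ≠ 0 := by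
      intro h
      simpa using congrArg (eval ![0, 1, 0]) h
    apply mul_left_cancel₀ hne
    rw [h1, hc']
    ring
  obtain ⟨u, hu⟩ := hs a
  obtain ⟨w, hw⟩ := hs kleinQuartic
  exact ⟨u - c' * w, c', by linear_combination hu + h4 - c' * hw⟩

theorem not_kleinQuartic_dvd_X_sub_X {i : Fin 3} (h : i ≠ 2) :
    ¬ kleinQuartic ∣ (X i - X 2 : Poly3) := by
  refine not_dvd_of_isHomogeneous kleinQuartic_isHomogeneous
    ((isHomogeneous_X _ i).sub (isHomogeneous_X _ 2)) (fun h0 => h ?_) (by norm_num)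
  exact X_injective (sub_eq_zero.1 h0)

/-- Modulo f, with s = x - z and t = y - z: from sF = aG and tF = bG follows ta = sb after
cancelling G. Regularity gives a = sa', and cancelling s leaves F = a'G. -/
theorem exists_eq_mul_of_sub_mul {F G : Poly3} (hG : ¬ kleinQuartic ∣ G)
    (hs : ∃ a, kleinQuartic ∣ (X 0 - X 2) * F - a * G)
    (ht : ∃ a, kleinQuartic ∣ (X 1 - X 2) * F - a * G) : ∃ a, kleinQuartic ∣ F - a * G := by
  obtain ⟨a, ha⟩ := hs
  obtain ⟨b, hb⟩ := ht
  have h1 : kleinQuartic ∣ ((X 1 - X 2) * a - (X 0 - X 2) * b) * G := by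
    convert dvd_sub (dvd_mul_of_dvd_right hb (X 0 - X 2)) (dvd_mul_of_dvd_right ha (X 1 - X 2))
      using 1
    ring
  obtain ⟨c, hc⟩ := (kleinQuartic_prime.dvd_or_dvd h1).resolve_right hG
  obtain ⟨a', c', hac⟩ := kleinQuartic_regular_sequence (a := a) (b := b) (c := c)
    (by linear_combination hc)
  refine ⟨a', (kleinQuartic_prime.dvd_or_dvd (a := X 0 - X 2) ?_).resolve_left
    (not_kleinQuartic_dvd_X_sub_X (by decide))⟩
  have h2 : (X 0 - X 2) * (F - a' * G) = ((X 0 - X 2) * F - a * G) + kleinQuartic * (c' * G) := by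
    rw [hac]; ring
  rw [h2]
  exact dvd_add ha (dvd_mul_right _ _)

theorem exists_eq_mul_of_pow_sub_mul {G : Poly3} (hG : ¬ kleinQuartic ∣ G) (m n : ℕ) :
    ∀ F : Poly3, (∃ a, kleinQuartic ∣ (X 0 - X 2) ^ m * F - a * G) →
      (∃ a, kleinQuartic ∣ (X 1 - X 2) ^ n * F - a * G) → ∃ a, kleinQuartic ∣ F - a * G := by
  have key : ∀ m F, (∃ a, kleinQuartic ∣ (X 0 - X 2) ^ m * F - a * G) →
      (∃ a, kleinQuartic ∣ (X 1 - X 2) * F - a * G) → ∃ a, kleinQuartic ∣ F - a * G := by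
    intro m
    induction m with
    | zero => intro F h _; simpa using h
    | succ m ih =>
      rintro F ⟨a, ha⟩ ⟨b, hb⟩
      refine ih F (exists_eq_mul_of_sub_mul hG ⟨a, ?_⟩ ⟨(X 0 - X 2) ^ m * b, ?_⟩) ⟨b, hb⟩
      · convert ha using 1; ring
      · convert dvd_mul_of_dvd_right hb ((X 0 - X 2) ^ m) using 1; ring
  induction n with
  | zero => intro F _ h; simpa using h
  | succ n ih =>
    rintro F ⟨a, ha⟩ ⟨b, hb⟩
    refine ih F ⟨a, ha⟩ (key m _ ⟨(X 1 - X 2) ^ n * a, ?_⟩ ⟨b, ?_⟩)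
    · convert dvd_mul_of_dvd_right ha ((X 1 - X 2) ^ n) using 1; ring
    · convert hb using 1; ring

/-- A form whose divisor on the Klein quartic contains that of `G` is a multiple of `G` modulo the
equation of the curve. -/
theorem exists_eq_mul_of_ordAt_le {F G : Poly3} {m n : ℕ} (hF : F.IsHomogeneous (m + n))
    (hG : G.IsHomogeneous n) (hG0 : ¬ kleinQuartic ∣ G)
    (h : ∀ p, VanishesAt kleinQuartic p → ordAt kleinQuartic G p ≤ ordAt kleinQuartic F p) :
    ∃ a : Poly3, a.IsHomogeneous m ∧ kleinQuartic ∣ F - a * G := by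
  have hk := kleinQuartic_isSmoothQuartic
  -- The conductor (G, f) : F. The order condition says that its only zero is the origin; the claim
  -- is that it contains 1.
  let I : Ideal Poly3 := 
    { carrier := {s | ∃ a, kleinQuartic ∣ s * F - a * G}
      zero_mem' := ⟨0, by simp⟩
      add_mem' := by
        rintro s t ⟨a, ha⟩ ⟨b, hb⟩
        refine ⟨a + b, ?_⟩
        convert dvd_add ha hb using 1
        ring
      smul_mem' := by
        rintro c s ⟨a, ha⟩
        refine ⟨c * a, ?_⟩
        convert dvd_mul_of_dvd_right ha c using 1
        rw [smul_eq_mul]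
        ring }
  have hI : ∀ s, s ∈ I ↔ ∃ a, kleinQuartic ∣ s * F - a * G := fun s => Iff.rfl
  have hzero : ∀ v ∈ zeroLocus ℂ I, v = 0 := by
    intro v hv
    rw [mem_zeroLocus_iff] at hv
    simp only [aeval_eq_eval_complex] at hv
    by_contra hv0
    have hfv : eval v kleinQuartic = 0 := hv _ ⟨0, by simp⟩
    obtain ⟨s, hs, a, g, hsa⟩ := (hk.ordAt_le_iff
      ((vanishesAt_mk kleinQuartic_isHomogeneous hv0).2 hfv)).1
      (h _ ((vanishesAt_mk kleinQuartic_isHomogeneous hv0).2 hfv))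
    -- The denominator s need not be homogeneous. One of its components avoids the prime ideal, and
    -- the matching component of the relation puts it into I.
    obtain ⟨k, hk'⟩ : ∃ k, homogeneousComponent k s ∉ pointIdeal (Projectivization.mk ℂ v hv0) := by
      by_contra! hcon
      apply hs
      rw [← sum_homogeneousComponent s]
      exact Ideal.sum_mem _ fun i _ => hcon i
    rw [mem_pointIdeal_iff_vanishesAt (homogeneousComponent_isHomogeneous k s),
      vanishesAt_mk (homogeneousComponent_isHomogeneous k s)] at hk'
    apply hk'
    apply hv
    have h1 := congrArg (homogeneousComponent (k + (m + n))) hsa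
    rw [homogeneousComponent_mul_of_isHomogeneous hF, map_add, ← add_assoc,
      homogeneousComponent_mul_of_isHomogeneous hG] at h1
    refine ⟨homogeneousComponent (k + m) a, ?_⟩
    rw [h1, add_sub_cancel_left]
    exact dvd_homogeneousComponent kleinQuartic_isHomogeneous (dvd_mul_left _ _) _
  have hrad : ∀ s : Poly3, eval 0 s = 0 → ∃ N, s ^ N ∈ I := by
    intro s hs
    have : s ∈ vanishingIdeal ℂ (zeroLocus ℂ I) := by
      rw [mem_vanishingIdeal_iff]
      intro v hv
      rw [hzero v hv, aeval_eq_eval_complex, hs]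
    rwa [vanishingIdeal_zeroLocus_eq_radical] at this
  -- Powers of x - z and y - z lie in I by the Nullstellensatz; the regular sequence then strips
  -- them off.
  obtain ⟨M, hM⟩ := hrad (X 0 - X 2) (by simp)
  obtain ⟨N, hN⟩ := hrad (X 1 - X 2) (by simp)
  obtain ⟨a, g, ha⟩ := exists_eq_mul_of_pow_sub_mul hG0 M N F hM hN
  refine ⟨homogeneousComponent m a, homogeneousComponent_isHomogeneous _ _, ?_⟩
  have := dvd_homogeneousComponent kleinQuartic_isHomogeneous ⟨g, ha⟩ (m + n)
  rwa [map_sub, homogeneousComponent_mul_of_isHomogeneous hG, homogeneousComponent_eq_self hF]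
    at this

/-! ## Principal divisors -/

namespace IsSmoothQuartic

variable {f : Poly3} (hf : IsSmoothQuartic f)

include hf in
theorem coe_vanishingOrder {p : PPlane} (hp : VanishesAt f p) {F : Poly3} (hF : ¬ f ∣ F) :
    (vanishingOrder f F p : ℕ∞) = ordAt f F p :=
  ENat.natCast_toNat fun h => hF ((hf.ordAt_eq_top_iff hp).1 h)

include hf in
theorem vanishingOrder_mul {p : PPlane} (hp : VanishesAt f p) {F G : Poly3} (hF : ¬ f ∣ F)
    (hG : ¬ f ∣ G) :
    vanishingOrder f (F * G) p = vanishingOrder f F p + vanishingOrder f G p := by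
  have hFG : ¬ f ∣ F * G := fun h => (hf.prime.dvd_or_dvd h).elim hF hG
  have h := hf.ordAt_mul hp F G
  rw [← hf.coe_vanishingOrder hp hF, ← hf.coe_vanishingOrder hp hG,
    ← hf.coe_vanishingOrder hp hFG] at h
  exact_mod_cast h

include hf in
theorem not_dvd_mul {F G : Poly3} (hF : ¬ f ∣ F) (hG : ¬ f ∣ G) : ¬ f ∣ F * G :=
  fun h => (hf.prime.dvd_or_dvd h).elim hF hG

/-- The divisors of nonzero rational functions. -/
def principalDivisors : AddSubgroup (CurveDiv f) where
  carrier := {E | ∃ (d : ℕ) (F G : Poly3), F.IsHomogeneous d ∧ G.IsHomogeneous d ∧ ¬ f ∣ F ∧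
    ¬ f ∣ G ∧ ∀ p : CurvePt f, E p = (vanishingOrder f F p.1 : ℤ) - vanishingOrder f G p.1}
  zero_mem' := ⟨0, 1, 1, isHomogeneous_one _ _, isHomogeneous_one _ _,
    fun h => hf.prime.not_isUnit (isUnit_of_dvd_one h),
    fun h => hf.prime.not_isUnit (isUnit_of_dvd_one h), fun p => by simp⟩
  add_mem' := by
    rintro E E' ⟨d, F, G, hF, hG, hF0, hG0, h⟩ ⟨d', F', G', hF', hG', hF0', hG0', h'⟩
    refine ⟨d + d', F * F', G * G', hF.mul hF', hG.mul hG', hf.not_dvd_mul hF0 hF0',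
      hf.not_dvd_mul hG0 hG0', fun p => ?_⟩
    rw [Finsupp.add_apply, h, h', hf.vanishingOrder_mul p.2 hF0 hF0',
      hf.vanishingOrder_mul p.2 hG0 hG0']
    push_cast
    ring
  neg_mem' := by
    rintro E ⟨d, F, G, hF, hG, hF0, hG0, h⟩
    refine ⟨d, G, F, hG, hF, hG0, hF0, fun p => ?_⟩
    rw [Finsupp.neg_apply, h]
    ring

theorem linEquiv_iff {D₁ D₂ : CurveDiv f} :
    LinEquiv f D₁ D₂ ↔ D₁ - D₂ ∈ hf.principalDivisors := by
  constructor
  · rintro ⟨u, d, F, G, hF, hG, hF0, hG0, -, h⟩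
    exact ⟨d, F, G, hF, hG, hF0, hG0, h⟩
  · rintro ⟨d, F, G, hF, hG, hF0, hG0, h⟩
    have : (Ideal.span {f}).IsPrime := (Ideal.span_singleton_prime hf.prime.ne_zero).2 hf.prime
    have hG1 : (Ideal.Quotient.mk (Ideal.span {f}) G) ≠ 0 := by
      rwa [Ne, Ideal.Quotient.eq_zero_iff_mem, Ideal.mem_span_singleton]
    refine ⟨IsLocalization.mk' (FracRing f) (Ideal.Quotient.mk (Ideal.span {f}) F)
      ⟨_, mem_nonZeroDivisors_of_ne_zero hG1⟩, d, F, G, hF, hG, hF0, hG0, ?_, h⟩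
    exact IsLocalization.mk'_spec _ _ _

end IsSmoothQuartic

/-! ## Regular maps and orders of vanishing -/

theorem eval_aeval_poly (Φ : Fin 3 → Poly3) (v : Fin 3 → ℂ) (H : Poly3) :
    eval v (aeval Φ H) = eval (fun i => eval v (Φ i)) H := by
  have : (eval v).comp (aeval Φ).toRingHom = eval (fun i => eval v (Φ i)) := by
    apply MvPolynomial.ringHom_ext
    · intro r; simp [algebraMap_eq]
    · intro i; simp
  exact RingHom.congr_fun this H

theorem aeval_sub_aeval_mem {I : Ideal Poly3} {a b : Fin 3 → Poly3} (h : ∀ i, a i - b i ∈ I)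
    (P : Poly3) : aeval a P - aeval b P ∈ I := by
  rw [← Ideal.Quotient.eq]
  have : (Ideal.Quotient.mkₐ ℂ I).comp (aeval a) = (Ideal.Quotient.mkₐ ℂ I).comp (aeval b) := by
    apply MvPolynomial.algHom_ext
    intro i
    simp only [AlgHom.comp_apply, aeval_X, Ideal.Quotient.mkₐ_eq_mk]
    rw [Ideal.Quotient.eq]
    exact h i
  exact congrArg (fun g => g P) this

/-- Proportional triples of polynomials give proportional values of forms. -/
theorem dvd_aeval_mul_pow_sub {f : Poly3} {Φ Ψ : Fin 3 → Poly3}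
    (h : ∀ i j, f ∣ Φ i * Ψ j - Φ j * Ψ i) {H : Poly3} {n : ℕ} (hH : H.IsHomogeneous n)
    (j : Fin 3) : f ∣ aeval Φ H * Ψ j ^ n - aeval Ψ H * Φ j ^ n := by
  rw [mul_comm _ (Ψ j ^ n), mul_comm _ (Φ j ^ n), ← aeval_mul_left_of_isHomogeneous hH,
    ← aeval_mul_left_of_isHomogeneous hH, ← Ideal.mem_span_singleton]
  refine aeval_sub_aeval_mem (fun i => ?_) H
  rw [Ideal.mem_span_singleton, mul_comm (Ψ j)]
  exact h i j

/-- The forms `Φ` of degree `d` define the map `τ` where the form `G` does not vanish. -/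
structure IsRep (f : Poly3) (τ : CurvePt f → CurvePt f) (d : ℕ) (Φ : Fin 3 → Poly3) (e : ℕ)
    (G : Poly3) : Prop where
  degree_ne_zero : d ≠ 0
  degree_ne_zero' : e ≠ 0
  homogeneous : ∀ i, (Φ i).IsHomogeneous d
  homogeneous' : G.IsHomogeneous e
  apply_eq : ∀ q : CurvePt f, ¬ VanishesAt G q.1 →
    ∃ hq : (fun i => eval q.1.rep (Φ i)) ≠ 0, (τ q).1 = Projectivization.mk ℂ _ hq

/-- Multiplying by a coordinate that does not vanish at q makes both degrees positive. -/
theorem IsRegularMap.exists_isRep {f : Poly3} {τ : CurvePt f → CurvePt f} (hτ : IsRegularMap f τ)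
    (q : CurvePt f) : ∃ d Φ e G, IsRep f τ d Φ e G ∧ ¬ VanishesAt G q.1 := by
  obtain ⟨d, Φ, e, G, hΦ, hG, hGq, h⟩ := hτ q
  obtain ⟨k, hk⟩ : ∃ k, q.1.rep k ≠ 0 := by
    by_contra! h; exact q.1.rep_nonzero (funext h)
  have hX : ∀ q' : CurvePt f, VanishesAt (X k) q'.1 ↔ q'.1.rep k = 0 := fun q' => by
    simp [VanishesAt]
  refine ⟨1 + d, fun i => X k * Φ i, 1 + e, X k * G, ⟨by omega, by omega, fun i =>
    (isHomogeneous_X _ k).mul (hΦ i), (isHomogeneous_X _ k).mul hG, fun q' hq' => ?_⟩, ?_⟩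
  · rw [vanishesAt_mul, hX, not_or] at hq'
    obtain ⟨hq, he⟩ := h q' hq'.2
    have hs : (fun i => eval q'.1.rep (X k * Φ i)) =
        q'.1.rep k • (fun i => eval q'.1.rep (Φ i)) := by
      funext i; simp
    refine ⟨hs ▸ smul_ne_zero hq'.1 hq, ?_⟩
    rw [he, Projectivization.mk_eq_mk_iff']
    refine ⟨(q'.1.rep k)⁻¹, ?_⟩
    rw [hs, smul_smul, inv_mul_cancel₀ hq'.1, one_smul]
  · rw [vanishesAt_mul, hX, not_or]
    exact ⟨hk, hGq⟩

namespace IsRep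

variable {f : Poly3} (hf : IsSmoothQuartic f) {τ : CurvePt f → CurvePt f} {d : ℕ}
  {Φ : Fin 3 → Poly3} {e : ℕ} {G : Poly3} (h : IsRep f τ d Φ e G)

include h in
theorem exists_rep_eq {q : CurvePt f} (hq : ¬ VanishesAt G q.1) :
    ∃ c : ℂ, c ≠ 0 ∧ (fun i => eval q.1.rep (Φ i)) = c • (τ q).1.rep := by
  obtain ⟨h0, he⟩ := h.apply_eq q hq
  obtain ⟨a, ha⟩ := Projectivization.exists_smul_eq_mk_rep ℂ _ h0
  refine ⟨((a⁻¹ : ℂˣ) : ℂ), Units.ne_zero _, ?_⟩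
  rw [he, ← ha]
  funext i
  simp [Units.smul_def]

include h in
theorem exists_not_vanishesAt {q : CurvePt f} (hq : ¬ VanishesAt G q.1) :
    ∃ j, ¬ VanishesAt (Φ j) q.1 := by
  obtain ⟨h0, -⟩ := h.apply_eq q hq
  by_contra! hcon
  exact h0 (funext hcon)

include h in
theorem vanishesAt_aeval_iff {q : CurvePt f} (hq : ¬ VanishesAt G q.1) {H : Poly3} {n : ℕ}
    (hH : H.IsHomogeneous n) : VanishesAt (aeval Φ H) q.1 ↔ VanishesAt H (τ q).1 := by
  obtain ⟨c, hc, he⟩ := h.exists_rep_eq hq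
  rw [VanishesAt, eval_aeval_poly, he, eval_smul_of_isHomogeneous hH]
  simp [VanishesAt, hc]

include h in
theorem aeval_mem_pointIdeal_iff {q : CurvePt f} (hq : ¬ VanishesAt G q.1) {H : Poly3} :
    aeval Φ H ∈ pointIdeal q.1 ↔ H ∈ pointIdeal (τ q).1 := by
  obtain ⟨c, hc, he⟩ := h.exists_rep_eq hq
  have key : ∀ t : ℂ, eval (t • q.1.rep) (aeval Φ H) = eval ((t ^ d * c) • (τ q).1.rep) H := by
    intro t
    rw [eval_aeval_poly, mul_smul, ← he]
    congr 2
    funext i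
    exact eval_smul_of_isHomogeneous (h.homogeneous i) t _
  rw [mem_pointIdeal, mem_pointIdeal]
  constructor
  · intro hz t
    -- On the cone the substitution multiplies the parameter of the line by t ↦ c·t^d, which is onto
    -- since d > 0.
    obtain ⟨s, hs⟩ := IsAlgClosed.exists_pow_nat_eq (t * c⁻¹) (Nat.pos_of_ne_zero h.degree_ne_zero)
    have := hz s
    rwa [key, hs, inv_mul_cancel_right₀ hc] at this
  · intro hz t
    rw [key, hz]

theorem not_dvd {q : CurvePt f} (hq : ¬ VanishesAt G q.1) : ¬ f ∣ G := by
  rintro ⟨g, rfl⟩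
  exact hq (vanishesAt_mul.2 (Or.inl q.2))

include hf h

theorem dvd_aeval_self {q : CurvePt f} (hq : ¬ VanishesAt G q.1) : f ∣ aeval Φ f := by
  refine (hf.prime.dvd_or_dvd (hf.dvd_of_forall_vanishesAt
    (h.homogeneous'.mul (hf.homogeneous.aeval Φ h.homogeneous)) ?_ ?_)).resolve_left
      (not_dvd hq)
  · have := h.degree_ne_zero'
    omega
  · intro p hp
    rw [vanishesAt_mul]
    by_cases hG : VanishesAt G p
    · exact Or.inl hG
    · exact Or.inr ((h.vanishesAt_aeval_iff (q := ⟨p, hp⟩) hG hf.homogeneous).2 (τ ⟨p, hp⟩).2)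

/-- The witness s·H = a + g·f of the order at the image is pulled back along Φ: f goes to a multiple
of f and the ideal of τ q goes into the ideal of q. -/
theorem ordAt_le {q : CurvePt f} (hq : ¬ VanishesAt G q.1) (H : Poly3) :
    ordAt f H (τ q).1 ≤ ordAt f (aeval Φ H) q.1 := by
  rw [← ENat.forall_natCast_le_iff_le]
  intro n hn
  rw [hf.le_ordAt_iff (τ q).2] at hn
  obtain ⟨s, hs, a, ha, g, hsa⟩ := hn
  rw [hf.le_ordAt_iff q.2]
  obtain ⟨b, hb⟩ := h.dvd_aeval_self hf hq
  refine ⟨aeval Φ s, fun hc => hs ((h.aeval_mem_pointIdeal_iff hq).1 hc), aeval Φ a, ?_,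
    aeval Φ g * b, ?_⟩
  · have h1 : (pointIdeal (τ q).1).map (aeval Φ : Poly3 →ₐ[ℂ] Poly3) ≤ pointIdeal q.1 := by
      rw [Ideal.map_le_iff_le_comap]
      intro x hx
      exact (h.aeval_mem_pointIdeal_iff hq).2 hx
    have h2 := Ideal.mem_map_of_mem (aeval Φ : Poly3 →ₐ[ℂ] Poly3) ha
    rw [Ideal.map_pow] at h2
    exact Ideal.pow_right_mono h1 n h2
  · rw [← map_mul, hsa, map_add, map_mul, hb]
    ring

/-- Two representations of a map are proportional. -/
theorem dvd_mul_sub_mul {d' e' : ℕ} {Ψ : Fin 3 → Poly3} {G' : Poly3} (h' : IsRep f τ d' Ψ e' G')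
    {q q' : CurvePt f} (hq : ¬ VanishesAt G q.1) (hq' : ¬ VanishesAt G' q'.1) (i j : Fin 3) :
    f ∣ Φ i * Ψ j - Φ j * Ψ i := by
  have hhom : (Φ i * Ψ j - Φ j * Ψ i).IsHomogeneous (d + d') :=
    ((h.homogeneous i).mul (h'.homogeneous j)).sub ((h.homogeneous j).mul (h'.homogeneous i))
  refine (hf.prime.dvd_or_dvd (hf.dvd_of_forall_vanishesAt
    ((h.homogeneous'.mul h'.homogeneous').mul hhom) ?_ ?_)).resolve_left
      (hf.not_dvd_mul (not_dvd hq) (not_dvd hq'))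
  · have := h.degree_ne_zero'
    omega
  · intro p hp
    rw [vanishesAt_mul, vanishesAt_mul, or_assoc]
    by_cases hG : VanishesAt G p
    · exact Or.inl hG
    by_cases hG' : VanishesAt G' p
    · exact Or.inr (Or.inl hG')
    refine Or.inr (Or.inr ?_)
    obtain ⟨c, -, hc⟩ := h.exists_rep_eq (q := ⟨p, hp⟩) hG
    obtain ⟨c', -, hc'⟩ := h'.exists_rep_eq (q := ⟨p, hp⟩) hG'
    have h1 : ∀ i, eval p.rep (Φ i) = c * (τ ⟨p, hp⟩).1.rep i := fun i => congrFun hc i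
    have h2 : ∀ i, eval p.rep (Ψ i) = c' * (τ ⟨p, hp⟩).1.rep i := fun i => congrFun hc' i
    rw [VanishesAt, map_sub, map_mul, map_mul, h1, h1, h2, h2]
    ring

/-- An invertible regular map preserves orders of vanishing. -/
theorem ordAt_aeval {σ : CurvePt f → CurvePt f} (hσ : IsRegularMap f σ)
    (hστ : Function.LeftInverse σ τ) (hτσ : Function.LeftInverse τ σ) {q : CurvePt f}
    (hq : ¬ VanishesAt G q.1) {H : Poly3} {n : ℕ} (hH : H.IsHomogeneous n) :
    ordAt f (aeval Φ H) q.1 = ordAt f H (τ q).1 := by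
  refine le_antisymm ?_ (h.ordAt_le hf hq H)
  -- The reverse inequality is the same bound for the inverse map. The composite representation Θ is
  -- proportional to the identity, so substituting it changes H only by factors that do not vanish
  -- at the point.
  obtain ⟨d', Ψ, e', G', h', hr⟩ := hσ.exists_isRep (τ q)
  have h1 := h'.ordAt_le hf hr (aeval Φ H)
  rw [hστ q] at h1
  refine h1.trans (le_of_eq ?_)
  set Θ : Fin 3 → Poly3 := fun i => aeval Ψ (Φ i) with hΘ
  have hΘH : aeval Ψ (aeval Φ H) = aeval Θ H := by
    have : (aeval Ψ).comp (aeval Φ) = (aeval Θ : Poly3 →ₐ[ℂ] Poly3) := by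
      apply MvPolynomial.algHom_ext
      intro i
      simp [hΘ]
    exact congrArg (fun g => g H) this
  have hΘhom : ∀ i, (Θ i).IsHomogeneous (d' * d) := fun i =>
    (h.homogeneous i).aeval Ψ h'.homogeneous
  have hΘr : ∀ p : CurvePt f, ¬ VanishesAt G' p.1 → ¬ VanishesAt (aeval Ψ G) p.1 →
      ∃ c : ℂ, c ≠ 0 ∧ ∀ i, eval p.1.rep (Θ i) = c * p.1.rep i := by
    intro p hp1 hp2
    rw [h'.vanishesAt_aeval_iff hp1 h.homogeneous'] at hp2
    obtain ⟨c, hc0, hc⟩ := h'.exists_rep_eq hp1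
    obtain ⟨c', hc0', hc'⟩ := h.exists_rep_eq hp2
    rw [hτσ p] at hc'
    refine ⟨c ^ d * c', mul_ne_zero (pow_ne_zero _ hc0) hc0', fun i => ?_⟩
    rw [hΘ, eval_aeval_poly, hc, eval_smul_of_isHomogeneous (h.homogeneous i), mul_assoc]
    congr 1
    exact congrFun hc' i
  have hG2 : ¬ VanishesAt (aeval Ψ G) (τ q).1 := by
    rwa [h'.vanishesAt_aeval_iff hr h.homogeneous', hστ q]
  have hprop : ∀ i j, f ∣ Θ i * X j - Θ j * X i := by
    intro i j
    have hhom : (Θ i * X j - Θ j * X i).IsHomogeneous (d' * d + 1) :=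
      ((hΘhom i).mul (isHomogeneous_X _ j)).sub ((hΘhom j).mul (isHomogeneous_X _ i))
    refine (hf.prime.dvd_or_dvd (hf.dvd_of_forall_vanishesAt
      ((h'.homogeneous'.mul (h.homogeneous'.aeval Ψ h'.homogeneous)).mul hhom) (by omega)
        ?_)).resolve_left (hf.not_dvd_mul (not_dvd hr) (not_dvd hG2))
    intro p hp
    rw [vanishesAt_mul, vanishesAt_mul, or_assoc]
    by_cases h1 : VanishesAt G' p
    · exact Or.inl h1
    by_cases h2 : VanishesAt (aeval Ψ G) p
    · exact Or.inr (Or.inl h2)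
    obtain ⟨c, -, hc⟩ := hΘr ⟨p, hp⟩ h1 h2
    refine Or.inr (Or.inr ?_)
    rw [VanishesAt, map_sub, map_mul, map_mul, hc, hc, eval_X, eval_X]
    ring
  obtain ⟨j, hj⟩ : ∃ j, (τ q).1.rep j ≠ 0 := by
    by_contra! hcon; exact (τ q).1.rep_nonzero (funext hcon)
  obtain ⟨c, hc0, hc⟩ := hΘr (τ q) hr hG2
  have hcong := ordAt_congr (τ q).1 (dvd_aeval_mul_pow_sub hprop hH j)
  rw [aeval_X_left_apply, hf.ordAt_mul (τ q).2, hf.ordAt_mul (τ q).2, hf.ordAt_pow (τ q).2,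
    hf.ordAt_pow (τ q).2, (hf.ordAt_eq_zero_iff (τ q).2 (isHomogeneous_X _ j)).2 (by
      simpa [VanishesAt] using hj), (hf.ordAt_eq_zero_iff (τ q).2 (hΘhom j)).2 (by
      rw [VanishesAt, hc]; exact mul_ne_zero hc0 hj)] at hcong
  rw [hΘH]
  simpa using hcong

end IsRep

/-- Automorphisms of the curve map principal divisors to principal divisors. -/
theorem IsSmoothQuartic.mapDomain_mem_principalDivisors {f : Poly3} (hf : IsSmoothQuartic f)
    {σ : Equiv.Perm (CurvePt f)} (hσ : IsCurveAut f σ) {E : CurveDiv f}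
    (hE : E ∈ hf.principalDivisors) : Finsupp.mapDomain σ E ∈ hf.principalDivisors := by
  rcases isEmpty_or_nonempty (CurvePt f) with hemp | ⟨⟨q₀⟩⟩
  · rw [Subsingleton.elim (Finsupp.mapDomain σ E) 0]
    exact zero_mem _
  obtain ⟨n, F, G, hF, hG, hF0, hG0, hFG⟩ := hE
  obtain ⟨d, Φ, e, U, h, hU⟩ := hσ.2.exists_isRep q₀
  have hinv1 : Function.LeftInverse σ σ.symm := σ.apply_symm_apply
  have hinv2 : Function.LeftInverse σ.symm σ := σ.symm_apply_apply
  have hnd : ∀ H : Poly3, H.IsHomogeneous n → ¬ f ∣ H → ¬ f ∣ aeval Φ H := by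
    intro H hH hH0
    rw [← hf.ordAt_eq_top_iff q₀.2, h.ordAt_aeval hf hσ.1 hinv1 hinv2 hU hH,
      hf.ordAt_eq_top_iff (σ.symm q₀).2]
    exact hH0
  refine ⟨d * n, aeval Φ F, aeval Φ G, hF.aeval Φ h.homogeneous, hG.aeval Φ h.homogeneous,
    hnd F hF hF0, hnd G hG hG0, fun q => ?_⟩
  -- The fixed representation Φ may vanish identically at q. Comparison with a representation Ψ good
  -- at q adds n times the order of Φ j, the same amount for F and G, so it cancels.
  obtain ⟨d', Ψ, e', U', h', hU'⟩ := hσ.2.exists_isRep q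
  obtain ⟨j, hj⟩ := h'.exists_not_vanishesAt hU'
  have hprop := fun i j => h.dvd_mul_sub_mul hf h' hU hU' i j
  have hΦj : ¬ f ∣ Φ j := by
    intro hcon
    obtain ⟨i, hi⟩ := h.exists_not_vanishesAt hU
    have h1 : f ∣ Φ i * Ψ j := by
      have := dvd_add (hprop i j) (dvd_mul_of_dvd_left hcon (Ψ i))
      rwa [sub_add_cancel] at this
    exact hf.not_dvd_mul (IsRep.not_dvd hi) (IsRep.not_dvd hj) h1
  have key : ∀ H : Poly3, H.IsHomogeneous n → ¬ f ∣ H → vanishingOrder f (aeval Φ H) q.1 =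
      vanishingOrder f H (σ.symm q).1 + n * vanishingOrder f (Φ j) q.1 := by
    intro H hH hH0
    have hcong := ordAt_congr q.1 (dvd_aeval_mul_pow_sub hprop hH j)
    rw [hf.ordAt_mul q.2, hf.ordAt_mul q.2, hf.ordAt_pow q.2, hf.ordAt_pow q.2,
      (hf.ordAt_eq_zero_iff q.2 (h'.homogeneous j)).2 hj,
      h'.ordAt_aeval hf hσ.1 hinv1 hinv2 hU' hH, ← hf.coe_vanishingOrder q.2 (hnd H hH hH0),
      ← hf.coe_vanishingOrder q.2 hΦj, ← hf.coe_vanishingOrder (σ.symm q).2 hH0, smul_zero,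
      add_zero, nsmul_eq_mul] at hcong
    exact_mod_cast hcong
  rw [Finsupp.mapDomain_equiv_apply, hFG, key F hF hF0, key G hG hG0]
  push_cast
  ring

/-! ## Transversality at points with given coordinates -/

theorem exists_rep_mk_eq {v : Fin 3 → ℂ} (hv : v ≠ 0) :
    ∃ c : ℂ, c ≠ 0 ∧ (Projectivization.mk ℂ v hv).rep = c • v := by
  obtain ⟨a, ha⟩ := Projectivization.exists_smul_eq_mk_rep ℂ v hv
  exact ⟨a, a.ne_zero, ha.symm⟩

theorem IsSmoothQuartic.ordAt_mk_eq_one {f : Poly3} (hf : IsSmoothQuartic f) {v : Fin 3 → ℂ}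
    (hv : v ≠ 0) (hfv : eval v f = 0) {F : Poly3} {d : ℕ} (hF : F.IsHomogeneous d)
    (hFv : eval v F = 0) (hc : gradientAt F v ⨯₃ gradientAt f v ≠ 0) :
    ordAt f F (Projectivization.mk ℂ v hv) = 1 := by
  refine hf.ordAt_eq_one ((vanishesAt_mk hf.homogeneous hv).2 hfv) hF
    ((vanishesAt_mk hF hv).2 hFv) ?_
  obtain ⟨c, hc0, hrep⟩ := exists_rep_mk_eq hv
  rw [hrep, gradientAt_smul hF, gradientAt_smul hf.homogeneous, map_smul, map_smul,
    LinearMap.smul_apply]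
  exact smul_ne_zero (pow_ne_zero _ hc0) (smul_ne_zero (pow_ne_zero _ hc0) hc)

theorem IsSmoothQuartic.cross_eq_zero_of_two_le_ordAt {f : Poly3} (hf : IsSmoothQuartic f)
    {v : Fin 3 → ℂ} (hv : v ≠ 0) (hfv : eval v f = 0) {F : Poly3} {d : ℕ}
    (hF : F.IsHomogeneous d) (h : 2 ≤ ordAt f F (Projectivization.mk ℂ v hv)) :
    eval v F = 0 ∧ gradientAt F v ⨯₃ gradientAt f v = 0 := by
  have hp := (vanishesAt_mk hf.homogeneous hv).2 hfv
  have h0 : eval v F = 0 := by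
    rw [← vanishesAt_mk hF hv]
    by_contra h0
    rw [(hf.ordAt_eq_zero_iff hp hF).2 h0] at h
    norm_num at h
  refine ⟨h0, ?_⟩
  by_contra hc
  rw [hf.ordAt_mk_eq_one hv hfv hF h0 hc] at h
  norm_num at h

theorem IsSmoothQuartic.ordAt_add_eq_of_lt {f : Poly3} (hf : IsSmoothQuartic f) {p : PPlane}
    (hp : VanishesAt f p) {F G : Poly3} (h : ordAt f F p < ordAt f G p) :
    ordAt f (F + G) p = ordAt f F p := by
  apply le_antisymm
  · have h1 := hf.min_ordAt_le_add hp (F + G) ((-1) * G)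
    have h2 : ordAt f (-1 : Poly3) p = 0 := by
      rw [hf.ordAt_eq_zero_iff hp (isHomogeneous_one _ _).neg]
      simp [VanishesAt]
    rw [hf.ordAt_mul hp, h2, zero_add, show F + G + -1 * G = F by ring, min_le_iff] at h1
    exact h1.resolve_right (not_le.2 h)
  · have := hf.min_ordAt_le_add hp F G
    rwa [min_eq_left h.le] at this

/-! ## Divisors cut out by forms -/

/-- `F` is a form of degree `d` that cuts out the divisor `E` on the curve `f = 0`. -/
structure CutsOut (f F : Poly3) (d : ℕ) (E : CurveDiv f) : Prop where
  homogeneous : F.IsHomogeneous d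
  not_dvd : ¬ f ∣ F
  apply_eq : ∀ p : CurvePt f, E p = vanishingOrder f F p.1

namespace CutsOut

variable {f F G : Poly3} {d e : ℕ} {D E : CurveDiv f}

theorem mul (hf : IsSmoothQuartic f) (hF : CutsOut f F d D) (hG : CutsOut f G e E) :
    CutsOut f (F * G) (d + e) (D + E) :=
  ⟨hF.homogeneous.mul hG.homogeneous, hf.not_dvd_mul hF.not_dvd hG.not_dvd, fun p => by
    rw [hf.vanishingOrder_mul p.2 hF.not_dvd hG.not_dvd, Finsupp.add_apply, hF.apply_eq,
      hG.apply_eq, Nat.cast_add]⟩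

theorem sub_mem_principalDivisors (hf : IsSmoothQuartic f) (hF : CutsOut f F d D)
    (hG : CutsOut f G d E) : D - E ∈ hf.principalDivisors :=
  ⟨d, F, G, hF.homogeneous, hG.homogeneous, hF.not_dvd, hG.not_dvd, fun p => by
    rw [Finsupp.sub_apply, hF.apply_eq, hG.apply_eq]⟩

theorem isLineSection (hF : CutsOut f F 1 D) : IsLineSection f D :=
  ⟨F, hF.homogeneous, fun h => hF.not_dvd (h ▸ dvd_zero f), hF.apply_eq⟩

end CutsOut

theorem IsLineSection.exists_cutsOut {f : Poly3} (hf : IsSmoothQuartic f) {h : CurveDiv f}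
    (hh : IsLineSection f h) : ∃ l, CutsOut f l 1 h := by
  obtain ⟨l, hl, hl0, hdiv⟩ := hh
  exact ⟨l, hl, not_dvd_of_isHomogeneous hf.homogeneous hl hl0 (by norm_num), hdiv⟩

/-! ## The coordinate points of the Klein quartic -/

theorem single_one_ne_zero (k : Fin 3) : (Pi.single k 1 : Fin 3 → ℂ) ≠ 0 := fun h => by
  simpa using congrFun h k

/-- The point of the Klein quartic with the coordinate vector `v`. -/
noncomputable def kleinPt (v : Fin 3 → ℂ) (hv : v ≠ 0) (h : eval v kleinQuartic = 0) : CurvePt kleinQuartic :=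
  ⟨Projectivization.mk ℂ v hv, (vanishesAt_mk kleinQuartic_isHomogeneous hv).2 h⟩

theorem eval_single_kleinQuartic (k : Fin 3) :
    eval (Pi.single k 1 : Fin 3 → ℂ) kleinQuartic = 0 := by
  rw [eval_kleinQuartic]
  fin_cases k <;> simp

/-- The coordinate points, which are flexes of the Klein quartic. -/
noncomputable def coordPt (k : Fin 3) : CurvePt kleinQuartic :=
  kleinPt (Pi.single k 1) (single_one_ne_zero k) (eval_single_kleinQuartic k)

theorem exists_eq_kleinPt (p : CurvePt kleinQuartic) : ∃ v hv h, p = kleinPt v hv h :=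
  ⟨p.1.rep, p.1.rep_nonzero, p.2, Subtype.ext p.1.mk_rep.symm⟩

theorem kleinPt_eq_iff {v w : Fin 3 → ℂ} {hv : v ≠ 0} {hw : w ≠ 0} {h : eval v kleinQuartic = 0}
    {h' : eval w kleinQuartic = 0} : kleinPt v hv h = kleinPt w hw h' ↔ ∃ c : ℂ, c • w = v := by
  exact Subtype.ext_iff.trans (Projectivization.mk_eq_mk_iff' ..)

theorem coordPt_injective : Function.Injective coordPt := by
  intro i j hij
  obtain ⟨c, hc⟩ := kleinPt_eq_iff.1 hij
  by_contra hne
  simpa [hne] using congrFun hc i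

theorem gradientAt_X (i : Fin 3) (v : Fin 3 → ℂ) : gradientAt (X i) v = Pi.single i 1 := by
  funext j
  rw [gradientAt, pderiv_X]
  by_cases h : i = j
  · subst h; simp
  · simp [h, Ne.symm h]

theorem kleinQuartic_eq_rotate (k : Fin 3) : kleinQuartic =
    X k ^ 3 * X (k + 1) + X (k + 1) ^ 3 * X (k + 2) + X (k + 2) ^ 3 * X k := by
  fin_cases k <;> simp [kleinQuartic] <;> ring

theorem ordAt_X_coordPt (k : Fin 3) : ordAt kleinQuartic (X k) (coordPt k).1 = 0 := by
  rw [kleinQuartic_isSmoothQuartic.ordAt_eq_zero_iff (coordPt k).2 (isHomogeneous_X _ _)]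
  refine (not_congr (vanishesAt_mk (isHomogeneous_X _ _) (single_one_ne_zero k))).2 ?_
  simp

theorem ordAt_X_add_two_coordPt (k : Fin 3) : ordAt kleinQuartic (X (k + 2)) (coordPt k).1 = 1 := by
  refine kleinQuartic_isSmoothQuartic.ordAt_mk_eq_one (single_one_ne_zero k) (eval_single_kleinQuartic k)
    (isHomogeneous_X _ _) ?_ ?_
  · fin_cases k <;> simp
  · rw [gradientAt_X, gradientAt_kleinQuartic]
    fin_cases k <;> simp [cross_apply]

/-- On the curve X (k+1) times a unit equals X (k+2)³ times a unit, and X (k+2) has order one here: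
the point is a flex. -/
theorem ordAt_X_add_one_coordPt (k : Fin 3) : ordAt kleinQuartic (X (k + 1)) (coordPt k).1 = 3 := by
  have hp := (coordPt k).2
  have hcong : ordAt kleinQuartic (X (k + 1) * (X k ^ 3 + X (k + 1) ^ 2 * X (k + 2))) (coordPt k).1 =
      ordAt kleinQuartic (X (k + 2) ^ 3 * (C (-1) * X k)) (coordPt k).1 := by
    refine ordAt_congr _ ⟨1, ?_⟩
    conv_rhs => rw [kleinQuartic_eq_rotate k]
    rw [C_neg, C_1]
    ring
  have hu : ordAt kleinQuartic (X k ^ 3 + X (k + 1) ^ 2 * X (k + 2)) (coordPt k).1 = 0 := by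
    have hhom : (X k ^ 3 + X (k + 1) ^ 2 * X (k + 2) : Poly3).IsHomogeneous 3 :=
      (isHomogeneous_X_pow _ _).add ((isHomogeneous_X_pow _ _).mul (isHomogeneous_X _ _))
    rw [kleinQuartic_isSmoothQuartic.ordAt_eq_zero_iff hp hhom]
    refine (not_congr (vanishesAt_mk hhom (single_one_ne_zero k))).2 ?_
    fin_cases k <;> simp
  have hC : ordAt kleinQuartic (C (-1) : Poly3) (coordPt k).1 = 0 := by
    rw [kleinQuartic_isSmoothQuartic.ordAt_eq_zero_iff hp (isHomogeneous_C _ _)]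
    simp [VanishesAt]
  rw [kleinQuartic_isSmoothQuartic.ordAt_mul hp, kleinQuartic_isSmoothQuartic.ordAt_mul hp, kleinQuartic_isSmoothQuartic.ordAt_mul hp, kleinQuartic_isSmoothQuartic.ordAt_pow hp, hu, hC,
    ordAt_X_coordPt, ordAt_X_add_two_coordPt] at hcong
  simpa using hcong

theorem eq_coordPt_of_apply_eq_zero {v : Fin 3 → ℂ} {hv : v ≠ 0} {h : eval v kleinQuartic = 0} {i : Fin 3}
    (hi : v i = 0) : kleinPt v hv h = coordPt (i + 1) ∨ kleinPt v hv h = coordPt (i + 2) := by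
  have hj : v (i + 1) = 0 ∨ v (i + 2) = 0 := by
    have h' := h
    rw [kleinQuartic_eq_rotate i] at h'
    simpa [hi] using h'
  rcases hj with hj | hj
  · right
    refine kleinPt_eq_iff.2 ⟨v (i + 2), ?_⟩
    funext k
    fin_cases i <;> fin_cases k <;> simp_all
  · left
    refine kleinPt_eq_iff.2 ⟨v (i + 1), ?_⟩
    funext k
    fin_cases i <;> fin_cases k <;> simp_all

theorem ordAt_X_of_ne {i : Fin 3} {p : CurvePt kleinQuartic} (h1 : p ≠ coordPt (i + 1))
    (h2 : p ≠ coordPt (i + 2)) : ordAt kleinQuartic (X i) p.1 = 0 := by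
  rw [kleinQuartic_isSmoothQuartic.ordAt_eq_zero_iff p.2 (isHomogeneous_X _ _)]
  obtain ⟨v, hv, h, rfl⟩ := exists_eq_kleinPt p
  refine (not_congr (vanishesAt_mk (isHomogeneous_X _ _) hv)).2 fun hi => ?_
  rw [eval_X] at hi
  exact (eq_coordPt_of_apply_eq_zero hi).elim h1 h2

theorem not_dvd_X (i : Fin 3) : ¬ kleinQuartic ∣ (X i : Poly3) :=
  not_dvd_of_isHomogeneous kleinQuartic_isHomogeneous (isHomogeneous_X _ i) (X_ne_zero i)
    (by norm_num)

/-- The divisor of a coordinate line. -/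
theorem cutsOut_X (i : Fin 3) : CutsOut kleinQuartic (X i) 1
    (Finsupp.single (coordPt (i + 2)) 3 + Finsupp.single (coordPt (i + 1)) 1) := by
  refine ⟨isHomogeneous_X _ _, not_dvd_X i, fun p => ?_⟩
  have hne : coordPt (i + 1) ≠ coordPt (i + 2) := fun h => by
    have := coordPt_injective h
    fin_cases i <;> simp at this
  rw [vanishingOrder_eq_toNat, Finsupp.add_apply]
  by_cases h1 : p = coordPt (i + 1)
  · have h := ordAt_X_add_two_coordPt (i + 1)
    rw [show i + 1 + 2 = i by fin_cases i <;> rfl] at h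
    rw [h1, h, Finsupp.single_eq_of_ne hne, Finsupp.single_eq_same]
    rfl
  by_cases h2 : p = coordPt (i + 2)
  · have h := ordAt_X_add_one_coordPt (i + 2)
    rw [show i + 2 + 1 = i by fin_cases i <;> rfl] at h
    rw [h2, h, Finsupp.single_eq_of_ne hne.symm, Finsupp.single_eq_same]
    rfl
  · rw [ordAt_X_of_ne h1 h2, Finsupp.single_eq_of_ne h1, Finsupp.single_eq_of_ne h2]
    rfl

/-! ## The class group -/

/-- The class of a divisor on the Klein quartic. -/
noncomputable def kleinClass : CurveDiv kleinQuartic →+ CurveDiv kleinQuartic ⧸ kleinQuartic_isSmoothQuartic.principalDivisors :=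
  QuotientAddGroup.mk' _

theorem kleinClass_eq_iff {D E : CurveDiv kleinQuartic} :
    kleinClass D = kleinClass E ↔ D - E ∈ kleinQuartic_isSmoothQuartic.principalDivisors := by
  rw [kleinClass, QuotientAddGroup.mk'_apply, QuotientAddGroup.mk'_apply, eq_comm,
    QuotientAddGroup.eq, neg_add_eq_sub]

theorem linEquiv_iff_kleinClass {D E : CurveDiv kleinQuartic} : LinEquiv kleinQuartic D E ↔ kleinClass D = kleinClass E := by
  rw [kleinQuartic_isSmoothQuartic.linEquiv_iff, kleinClass_eq_iff]

theorem CutsOut.kleinClass_eq {F G : Poly3} {d : ℕ} {D E : CurveDiv kleinQuartic} (hF : CutsOut kleinQuartic F d D)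
    (hG : CutsOut kleinQuartic G d E) : kleinClass D = kleinClass E :=
  kleinClass_eq_iff.2 (hF.sub_mem_principalDivisors kleinQuartic_isSmoothQuartic hG)

/-- The class of a point. -/
noncomputable def ptClass (p : CurvePt kleinQuartic) : CurveDiv kleinQuartic ⧸ kleinQuartic_isSmoothQuartic.principalDivisors :=
  kleinClass (Finsupp.single p 1)

theorem kleinClass_single (p : CurvePt kleinQuartic) (n : ℤ) :
    kleinClass (Finsupp.single p n) = n • ptClass p := by
  rw [ptClass, ← map_zsmul, Finsupp.smul_single, smul_eq_mul, mul_one]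

/-- The class of the divisor cut out by a line. -/
noncomputable def hClass : CurveDiv kleinQuartic ⧸ kleinQuartic_isSmoothQuartic.principalDivisors :=
  (3 : ℤ) • ptClass (coordPt 0) + ptClass (coordPt 2)

theorem hClass_eq_zero_two : hClass = (3 : ℤ) • ptClass (coordPt 0) + ptClass (coordPt 2) := rfl

theorem kleinClass_lineSection {l : Poly3} {h : CurveDiv kleinQuartic} (hl : CutsOut kleinQuartic l 1 h) :
    kleinClass h = hClass := by
  rw [hl.kleinClass_eq (cutsOut_X 1), map_add, kleinClass_single, kleinClass_single, one_smul]
  rfl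

theorem hClass_eq_two_one : hClass = (3 : ℤ) • ptClass (coordPt 2) + ptClass (coordPt 1) := by
  rw [← kleinClass_lineSection (cutsOut_X 0), map_add, kleinClass_single, kleinClass_single,
    one_smul]
  rfl

theorem hClass_eq_one_zero : hClass = (3 : ℤ) • ptClass (coordPt 1) + ptClass (coordPt 0) := by
  rw [← kleinClass_lineSection (cutsOut_X 2), map_add, kleinClass_single, kleinClass_single,
    one_smul]
  rfl

theorem seven_smul_coordPt (k : Fin 3) :
    (7 : ℤ) • ptClass (coordPt k) = (7 : ℤ) • ptClass (coordPt 0) := by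
  have h1 := hClass_eq_zero_two.symm.trans hClass_eq_two_one
  have h2 := hClass_eq_zero_two.symm.trans hClass_eq_one_zero
  fin_cases k
  · rfl
  · show (7 : ℤ) • ptClass (coordPt 1) = _
    linear_combination (norm := module) (-1 : ℤ) • h1 + (-2 : ℤ) • h2
  · show (7 : ℤ) • ptClass (coordPt 2) = _
    linear_combination (norm := module) (-3 : ℤ) • h1 + (1 : ℤ) • h2

/-! ## Linear automorphisms of the Klein quartic -/

/-- `M` and `N` are inverse matrices that preserve the Klein quartic. -/
structure IsKleinMatrix (M N : Matrix (Fin 3) (Fin 3) ℂ) : Prop where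
  mul_eq_one : M * N = 1
  mul_eq_one' : N * M = 1
  eval_eq_zero : ∀ v, eval v kleinQuartic = 0 → eval (M *ᵥ v) kleinQuartic = 0
  eval_eq_zero' : ∀ v, eval v kleinQuartic = 0 → eval (N *ᵥ v) kleinQuartic = 0

namespace IsKleinMatrix

variable {M N M' N' : Matrix (Fin 3) (Fin 3) ℂ}

theorem symm (h : IsKleinMatrix M N) : IsKleinMatrix N M :=
  ⟨h.2, h.1, h.4, h.3⟩

theorem mulVec_ne_zero (h : IsKleinMatrix M N) {v : Fin 3 → ℂ} (hv : v ≠ 0) : M *ᵥ v ≠ 0 := by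
  intro h0
  apply hv
  rw [← one_mulVec v, ← h.mul_eq_one', ← mulVec_mulVec, h0, mulVec_zero]

/-- The permutation of the points of the Klein quartic that is given by a matrix. -/
noncomputable def toFun (h : IsKleinMatrix M N) (p : CurvePt kleinQuartic) :
    CurvePt kleinQuartic :=
  kleinPt (M *ᵥ p.1.rep) (h.mulVec_ne_zero p.1.rep_nonzero) (h.eval_eq_zero _ p.2)

theorem toFun_kleinPt (h : IsKleinMatrix M N) {v : Fin 3 → ℂ} (hv : v ≠ 0)
    (hv' : eval v kleinQuartic = 0) :
    h.toFun (kleinPt v hv hv') =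
      kleinPt (M *ᵥ v) (h.mulVec_ne_zero hv) (h.eval_eq_zero _ hv') := by
  obtain ⟨c, -, hc⟩ := exists_rep_mk_eq hv
  refine kleinPt_eq_iff.2 ⟨c, ?_⟩
  rw [kleinPt, hc, mulVec_smul]

theorem toFun_toFun (h : IsKleinMatrix M N) (p : CurvePt kleinQuartic) :
    h.symm.toFun (h.toFun p) = p := by
  obtain ⟨v, hv, hv', rfl⟩ := exists_eq_kleinPt p
  rw [toFun_kleinPt, toFun_kleinPt]
  refine kleinPt_eq_iff.2 ⟨1, ?_⟩
  rw [mulVec_mulVec, h.mul_eq_one', one_mulVec, one_smul]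

/-- The permutation of the points of the Klein quartic that is given by a matrix. -/
noncomputable def perm (h : IsKleinMatrix M N) : Equiv.Perm (CurvePt kleinQuartic) where
  toFun := h.toFun
  invFun := h.symm.toFun
  left_inv := h.toFun_toFun
  right_inv := h.symm.toFun_toFun

theorem perm_kleinPt (h : IsKleinMatrix M N) {v : Fin 3 → ℂ} (hv : v ≠ 0)
    (hv' : eval v kleinQuartic = 0) :
    h.perm (kleinPt v hv hv') =
      kleinPt (M *ᵥ v) (h.mulVec_ne_zero hv) (h.eval_eq_zero _ hv') :=
  h.toFun_kleinPt hv hv'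

theorem isRegularMap_toFun (h : IsKleinMatrix M N) : IsRegularMap kleinQuartic h.toFun := by
  refine fun p => ⟨1, fun i => linearForm (M i), 0, 1, fun i => linearForm_isHomogeneous _,
    isHomogeneous_one _ _, by simp [VanishesAt], fun q _ => ?_⟩
  have he : (fun i => eval q.1.rep (linearForm (M i))) = M *ᵥ q.1.rep := by
    funext i
    rw [eval_linearForm, dotProduct_comm]
    rfl
  refine ⟨he ▸ h.mulVec_ne_zero q.1.rep_nonzero, ?_⟩
  simp only [he]
  rfl

theorem isCurveAut_perm (h : IsKleinMatrix M N) : IsCurveAut kleinQuartic h.perm :=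
  ⟨h.isRegularMap_toFun, h.symm.isRegularMap_toFun⟩

end IsKleinMatrix

/-- The diagonal matrix of the automorphism `φ`. -/
def kleinDiag (ω : ℂ) : Matrix (Fin 3) (Fin 3) ℂ := diagonal ![ω ^ 4, ω ^ 2, ω]

theorem kleinDiag_mulVec (ω : ℂ) (v : Fin 3 → ℂ) :
    kleinDiag ω *ᵥ v = ![ω ^ 4 * v 0, ω ^ 2 * v 1, ω * v 2] := by
  funext i
  rw [kleinDiag, mulVec_diagonal]
  fin_cases i <;> rfl

theorem eval_kleinDiag_mulVec {ω : ℂ} (hω : ω ^ 7 = 1) (v : Fin 3 → ℂ) :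
    eval (kleinDiag ω *ᵥ v) kleinQuartic = eval v kleinQuartic := by
  rw [kleinDiag_mulVec, eval_kleinQuartic, eval_kleinQuartic]
  simp only [cons_val]
  linear_combination ((ω ^ 7 + 1) * v 0 ^ 3 * v 1 + v 1 ^ 3 * v 2 + v 2 ^ 3 * v 0) * hω

theorem kleinDiag_mul (ω τ : ℂ) : kleinDiag ω * kleinDiag τ = kleinDiag (ω * τ) := by
  rw [kleinDiag, kleinDiag, kleinDiag, diagonal_mul_diagonal]
  congr 1
  funext i
  fin_cases i <;> simp [mul_pow]

theorem kleinDiag_one : kleinDiag 1 = 1 := by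
  rw [kleinDiag, ← diagonal_one]
  congr 1
  funext i
  fin_cases i <;> simp

theorem isKleinMatrix_kleinDiag {ω : ℂ} (hω : ω ^ 7 = 1) :
    IsKleinMatrix (kleinDiag ω) (kleinDiag (ω ^ 6)) := by
  have h6 : (ω ^ 6) ^ 7 = 1 := by rw [← pow_mul, mul_comm, pow_mul, hω, one_pow]
  refine ⟨?_, ?_, fun v hv => ?_, fun v hv => ?_⟩
  · rw [kleinDiag_mul, ← pow_succ', hω, kleinDiag_one]
  · rw [kleinDiag_mul, ← pow_succ, hω, kleinDiag_one]
  · rw [eval_kleinDiag_mulVec hω, hv]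
  · rw [eval_kleinDiag_mulVec h6, hv]

/-! ## The orbits of the automorphism of order seven -/

section Orbit

variable {ζ : ℂ} (hζ : IsPrimitiveRoot ζ 7)

include hζ in
theorem pow_val_pow_seven (i : ZMod 7) : (ζ ^ i.val) ^ 7 = 1 := by
  rw [← pow_mul, mul_comm, pow_mul, hζ.pow_eq_one, one_pow]

/-- The powers of the automorphism `φ`. -/
noncomputable def phiPerm (i : ZMod 7) : Equiv.Perm (CurvePt kleinQuartic) :=
  (isKleinMatrix_kleinDiag (pow_val_pow_seven hζ i)).perm

theorem phiPerm_kleinPt_eq_iff {i : ZMod 7} {v w : Fin 3 → ℂ} {hv : v ≠ 0} {hw : w ≠ 0}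
    {h : eval v kleinQuartic = 0} {h' : eval w kleinQuartic = 0} :
    phiPerm hζ i (kleinPt v hv h) = kleinPt w hw h' ↔
      ∃ c : ℂ, c • w = ![(ζ ^ i.val) ^ 4 * v 0, (ζ ^ i.val) ^ 2 * v 1, ζ ^ i.val * v 2] := by
  rw [phiPerm, IsKleinMatrix.perm_kleinPt, kleinPt_eq_iff, kleinDiag_mulVec]

theorem phiPerm_coordPt (i : ZMod 7) (k : Fin 3) : phiPerm hζ i (coordPt k) = coordPt k := by
  refine (phiPerm_kleinPt_eq_iff hζ).2 ⟨(![(ζ ^ i.val) ^ 4, (ζ ^ i.val) ^ 2, ζ ^ i.val] : _) k, ?_⟩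
  funext j
  fin_cases k <;> fin_cases j <;> simp

theorem eq_of_pow_three_eq {ω τ : ℂ} (hω : ω ^ 7 = 1) (hτ : τ ^ 7 = 1) (h : ω ^ 3 = τ ^ 3) :
    ω = τ := by
  have h15 (x : ℂ) (hx : x ^ 7 = 1) : x = (x ^ 3) ^ 5 := by
    linear_combination (-x * (x ^ 7 + 1)) * hx
  rw [h15 ω hω, h, ← h15 τ hτ]

include hζ in
theorem pow_val_injective : Function.Injective fun i : ZMod 7 => ζ ^ i.val := fun i j h =>
  ZMod.val_injective 7 (hζ.pow_inj i.val_lt j.val_lt h)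

include hζ in
theorem exists_pow_val_eq {ω : ℂ} (hω : ω ^ 7 = 1) : ∃ i : ZMod 7, ζ ^ i.val = ω := by
  obtain ⟨k, hk, rfl⟩ := hζ.eq_pow_of_pow_eq_one hω
  exact ⟨k, by rw [ZMod.val_natCast, Nat.mod_eq_of_lt hk]⟩

theorem phiPerm_injective {v : Fin 3 → ℂ} {hv : v ≠ 0} {h : eval v kleinQuartic = 0}
    (hv' : ∀ i, v i ≠ 0) : Function.Injective fun i => phiPerm hζ i (kleinPt v hv h) := by
  intro i j hij
  apply pow_val_injective hζ
  simp only [phiPerm, IsKleinMatrix.perm_kleinPt, kleinPt_eq_iff, kleinDiag_mulVec] at hij ⊢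
  have h1 := pow_val_pow_seven hζ i
  have h2 := pow_val_pow_seven hζ j
  set ω := ζ ^ i.val
  set τ := ζ ^ j.val
  have hω0 : ω ≠ 0 := fun h0 => by simp [h0] at h1
  have hτ0 : τ ≠ 0 := fun h0 => by simp [h0] at h2
  obtain ⟨c, hc⟩ := hij
  have e0 : c * τ ^ 4 = ω ^ 4 :=
    mul_right_cancel₀ (hv' 0) (by rw [mul_assoc]; exact congrFun hc 0)
  have e2 : c * τ = ω := mul_right_cancel₀ (hv' 2) (by rw [mul_assoc]; exact congrFun hc 2)
  refine eq_of_pow_three_eq h1 h2 (mul_left_cancel₀ hω0 ?_)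
  linear_combination -e0 + τ ^ 3 * e2

/-- The function x²y/z³ generates the invariants of φ, so its value determines the orbit of a point
off the coordinate lines. -/
theorem exists_phiPerm_eq {v w : Fin 3 → ℂ} {hv : v ≠ 0} {hw : w ≠ 0}
    {h : eval v kleinQuartic = 0} {h' : eval w kleinQuartic = 0} (hv' : ∀ i, v i ≠ 0)
    (hw' : ∀ i, w i ≠ 0) (heq : v 0 ^ 2 * v 1 * w 2 ^ 3 = w 0 ^ 2 * w 1 * v 2 ^ 3) :
    ∃ i, phiPerm hζ i (kleinPt v hv h) = kleinPt w hw h' := by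
  rw [eval_kleinQuartic] at h h'
  have v0 := hv' 0
  have v1 := hv' 1
  have v2 := hv' 2
  have w0 := hw' 0
  have w1 := hw' 1
  have w2 := hw' 2
  obtain ⟨x, hx⟩ : ∃ x, x = v 0 / v 2 := ⟨_, rfl⟩
  obtain ⟨y, hy⟩ : ∃ y, y = v 1 / v 2 := ⟨_, rfl⟩
  obtain ⟨x', hx'⟩ : ∃ x', x' = w 0 / w 2 := ⟨_, rfl⟩
  obtain ⟨y', hy'⟩ : ∃ y', y' = w 1 / w 2 := ⟨_, rfl⟩
  have hx0 : x ≠ 0 := by rw [hx]; positivity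
  have hx'0 : x' ≠ 0 := by rw [hx']; positivity
  have hy0 : y ≠ 0 := by rw [hy]; positivity
  have ex : v 0 = x * v 2 := by rw [hx]; field_simp
  have ey : v 1 = y * v 2 := by rw [hy]; field_simp
  have ex' : w 0 = x' * w 2 := by rw [hx']; field_simp
  have ey' : w 1 = y' * w 2 := by rw [hy']; field_simp
  have hc : x ^ 2 * y = x' ^ 2 * y' := by
    refine mul_right_cancel₀ (pow_ne_zero 3 (mul_ne_zero v2 w2)) ?_
    rw [ex, ey, ex', ey'] at heq
    linear_combination heq
  have hK : x ^ 3 * y + y ^ 3 + x = 0 := by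
    refine mul_right_cancel₀ (pow_ne_zero 4 v2) ?_
    rw [ex, ey] at h
    linear_combination h
  have hK' : x' ^ 3 * y' + y' ^ 3 + x' = 0 := by
    refine mul_right_cancel₀ (pow_ne_zero 4 w2) ?_
    rw [ex', ey'] at h'
    linear_combination h'
  -- With z = 1, the equation times x⁶ expresses x⁷ through c = x²y. Two points with the same c
  -- therefore differ in x by a seventh root of unity r.
  have h7 : x ^ 7 * (1 + x ^ 2 * y) = -(x ^ 2 * y) ^ 3 := by linear_combination x ^ 6 * hK
  have h7' : x' ^ 7 * (1 + x ^ 2 * y) = -(x ^ 2 * y) ^ 3 := by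
    rw [hc]; linear_combination x' ^ 6 * hK'
  have hc1 : 1 + x ^ 2 * y ≠ 0 := by
    intro h0
    rw [h0, mul_zero, zero_eq_neg] at h7
    exact pow_ne_zero 3 (mul_ne_zero (pow_ne_zero 2 hx0) hy0) h7
  have hr : (x' / x) ^ 7 = 1 := by
    rw [div_pow, mul_right_cancel₀ hc1 (h7'.trans h7.symm), div_self (pow_ne_zero 7 hx0)]
  obtain ⟨r, hr'⟩ : ∃ r, r = x' / x := ⟨_, rfl⟩
  rw [← hr'] at hr
  have exr : x' = r * x := by rw [hr']; field_simp
  have hr0 : r ≠ 0 := fun h0 => by simp [h0] at hr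
  have eyr : y' = r ^ 5 * y := by
    refine mul_left_cancel₀ (pow_ne_zero 2 hx'0) ?_
    rw [← hc, exr]
    linear_combination (-x ^ 2 * y) * hr
  -- After normalising z, a root ω multiplies x by ω³ and y by ω; the inverse of 3 modulo 7 is 5.
  obtain ⟨i, hi⟩ := exists_pow_val_eq hζ (ω := r ^ 5) (by
    rw [← pow_mul, mul_comm, pow_mul, hr, one_pow])
  refine ⟨i, (phiPerm_kleinPt_eq_iff hζ).2 ⟨r ^ 5 * v 2 / w 2, ?_⟩⟩
  rw [hi]
  funext k
  fin_cases k
  · show r ^ 5 * v 2 / w 2 * w 0 = (r ^ 5) ^ 4 * v 0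
    rw [ex', ex, exr]
    field_simp
    linear_combination (-(r ^ 7 + 1)) * hr
  · show r ^ 5 * v 2 / w 2 * w 1 = (r ^ 5) ^ 2 * v 1
    rw [ey', ey, eyr]
    field_simp
  · show r ^ 5 * v 2 / w 2 * w 2 = r ^ 5 * v 2
    field_simp

theorem mul_eq_mul_of_phiPerm_eq {i : ZMod 7} {v w : Fin 3 → ℂ} {hv : v ≠ 0} {hw : w ≠ 0}
    {h : eval v kleinQuartic = 0} {h' : eval w kleinQuartic = 0}
    (hi : phiPerm hζ i (kleinPt v hv h) = kleinPt w hw h') :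
    v 0 ^ 2 * v 1 * w 2 ^ 3 = w 0 ^ 2 * w 1 * v 2 ^ 3 := by
  obtain ⟨c, hc⟩ := (phiPerm_kleinPt_eq_iff hζ).1 hi
  have h7 := pow_val_pow_seven hζ i
  set ω := ζ ^ i.val
  have hω0 : ω ≠ 0 := fun h0 => by simp [h0] at h7
  have e0 : c * w 0 = ω ^ 4 * v 0 := congrFun hc 0
  have e1 : c * w 1 = ω ^ 2 * v 1 := congrFun hc 1
  have e2 : c * w 2 = ω * v 2 := congrFun hc 2
  have hc0 : c ≠ 0 := by
    rintro rfl
    apply hv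
    simp only [zero_mul, zero_eq_mul, hω0, pow_eq_zero_iff, ne_eq, OfNat.ofNat_ne_zero,
      not_false_eq_true, false_or] at e0 e1 e2
    funext k
    fin_cases k <;> assumption
  refine mul_left_cancel₀ (pow_ne_zero 3 hc0) ?_
  calc c ^ 3 * (v 0 ^ 2 * v 1 * w 2 ^ 3) = v 0 ^ 2 * v 1 * (c * w 2) ^ 3 := by ring
    _ = (c * w 0) ^ 2 * (c * w 1) * v 2 ^ 3 := by
      rw [e0, e1, e2]
      linear_combination (-v 0 ^ 2 * v 1 * v 2 ^ 3 * ω ^ 3) * h7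
    _ = _ := by ring

end Orbit

/-! ## The class of an orbit of the automorphism of order seven -/

/-- A form that cuts out `3A + 2B` and an orbit of `φ`. -/
noncomputable def orbitForm (c : ℂ) : Poly3 := X 0 ^ 2 * X 1 - C c * X 2 ^ 3

theorem orbitForm_isHomogeneous (c : ℂ) : (orbitForm c).IsHomogeneous 3 :=
  ((isHomogeneous_X_pow _ _).mul (isHomogeneous_X _ _)).sub (isHomogeneous_C_mul_X_pow _ _ _)

theorem eval_orbitForm (c : ℂ) (v : Fin 3 → ℂ) :
    eval v (orbitForm c) = v 0 ^ 2 * v 1 - c * v 2 ^ 3 := by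
  simp [orbitForm]

theorem gradientAt_orbitForm (c : ℂ) (v : Fin 3 → ℂ) :
    gradientAt (orbitForm c) v = ![2 * v 0 * v 1, v 0 ^ 2, -3 * c * v 2 ^ 2] := by
  funext i
  fin_cases i <;> simp [gradientAt, orbitForm, pderiv_X] <;> ring1

theorem ordAt_orbitForm_coordPt_zero {c : ℂ} (hc1 : c ≠ -1) :
    ordAt kleinQuartic (orbitForm c) (coordPt 0).1 = 3 := by
  have hp := (coordPt 0).2
  -- Modulo f, y(x³ + y²z) is -z³x. Substituting it exhibits the factor z³, whose cofactor is a unit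
  -- at A because c ≠ -1.
  have hcong : ordAt kleinQuartic (orbitForm c * (X 0 ^ 3 + X 1 ^ 2 * X 2)) (coordPt 0).1 =
      ordAt kleinQuartic (X 2 ^ 3 * (C (-(1 + c)) * X 0 ^ 3 + C (-c) * (X 1 ^ 2 * X 2)))
        (coordPt 0).1 := by
    refine ordAt_congr _ ⟨X 0 ^ 2, ?_⟩
    simp only [orbitForm, kleinQuartic, C_neg, C_add, C_1]
    ring
  have hu : ordAt kleinQuartic (X 0 ^ 3 + X 1 ^ 2 * X 2) (coordPt 0).1 = 0 := by
    have hhom : (X 0 ^ 3 + X 1 ^ 2 * X 2 : Poly3).IsHomogeneous 3 :=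
      (isHomogeneous_X_pow _ _).add ((isHomogeneous_X_pow _ _).mul (isHomogeneous_X _ _))
    rw [kleinQuartic_isSmoothQuartic.ordAt_eq_zero_iff hp hhom]
    refine (not_congr (vanishesAt_mk hhom (single_one_ne_zero 0))).2 ?_
    simp
  have hu' : ordAt kleinQuartic (C (-(1 + c)) * X 0 ^ 3 + C (-c) * (X 1 ^ 2 * X 2))
      (coordPt 0).1 = 0 := by
    have hhom : (C (-(1 + c)) * X 0 ^ 3 + C (-c) * (X 1 ^ 2 * X 2) : Poly3).IsHomogeneous 3 :=
      (isHomogeneous_C_mul_X_pow _ _ _).add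
        (((isHomogeneous_X_pow _ _).mul (isHomogeneous_X _ _)).C_mul _)
    rw [kleinQuartic_isSmoothQuartic.ordAt_eq_zero_iff hp hhom]
    refine (not_congr (vanishesAt_mk hhom (single_one_ne_zero 0))).2 ?_
    simp only [map_add, map_mul, map_pow, eval_C, eval_X, Pi.single_eq_same]
    rw [Pi.single_eq_of_ne (by decide), Pi.single_eq_of_ne (by decide)]
    intro h
    exact hc1 (by linear_combination -h)
  have h2 := ordAt_X_add_two_coordPt 0
  rw [zero_add] at h2
  rw [kleinQuartic_isSmoothQuartic.ordAt_mul hp, kleinQuartic_isSmoothQuartic.ordAt_mul hp,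
    kleinQuartic_isSmoothQuartic.ordAt_pow hp, hu, hu', h2] at hcong
  simpa using hcong

theorem ordAt_C {f : Poly3} (hf : IsSmoothQuartic f) {p : PPlane} (hp : VanishesAt f p) {c : ℂ}
    (hc : c ≠ 0) : ordAt f (C c) p = 0 := by
  rw [hf.ordAt_eq_zero_iff hp (isHomogeneous_C _ _)]
  simpa [VanishesAt] using hc

theorem ordAt_orbitForm_coordPt_one {c : ℂ} (hc : c ≠ 0) :
    ordAt kleinQuartic (orbitForm c) (coordPt 1).1 = 2 := by
  have hp := (coordPt 1).2
  have h0 : ordAt kleinQuartic (X 0) (coordPt 1).1 = 1 := ordAt_X_add_two_coordPt 1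
  have h2 : ordAt kleinQuartic (X 2) (coordPt 1).1 = 3 := ordAt_X_add_one_coordPt 1
  have e1 : ordAt kleinQuartic (X 0 ^ 2 * X 1) (coordPt 1).1 = 2 := by
    rw [kleinQuartic_isSmoothQuartic.ordAt_mul hp, kleinQuartic_isSmoothQuartic.ordAt_pow hp, h0,
      ordAt_X_coordPt]
    norm_num
  have e2 : ordAt kleinQuartic (C (-c) * X 2 ^ 3) (coordPt 1).1 = 9 := by
    rw [kleinQuartic_isSmoothQuartic.ordAt_mul hp, kleinQuartic_isSmoothQuartic.ordAt_pow hp, h2,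
      ordAt_C kleinQuartic_isSmoothQuartic hp (neg_ne_zero.2 hc)]
    norm_num
  rw [orbitForm, sub_eq_add_neg, ← neg_mul, ← C_neg,
    kleinQuartic_isSmoothQuartic.ordAt_add_eq_of_lt hp (by rw [e1, e2]; norm_num), e1]

theorem ordAt_orbitForm_coordPt_two {c : ℂ} (hc : c ≠ 0) :
    ordAt kleinQuartic (orbitForm c) (coordPt 2).1 = 0 := by
  rw [kleinQuartic_isSmoothQuartic.ordAt_eq_zero_iff (coordPt 2).2 (orbitForm_isHomogeneous c)]
  refine (not_congr (vanishesAt_mk (orbitForm_isHomogeneous c) (single_one_ne_zero 2))).2 ?_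
  rw [eval_orbitForm]
  simpa using hc

theorem ordAt_orbitForm_kleinPt {c : ℂ} {v : Fin 3 → ℂ} {hv : v ≠ 0}
    {h : eval v kleinQuartic = 0} (hv' : ∀ i, v i ≠ 0) (hc : v 0 ^ 2 * v 1 = c * v 2 ^ 3) :
    ordAt kleinQuartic (orbitForm c) (kleinPt v hv h).1 = 1 := by
  refine kleinQuartic_isSmoothQuartic.ordAt_mk_eq_one hv h (orbitForm_isHomogeneous c)
    (by rw [eval_orbitForm, hc, sub_self]) fun h0 => ?_
  have h2 := congrFun h0 2
  rw [gradientAt_orbitForm, gradientAt_kleinQuartic, cross_apply] at h2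
  simp only [cons_val, Pi.zero_apply] at h2
  rw [eval_kleinQuartic] at h
  refine mul_ne_zero (mul_ne_zero (hv' 0) (pow_ne_zero 3 (hv' 1))) (hv' 2) ?_
  refine (mul_eq_zero.1 (?_ : (7 : ℂ) * _ = 0)).resolve_left (by norm_num)
  linear_combination h2 + v 0 * h

theorem exists_apply_eq_zero_iff {v : Fin 3 → ℂ} {hv : v ≠ 0} {h : eval v kleinQuartic = 0} :
    (∃ k, kleinPt v hv h = coordPt k) ↔ ∃ i, v i = 0 := by
  constructor
  · rintro ⟨k, hk⟩
    obtain ⟨c, hc⟩ := kleinPt_eq_iff.1 hk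
    refine ⟨k + 1, ?_⟩
    rw [← hc]
    fin_cases k <;> simp
  · rintro ⟨i, hi⟩
    exact (eq_coordPt_of_apply_eq_zero hi).elim (fun h => ⟨_, h⟩) fun h => ⟨_, h⟩

section

variable {ζ : ℂ} (hζ : IsPrimitiveRoot ζ 7)

/-- The divisor of an orbit of `φ`. -/
noncomputable def orbitDiv (p : CurvePt kleinQuartic) : CurveDiv kleinQuartic :=
  ∑ i, Finsupp.single (phiPerm hζ i p) 1

theorem orbitDiv_apply {p : CurvePt kleinQuartic} (hp : ∀ k, p ≠ coordPt k)
    (q : CurvePt kleinQuartic) [Decidable (∃ i, phiPerm hζ i p = q)] :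
    orbitDiv hζ p q = if ∃ i, phiPerm hζ i p = q then 1 else 0 := by
  classical
  obtain ⟨v, hv, h, rfl⟩ := exists_eq_kleinPt p
  have hv' : ∀ i, v i ≠ 0 := fun i hi => (exists_apply_eq_zero_iff.2 ⟨i, hi⟩).elim hp
  simp only [orbitDiv, Finsupp.finsetSum_apply, Finsupp.single_apply]
  split_ifs with hq
  · obtain ⟨j, rfl⟩ := hq
    simp_rw [(phiPerm_injective hζ hv').eq_iff]
    simp
  · exact Finset.sum_eq_zero fun i _ => if_neg fun hi => hq ⟨i, hi⟩

theorem cutsOut_orbitForm {v : Fin 3 → ℂ} {hv : v ≠ 0} {h : eval v kleinQuartic = 0}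
    (hv' : ∀ i, v i ≠ 0) : CutsOut kleinQuartic (orbitForm (v 0 ^ 2 * v 1 / v 2 ^ 3)) 3
      (Finsupp.single (coordPt 0) 3 + Finsupp.single (coordPt 1) 2 +
        orbitDiv hζ (kleinPt v hv h)) := by
  classical
  have hne : ∀ k, kleinPt v hv h ≠ coordPt k := fun k hk => by
    obtain ⟨i, hi⟩ := exists_apply_eq_zero_iff.1 ⟨k, hk⟩
    exact hv' i hi
  have horb : ∀ k i, phiPerm hζ i (kleinPt v hv h) ≠ coordPt k := fun k i hk =>
    hne k ((phiPerm hζ i).injective (hk.trans (phiPerm_coordPt hζ i k).symm))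
  obtain ⟨c, hc⟩ : ∃ c, c = v 0 ^ 2 * v 1 / v 2 ^ 3 := ⟨_, rfl⟩
  have hcv : v 0 ^ 2 * v 1 = c * v 2 ^ 3 := by
    rw [hc, div_mul_cancel₀ _ (pow_ne_zero 3 (hv' 2))]
  have hc0 : c ≠ 0 := by
    rw [hc]
    exact div_ne_zero (mul_ne_zero (pow_ne_zero 2 (hv' 0)) (hv' 1)) (pow_ne_zero 3 (hv' 2))
  -- If c = -1, the equation of the curve reduces to y³z = 0.
  have hc1 : c ≠ -1 := by
    rintro rfl
    have h' := h
    rw [eval_kleinQuartic] at h'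
    refine mul_ne_zero (pow_ne_zero 3 (hv' 1)) (hv' 2) ?_
    linear_combination h' - v 0 * hcv
  rw [← hc]
  have hdvd : ¬ kleinQuartic ∣ orbitForm c := by
    refine not_dvd_of_isHomogeneous kleinQuartic_isHomogeneous (orbitForm_isHomogeneous c) ?_
      (by norm_num)
    intro h0
    have := congrArg (eval ![1, 1, 0]) h0
    rw [eval_orbitForm] at this
    simp at this
  have h01 : coordPt 0 ≠ coordPt 1 := fun h => by simpa using coordPt_injective h
  have h02 : coordPt 0 ≠ coordPt 2 := fun h => by simpa using coordPt_injective h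
  have h12 : coordPt 1 ≠ coordPt 2 := fun h => by simpa using coordPt_injective h
  refine ⟨orbitForm_isHomogeneous c, hdvd, fun p => ?_⟩
  rw [vanishingOrder_eq_toNat, Finsupp.add_apply, Finsupp.add_apply, orbitDiv_apply hζ hne]
  by_cases hp0 : p = coordPt 0
  · subst hp0
    rw [if_neg fun ⟨i, hi⟩ => horb _ i hi, ordAt_orbitForm_coordPt_zero hc1,
      Finsupp.single_eq_same, Finsupp.single_eq_of_ne h01]
    rfl
  by_cases hp1 : p = coordPt 1
  · subst hp1
    rw [if_neg fun ⟨i, hi⟩ => horb _ i hi, ordAt_orbitForm_coordPt_one hc0,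
      Finsupp.single_eq_same, Finsupp.single_eq_of_ne h01.symm]
    rfl
  by_cases hp2 : p = coordPt 2
  · subst hp2
    rw [if_neg fun ⟨i, hi⟩ => horb _ i hi, ordAt_orbitForm_coordPt_two hc0,
      Finsupp.single_eq_of_ne h02.symm, Finsupp.single_eq_of_ne h12.symm]
    rfl
  rw [Finsupp.single_eq_of_ne hp0, Finsupp.single_eq_of_ne hp1]
  obtain ⟨w, hw, hw0, rfl⟩ := exists_eq_kleinPt p
  have hw' : ∀ i, w i ≠ 0 := fun i hi => by
    obtain ⟨k, hk⟩ := exists_apply_eq_zero_iff.2 ⟨i, hi⟩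
    fin_cases k
    exacts [hp0 hk, hp1 hk, hp2 hk]
  split_ifs with hi
  · obtain ⟨i, hi⟩ := hi
    rw [ordAt_orbitForm_kleinPt hw' ?_]
    · rfl
    · have := mul_eq_mul_of_phiPerm_eq hζ hi
      refine mul_right_cancel₀ (pow_ne_zero 3 (hv' 2)) ?_
      linear_combination -this + w 2 ^ 3 * hcv
  · rw [(kleinQuartic_isSmoothQuartic.ordAt_eq_zero_iff (kleinPt w hw hw0).2
      (orbitForm_isHomogeneous c)).2]
    · rfl
    · refine (not_congr (vanishesAt_mk (orbitForm_isHomogeneous c) hw)).2 fun h0 => hi ?_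
      rw [eval_orbitForm] at h0
      refine exists_phiPerm_eq hζ hv' hw' ?_
      linear_combination w 2 ^ 3 * hcv - v 2 ^ 3 * h0

/-- For a free orbit compare the cubic x²y - cz³ with z³: 3A + 2B + orbit ~ 9B + 3A, so the orbit
has class 7B = 7A. For a fixed point the orbit is the point taken seven times. -/
theorem kleinClass_orbitDiv (p : CurvePt kleinQuartic) :
    kleinClass (orbitDiv hζ p) = (7 : ℤ) • ptClass (coordPt 0) := by
  by_cases hp : ∃ k, p = coordPt k
  · obtain ⟨k, rfl⟩ := hp
    simp only [orbitDiv, phiPerm_coordPt, Finset.sum_const, Finset.card_univ, ZMod.card]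
    rw [← seven_smul_coordPt k, ptClass, map_nsmul]
    exact (natCast_zsmul _ 7).symm
  · push Not at hp
    obtain ⟨v, hv, h, rfl⟩ := exists_eq_kleinPt p
    have hv' : ∀ i, v i ≠ 0 := fun i hi => (exists_apply_eq_zero_iff.2 ⟨i, hi⟩).elim hp
    have h1 := (cutsOut_orbitForm hζ (hv := hv) (h := h) hv').kleinClass_eq
      (((cutsOut_X 2).mul kleinQuartic_isSmoothQuartic (cutsOut_X 2)).mul
        kleinQuartic_isSmoothQuartic (cutsOut_X 2))
    have h2 := seven_smul_coordPt 1
    rw [show (2 + 2 : Fin 3) = 1 from rfl, show (2 + 1 : Fin 3) = 0 from rfl] at h1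
    simp only [map_add, kleinClass_single] at h1
    linear_combination (norm := module) h1 + h2

/-! ## Classes that are invariant under the automorphism of order seven -/

/-- The degree of a divisor. -/
noncomputable def divDegree {f : Poly3} : CurveDiv f →+ ℤ :=
  Finsupp.liftAddHom fun _ => AddMonoidHom.id ℤ

theorem divDegree_single {f : Poly3} (p : CurvePt f) (n : ℤ) :
    divDegree (Finsupp.single p n) = n := by
  simp [divDegree]

theorem sum_kleinClass_mapDomain_phiPerm (D : CurveDiv kleinQuartic) :
    ∑ i, kleinClass (Finsupp.mapDomain (phiPerm hζ i) D) =
      (7 * divDegree D) • ptClass (coordPt 0) := by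
  induction D using Finsupp.induction_linear with
  | zero => simp
  | add D E hD hE =>
    simp only [Finsupp.mapDomain_add, map_add, Finset.sum_add_distrib, hD, hE, mul_add]
    exact (add_zsmul _ _ _).symm
  | single p n =>
    have h := congrArg (n • ·) (kleinClass_orbitDiv hζ p)
    simp only [orbitDiv, map_sum, Finset.smul_sum, kleinClass_single, one_smul] at h
    simp only [Finsupp.mapDomain_single, kleinClass_single, divDegree_single, h]
    rw [smul_smul, mul_comm]

include hζ in
-- Only invariance under φ enters. It makes the classes agree after multiplication by 7, and 7 - 3·2
-- = 1.
theorem kleinClass_eq_of_isAutInvariant {η η' : CurveDiv kleinQuartic}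
    (h : IsAutInvariant kleinQuartic η) (h' : IsAutInvariant kleinQuartic η')
    (hdeg : divDegree η = divDegree η') (h2 : (2 : ℤ) • kleinClass η = (2 : ℤ) • kleinClass η') :
    kleinClass η = kleinClass η' := by
  have key {D : CurveDiv kleinQuartic} (hD : IsAutInvariant kleinQuartic D) :
      (7 : ℤ) • kleinClass D = (7 * divDegree D) • ptClass (coordPt 0) := by
    rw [← sum_kleinClass_mapDomain_phiPerm hζ D, Finset.sum_congr rfl fun i _ =>
      linEquiv_iff_kleinClass.1 (hD (phiPerm hζ i) (IsKleinMatrix.isCurveAut_perm _))]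
    simp only [Finset.sum_const, Finset.card_univ, ZMod.card]
    exact natCast_zsmul _ 7
  have h7 : (7 : ℤ) • kleinClass η = (7 : ℤ) • kleinClass η' := by rw [key h, key h', hdeg]
  linear_combination (norm := module) h7 - (3 : ℤ) • h2

end

/-! ## The invariant theta characteristic -/

/-- The invariant theta characteristic of the Klein quartic. -/
noncomputable def etaSym : CurveDiv kleinQuartic :=
  Finsupp.single (coordPt 2) 1 + Finsupp.single (coordPt 1) 2 - Finsupp.single (coordPt 0) 1

theorem divDegree_etaSym : divDegree etaSym = 2 := by
  rw [etaSym, map_sub, map_add, divDegree_single, divDegree_single, divDegree_single]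
  norm_num

theorem kleinClass_etaSym : kleinClass etaSym =
    ptClass (coordPt 2) + (2 : ℤ) • ptClass (coordPt 1) - ptClass (coordPt 0) := by
  rw [etaSym, map_sub, map_add, kleinClass_single, kleinClass_single, kleinClass_single, one_smul,
    one_smul]

theorem two_smul_kleinClass_etaSym : (2 : ℤ) • kleinClass etaSym = hClass := by
  have h1 := hClass_eq_zero_two.symm.trans hClass_eq_two_one
  have h2 := hClass_eq_zero_two.symm.trans hClass_eq_one_zero
  rw [kleinClass_etaSym, hClass]
  linear_combination (norm := module) (-1 : ℤ) • h1 - h2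

theorem isTheta_iff {η : CurveDiv kleinQuartic} :
    IsTheta kleinQuartic η ↔ divDegree η = 2 ∧ (2 : ℤ) • kleinClass η = hClass := by
  have h2 : kleinClass (2 • η) = (2 : ℤ) • kleinClass η := by
    rw [map_nsmul]
    exact (natCast_zsmul _ 2).symm
  refine and_congr Iff.rfl ⟨?_, fun h => ⟨_, (cutsOut_X 0).isLineSection, ?_⟩⟩
  · rintro ⟨h, hh, hl⟩
    obtain ⟨l, hl'⟩ := hh.exists_cutsOut kleinQuartic_isSmoothQuartic
    rw [← h2, linEquiv_iff_kleinClass.1 hl, kleinClass_lineSection hl']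
  · rw [linEquiv_iff_kleinClass, kleinClass_lineSection (cutsOut_X 0), h2, h]

theorem pderiv_comm (i j : Fin 3) (F : Poly3) :
    pderiv i (pderiv j F) = pderiv j (pderiv i F) := by
  have h : ⁅(pderiv i : Derivation ℂ Poly3 Poly3), (pderiv j : Derivation ℂ Poly3 Poly3)⁆ = 0 := by
    refine derivation_ext fun k => ?_
    rw [Derivation.commutator_apply, pderiv_X, pderiv_X, Pi.single_apply, Pi.single_apply]
    split_ifs <;> simp
  have := DFunLike.congr_fun h F
  rwa [Derivation.commutator_apply, Derivation.zero_apply, sub_eq_zero] at this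

/-- The tangent line at the k-th coordinate point is X (k+1) = 0, so the gradient of q has at most
its (k+1)-st entry. -/
theorem tangent_coordPt {q : Poly3} {d : ℕ} (hq : q.IsHomogeneous d) {k : Fin 3}
    (h : 2 ≤ ordAt kleinQuartic q (coordPt k).1) :
    gradientAt q (Pi.single k 1) k = 0 ∧ gradientAt q (Pi.single k 1) (k + 2) = 0 := by
  obtain ⟨h0, hc⟩ := kleinQuartic_isSmoothQuartic.cross_eq_zero_of_two_le_ordAt
    (single_one_ne_zero k) (eval_single_kleinQuartic k) hq h
  have he := dotProduct_gradientAt hq (Pi.single k 1)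
  rw [single_dotProduct, h0, mul_zero, one_mul] at he
  refine ⟨he, ?_⟩
  have := congrFun hc k
  rw [gradientAt_kleinQuartic, cross_apply] at this
  fin_cases k
  · simpa using this
  · simpa using this
  · simpa using this

/-- A conic that is tangent to the Klein quartic at the coordinate points is zero. -/
theorem conic_eq_zero {q : Poly3} (hq : q.IsHomogeneous 2)
    (h : ∀ k, 2 ≤ ordAt kleinQuartic q (coordPt k).1) : q = 0 := by
  have hlin (i : Fin 3) : (pderiv i q).IsHomogeneous 1 := hq.pderiv
  have hev (i j : Fin 3) : eval (Pi.single i 1) (pderiv j q) =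
      eval 0 (pderiv i (pderiv j q)) := by
    conv_lhs => rw [eq_linearForm (hlin j) 0, eval_linearForm, single_dotProduct, one_mul]
    rfl
  have hall (i j : Fin 3) : eval (Pi.single i 1) (pderiv j q) = 0 := by
    -- The three tangency conditions kill all squares and all products X i · X (i+2), that is, all
    -- six coefficients of the conic.
    have hij : j = i ∨ j = i + 2 ∨ i = j + 2 := by
      clear * -
      revert i j
      decide
    rcases hij with hij | hij | hij
    · rw [hij]
      exact (tangent_coordPt hq (h i)).1
    · rw [hij]
      exact (tangent_coordPt hq (h i)).2
    · rw [hev, pderiv_comm, ← hev, hij]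
      exact (tangent_coordPt hq (h j)).2
  have hzero (j : Fin 3) : pderiv j q = 0 := by
    rw [eq_linearForm (hlin j) 0]
    refine MvPolynomial.funext fun v => ?_
    have ha : gradientAt (pderiv j q) 0 = 0 := by
      funext i
      rw [gradientAt, ← hev i j, hall i j, Pi.zero_apply]
    rw [eval_linearForm, ha, dotProduct_zero, map_zero]
  refine MvPolynomial.funext fun v => ?_
  have he := dotProduct_gradientAt hq v
  have hg : gradientAt q v = 0 := by
    funext j
    rw [gradientAt, hzero, map_zero, Pi.zero_apply]
  rw [hg, dotProduct_zero, zero_eq_mul] at he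
  rw [map_zero]
  exact he.resolve_left (by norm_num)

/-- The divisor of xz minus `etaSym` is 2(A + B + C). A section F/G therefore makes F·xz/G a conic
with this divisor or more, which must be zero. -/
theorem h0_etaSym : h0 kleinQuartic etaSym = 0 := by
  have hsub : sections kleinQuartic etaSym ⊆ {0} := by
    rintro u (rfl | ⟨E, ⟨d, F, G, hF, hG, hFd, hGd, -, hE⟩, hpos⟩)
    · rfl
    exfalso
    have hprod := (cutsOut_X 0).mul kleinQuartic_isSmoothQuartic (cutsOut_X 2)
    have hFX := kleinQuartic_isSmoothQuartic.not_dvd_mul hFd hprod.not_dvd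
    have hle (p : CurvePt kleinQuartic) : (vanishingOrder kleinQuartic G p.1 : ℤ) +
        (Finsupp.single (coordPt 0) 2 + Finsupp.single (coordPt 1) 2 +
          Finsupp.single (coordPt 2) 2 : CurveDiv kleinQuartic) p ≤
        vanishingOrder kleinQuartic (F * (X 0 * X 2)) p.1 := by
      have h1 := hpos p
      have h2 := hprod.apply_eq p
      rw [show (0 + 2 : Fin 3) = 2 from rfl, show (0 + 1 : Fin 3) = 1 from rfl,
        show (2 + 2 : Fin 3) = 1 from rfl, show (2 + 1 : Fin 3) = 0 from rfl] at h2
      rw [kleinQuartic_isSmoothQuartic.vanishingOrder_mul p.2 hFd hprod.not_dvd]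
      simp only [etaSym, Finsupp.coe_zero, Pi.zero_apply, Finsupp.add_apply, Finsupp.sub_apply,
        hE p] at h1 h2 ⊢
      push_cast
      rw [← h2]
      have e (k : Fin 3) (n : ℤ) : (Finsupp.single (coordPt k) n : CurveDiv kleinQuartic) p =
          n * (Finsupp.single (coordPt k) 1 : CurveDiv kleinQuartic) p := by
        by_cases hk : p = coordPt k
        · subst hk; simp
        · rw [Finsupp.single_eq_of_ne hk, Finsupp.single_eq_of_ne hk, mul_zero]
      rw [e 0 2, e 1 2, e 2 2, e 2 3, e 1 3]
      rw [e 1 2] at h1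
      linarith
    have hnn (p : CurvePt kleinQuartic) : (0 : ℤ) ≤
        (Finsupp.single (coordPt 0) 2 + Finsupp.single (coordPt 1) 2 +
          Finsupp.single (coordPt 2) 2 : CurveDiv kleinQuartic) p := by
      refine (add_nonneg (add_nonneg ?_ ?_) ?_ : (0 : CurveDiv kleinQuartic) ≤ _) p <;>
      exact Finsupp.single_nonneg.2 (by norm_num)
    obtain ⟨q, hq, hdvd⟩ := exists_eq_mul_of_ordAt_le (m := 2) (n := d) (F := F * (X 0 * X 2))
      (G := G) (by
        rw [add_comm]
        exact hF.mul ((isHomogeneous_X _ _).mul (isHomogeneous_X _ _))) hG hGd fun p hp => by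
        rw [← kleinQuartic_isSmoothQuartic.coe_vanishingOrder hp hGd,
          ← kleinQuartic_isSmoothQuartic.coe_vanishingOrder hp hFX]
        have h1 := hle ⟨p, hp⟩
        have h2 := hnn ⟨p, hp⟩
        norm_cast
        dsimp only at h1
        omega
    have hq0 : q = 0 := by
      refine conic_eq_zero hq fun k => ?_
      have hp := (coordPt k).2
      have h1 := ordAt_congr (coordPt k).1 hdvd
      have h2 := hle (coordPt k)
      rw [kleinQuartic_isSmoothQuartic.ordAt_mul hp q G,
        ← kleinQuartic_isSmoothQuartic.coe_vanishingOrder hp hGd,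
        ← kleinQuartic_isSmoothQuartic.coe_vanishingOrder hp hFX] at h1
      have h3 : (2 : ℤ) ≤ (Finsupp.single (coordPt 0) 2 + Finsupp.single (coordPt 1) 2 +
          Finsupp.single (coordPt 2) 2 : CurveDiv kleinQuartic) (coordPt k) := by
        classical
        simp only [Finsupp.add_apply, Finsupp.single_apply, coordPt_injective.eq_iff]
        fin_cases k <;> simp
      have h4 : vanishingOrder kleinQuartic G (coordPt k).1 + 2 ≤
          vanishingOrder kleinQuartic (F * (X 0 * X 2)) (coordPt k).1 := by omega
      have h5 : ((vanishingOrder kleinQuartic G (coordPt k).1 + 2 : ℕ) : ℕ∞) ≤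
          ordAt kleinQuartic q (coordPt k).1 + vanishingOrder kleinQuartic G (coordPt k).1 :=
        h1 ▸ Nat.cast_le.2 h4
      rw [Nat.cast_add, add_comm] at h5
      exact (ENat.add_le_add_iff_right (ENat.natCast_ne_top _)).1 h5
    rw [hq0, zero_mul, sub_zero] at hdvd
    exact hFX hdvd
  rw [h0, Submodule.span_eq_bot.2 fun x hx => hsub hx, finrank_bot]

theorem isEvenTheta_etaSym : IsEvenTheta kleinQuartic etaSym :=
  ⟨isTheta_iff.2 ⟨divDegree_etaSym, two_smul_kleinClass_etaSym⟩, by rw [h0_etaSym]; exact .zero⟩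

/-! ## The involution of the Klein quartic -/

/-- The entries of the matrix of an involution of the Klein quartic. -/
structure IsInvolutionData (a b c s : ℂ) : Prop where
  sum_eq : a + b + c = s
  sum_mul_eq : a * b + b * c + c * a = 0
  mul_eq : a * b * c = s
  sq_eq : s ^ 2 = -7
  cyclic_eq : a ^ 2 * b + b ^ 2 * c + c ^ 2 * a = -s

theorem IsPrimitiveRoot.sum_pow_seven {ζ : ℂ} (hζ : IsPrimitiveRoot ζ 7) :
    1 + ζ + ζ ^ 2 + ζ ^ 3 + ζ ^ 4 + ζ ^ 5 + ζ ^ 6 = 0 := by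
  have := hζ.geom_sum_eq_zero (by norm_num)
  simpa [Finset.sum_range_succ] using this

theorem exists_isInvolutionData {ζ : ℂ} (hζ : IsPrimitiveRoot ζ 7) :
    ∃ a b c s, IsInvolutionData a b c s := by
  have h := hζ.sum_pow_seven
  -- The classical entries of Klein's involution; s is the Gauss sum with square -7. The five
  -- relations are all that is used afterwards.
  refine ⟨ζ - ζ ^ 6, ζ ^ 2 - ζ ^ 5, ζ ^ 4 - ζ ^ 3, 1 + 2 * ζ + 2 * ζ ^ 2 + 2 * ζ ^ 4,
    ?_, ?_, ?_, ?_, ?_⟩ <;> grind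

/-- The matrix of the involution, up to a scalar. -/
def involutionMatrix (a b c : ℂ) : Matrix (Fin 3) (Fin 3) ℂ := !![a, b, c; b, c, a; c, a, b]

theorem involutionMatrix_mulVec (a b c : ℂ) (v : Fin 3 → ℂ) : involutionMatrix a b c *ᵥ v =
    ![a * v 0 + b * v 1 + c * v 2, b * v 0 + c * v 1 + a * v 2, c * v 0 + a * v 1 + b * v 2] := by
  funext i
  rw [involutionMatrix, mulVec, dotProduct, Fin.sum_univ_three]
  fin_cases i <;> rfl

namespace IsInvolutionData

variable {a b c s : ℂ} (h : IsInvolutionData a b c s)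

include h

theorem ne_zero : s ≠ 0 := fun h0 => by
  have := h.sq_eq
  norm_num [h0] at this

theorem eval_mulVec (v : Fin 3 → ℂ) :
    eval (involutionMatrix a b c *ᵥ v) kleinQuartic = 49 * eval v kleinQuartic := by
  obtain ⟨h1, h2, h3, h4, h5⟩ := h
  rw [involutionMatrix_mulVec, eval_kleinQuartic, eval_kleinQuartic]
  simp only [cons_val]
  generalize v 0 = x
  generalize v 1 = y
  generalize v 2 = z
  grind

theorem mul_self : involutionMatrix a b c * involutionMatrix a b c = (-7 : ℂ) • 1 := by
  have hd : a * a + b * b + c * c = -7 := by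
    rw [← h.sq_eq, ← h.sum_eq]
    linear_combination (-2) * h.sum_mul_eq
  have ho := h.sum_mul_eq
  ext i j
  rw [mul_apply, Fin.sum_univ_three]
  fin_cases i <;> fin_cases j <;> simp [involutionMatrix] <;>
    first | linear_combination hd | linear_combination ho

theorem isKleinMatrix : IsKleinMatrix ((-1 / 7 : ℂ) • involutionMatrix a b c)
    (involutionMatrix a b c) := by
  have h7 : (-1 / 7 : ℂ) • (-7 : ℂ) • (1 : Matrix (Fin 3) (Fin 3) ℂ) = 1 := by
    rw [smul_smul]
    norm_num
  refine ⟨?_, ?_, fun v hv => ?_, fun v hv => ?_⟩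
  · rw [smul_mul_assoc, h.mul_self, h7]
  · rw [mul_smul_comm, h.mul_self, h7]
  · rw [smul_mulVec, eval_smul_of_isHomogeneous kleinQuartic_isHomogeneous, h.eval_mulVec, hv,
      mul_zero, mul_zero]
  · rw [h.eval_mulVec, hv, mul_zero]

/-- The cubic whose divisor is the sum of two theta divisors. -/
theorem prod_linearForm : (X 0 * X 1 * X 2 : Poly3) *
    (linearForm ![a, b, c] * linearForm ![b, c, a] * linearForm ![c, a, b]) =
    C (-s) * ((X 0 ^ 2 * X 1 + X 1 ^ 2 * X 2 + X 2 ^ 2 * X 0 + X 0 * X 1 * X 2) ^ 2 -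
      kleinQuartic * (X 0 * X 1 + X 1 * X 2 + X 2 * X 0)) := by
  obtain ⟨h1, h2, h3, h4, h5⟩ := h
  refine MvPolynomial.funext fun v => ?_
  simp only [map_mul, map_add, map_sub, map_pow, eval_linearForm, eval_kleinQuartic, eval_X,
    eval_C, dotProduct, Fin.sum_univ_three, cons_val]
  generalize v 0 = x
  generalize v 1 = y
  generalize v 2 = z
  grind

end IsInvolutionData

/-! ## Permutations that preserve linear equivalence -/

/-- The permutation `σ` maps principal divisors to principal divisors. -/
def PreservesPrincipal (σ : Equiv.Perm (CurvePt kleinQuartic)) : Prop :=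
  ∀ E ∈ kleinQuartic_isSmoothQuartic.principalDivisors,
    Finsupp.mapDomain σ E ∈ kleinQuartic_isSmoothQuartic.principalDivisors

theorem IsCurveAut.preservesPrincipal {σ : Equiv.Perm (CurvePt kleinQuartic)}
    (hσ : IsCurveAut kleinQuartic σ) : PreservesPrincipal σ := fun _ hE =>
  kleinQuartic_isSmoothQuartic.mapDomain_mem_principalDivisors hσ hE

theorem IsCurveAut.preservesPrincipal_symm {σ : Equiv.Perm (CurvePt kleinQuartic)}
    (hσ : IsCurveAut kleinQuartic σ) : PreservesPrincipal σ.symm :=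
  IsCurveAut.preservesPrincipal ⟨hσ.2, hσ.1⟩

theorem PreservesPrincipal.trans {σ τ : Equiv.Perm (CurvePt kleinQuartic)}
    (hσ : PreservesPrincipal σ) (hτ : PreservesPrincipal τ) :
    PreservesPrincipal (σ.trans τ) := fun E hE => by
  rw [Equiv.coe_trans, Finsupp.mapDomain_comp]
  exact hτ _ (hσ E hE)

theorem mapDomain_sub {α β : Type*} (σ : α → β) (D E : α →₀ ℤ) :
    Finsupp.mapDomain σ (D - E) = Finsupp.mapDomain σ D - Finsupp.mapDomain σ E :=
  map_sub (Finsupp.mapDomain.addMonoidHom σ) D E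

theorem PreservesPrincipal.kleinClass_eq {σ : Equiv.Perm (CurvePt kleinQuartic)}
    (hσ : PreservesPrincipal σ) {D E : CurveDiv kleinQuartic} (h : kleinClass D = kleinClass E) :
    kleinClass (Finsupp.mapDomain σ D) = kleinClass (Finsupp.mapDomain σ E) := by
  rw [kleinClass_eq_iff] at h ⊢
  rw [← mapDomain_sub]
  exact hσ _ h

/-- The image of a divisor is cut out by the form composed with the inverse matrix N. -/
theorem IsKleinMatrix.cutsOut_aeval {M N : Matrix (Fin 3) (Fin 3) ℂ} (h : IsKleinMatrix M N)
    {H : Poly3} {d : ℕ} {D : CurveDiv kleinQuartic} (hH : CutsOut kleinQuartic H d D) :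
    CutsOut kleinQuartic (aeval (fun i => linearForm (N i)) H) d
      (Finsupp.mapDomain h.perm D) := by
  have hord (p : CurvePt kleinQuartic) :
      ordAt kleinQuartic (aeval (fun i => linearForm (N i)) H) p.1 =
        ordAt kleinQuartic H (h.perm.symm p).1 := by
    obtain ⟨k, hk⟩ : ∃ k, p.1.rep k ≠ 0 := by
      by_contra! h
      exact p.1.rep_nonzero (funext h)
    have hrep : IsRep kleinQuartic h.symm.toFun 1 (fun i => linearForm (N i)) 1 (X k) := by
      refine ⟨one_ne_zero, one_ne_zero, fun i => linearForm_isHomogeneous _, isHomogeneous_X _ _,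
        fun q _ => ?_⟩
      have he : (fun i => eval q.1.rep (linearForm (N i))) = N *ᵥ q.1.rep := by
        funext i
        rw [eval_linearForm, dotProduct_comm]
        rfl
      refine ⟨he ▸ h.symm.mulVec_ne_zero q.1.rep_nonzero, ?_⟩
      simp only [he]
      rfl
    exact hrep.ordAt_aeval kleinQuartic_isSmoothQuartic h.isRegularMap_toFun
      h.symm.toFun_toFun h.toFun_toFun (by simpa [VanishesAt] using hk) hH.homogeneous
  refine ⟨?_, fun hd => hH.not_dvd ?_, fun p => ?_⟩
  · have := hH.homogeneous.aeval (fun i => linearForm (N i)) fun i => linearForm_isHomogeneous (N i)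
    rwa [one_mul] at this
  · have h1 := hord (h.perm (coordPt 0))
    rw [Equiv.symm_apply_apply, (kleinQuartic_isSmoothQuartic.ordAt_eq_top_iff
      (h.perm (coordPt 0)).2).2 hd] at h1
    exact (kleinQuartic_isSmoothQuartic.ordAt_eq_top_iff (coordPt 0).2).1 h1.symm
  · rw [vanishingOrder_eq_toNat, hord, ← vanishingOrder_eq_toNat, ← hH.apply_eq]
    conv_lhs => rw [← h.perm.apply_symm_apply p]
    exact Finsupp.mapDomain_apply h.perm.injective D _

/-! ## Automorphisms that preserve the class of `etaSym` -/

/-- The permutation `σ` preserves linear equivalence and the class of `etaSym`. -/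
structure FixesEta (σ : Equiv.Perm (CurvePt kleinQuartic)) : Prop where
  preservesPrincipal : PreservesPrincipal σ
  preservesPrincipal_symm : PreservesPrincipal σ.symm
  kleinClass_eq : kleinClass (Finsupp.mapDomain σ etaSym) = kleinClass etaSym

theorem FixesEta.trans {σ τ : Equiv.Perm (CurvePt kleinQuartic)} (hσ : FixesEta σ)
    (hτ : FixesEta τ) : FixesEta (σ.trans τ) := by
  refine ⟨hσ.1.trans hτ.1, hτ.2.trans hσ.2, ?_⟩
  rw [Equiv.coe_trans, Finsupp.mapDomain_comp, hτ.1.kleinClass_eq hσ.3, hτ.3]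

theorem mapDomain_etaSym (σ : Equiv.Perm (CurvePt kleinQuartic)) :
    Finsupp.mapDomain σ etaSym = Finsupp.single (σ (coordPt 2)) 1 +
      Finsupp.single (σ (coordPt 1)) 2 - Finsupp.single (σ (coordPt 0)) 1 := by
  rw [etaSym, mapDomain_sub, Finsupp.mapDomain_add, Finsupp.mapDomain_single,
    Finsupp.mapDomain_single, Finsupp.mapDomain_single]

theorem fixesEta_phiPerm {ζ : ℂ} (hζ : IsPrimitiveRoot ζ 7) (i : ZMod 7) :
    FixesEta (phiPerm hζ i) :=
  ⟨(IsKleinMatrix.isCurveAut_perm _).preservesPrincipal,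
    (IsKleinMatrix.isCurveAut_perm _).preservesPrincipal_symm, by
    rw [mapDomain_etaSym, phiPerm_coordPt, phiPerm_coordPt, phiPerm_coordPt, etaSym]⟩

/-- The permutation matrix `(x, y, z) ↦ (z, x, y)`. -/
def rotationMatrix : Matrix (Fin 3) (Fin 3) ℂ := !![0, 0, 1; 1, 0, 0; 0, 1, 0]

theorem isKleinMatrix_rotationMatrix :
    IsKleinMatrix rotationMatrix (!![0, 1, 0; 0, 0, 1; 1, 0, 0]) := by
  refine ⟨?_, ?_, fun v hv => ?_, fun v hv => ?_⟩
  · ext i j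
    fin_cases i <;> fin_cases j <;> simp [rotationMatrix, mul_apply, Fin.sum_univ_three]
  · ext i j
    fin_cases i <;> fin_cases j <;> simp [rotationMatrix, mul_apply, Fin.sum_univ_three]
  · rw [eval_kleinQuartic] at hv ⊢
    simp [rotationMatrix, mulVec, dotProduct, Fin.sum_univ_three]
    linear_combination hv
  · rw [eval_kleinQuartic] at hv ⊢
    simp [mulVec, dotProduct, Fin.sum_univ_three]
    linear_combination hv

theorem perm_rotationMatrix_coordPt (k : Fin 3) :
    isKleinMatrix_rotationMatrix.perm (coordPt k) = coordPt (k + 1) := by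
  rw [coordPt, IsKleinMatrix.perm_kleinPt]
  refine kleinPt_eq_iff.2 ⟨1, ?_⟩
  rw [mulVec_single_one, one_smul]
  funext j
  fin_cases k <;> fin_cases j <;> simp [rotationMatrix]

theorem fixesEta_rotation : FixesEta isKleinMatrix_rotationMatrix.perm := by
  refine ⟨(IsKleinMatrix.isCurveAut_perm _).preservesPrincipal,
    (IsKleinMatrix.isCurveAut_perm _).preservesPrincipal_symm, ?_⟩
  have h1 := hClass_eq_zero_two.symm.trans hClass_eq_two_one
  have h2 := hClass_eq_zero_two.symm.trans hClass_eq_one_zero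
  rw [mapDomain_etaSym, perm_rotationMatrix_coordPt, perm_rotationMatrix_coordPt,
    perm_rotationMatrix_coordPt, kleinClass_etaSym]
  simp only [map_add, map_sub, kleinClass_single, one_smul, show (2 + 1 : Fin 3) = 0 from rfl,
    show (1 + 1 : Fin 3) = 2 from rfl, show (0 + 1 : Fin 3) = 1 from rfl]
  linear_combination (norm := module) h2

/-- The sum of the coordinate points. -/
noncomputable def coordDiv : CurveDiv kleinQuartic := ∑ k, Finsupp.single (coordPt k) 1

theorem cutsOut_prod_X : CutsOut kleinQuartic (X 0 * X 1 * X 2) 3 ((4 : ℤ) • coordDiv) := by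
  have h := ((cutsOut_X 0).mul kleinQuartic_isSmoothQuartic (cutsOut_X 1)).mul
    kleinQuartic_isSmoothQuartic (cutsOut_X 2)
  have he (k : Fin 3) (n : ℤ) : (Finsupp.single (coordPt k) n : CurveDiv kleinQuartic) =
      n • Finsupp.single (coordPt k) 1 := by
    rw [Finsupp.smul_single, smul_eq_mul, mul_one]
  convert h using 1
  rw [coordDiv, Fin.sum_univ_three, he _ 3, he _ 3, he _ 3, show (0 + 2 : Fin 3) = 2 from rfl,
    show (0 + 1 : Fin 3) = 1 from rfl, show (1 + 2 : Fin 3) = 0 from rfl,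
    show (1 + 1 : Fin 3) = 2 from rfl, show (2 + 2 : Fin 3) = 1 from rfl,
    show (2 + 1 : Fin 3) = 0 from rfl]
  module

/-- Presents η as 2(A + B + C) - H, so that its image under an automorphism depends only on the
image of the triangle. -/
theorem etaSym_eq : etaSym = (2 : ℤ) • coordDiv -
    (Finsupp.single (coordPt (1 + 2)) 3 + Finsupp.single (coordPt (1 + 1)) 1) := by
  have he (k : Fin 3) (n : ℤ) : (Finsupp.single (coordPt k) n : CurveDiv kleinQuartic) =
      n • Finsupp.single (coordPt k) 1 := by
    rw [Finsupp.smul_single, smul_eq_mul, mul_one]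
  rw [etaSym, coordDiv, Fin.sum_univ_three, he _ 3, he _ 2,
    show (1 + 2 : Fin 3) = 0 from rfl, show (1 + 1 : Fin 3) = 2 from rfl]
  module

/-- Let T = A + B + C and let T' be its image. By `prod_linearForm` the two triangles together form
the square of a cubic on the curve, so that cubic cuts out 2T + 2T'. Since 4T ~ 3H as well, 2T' ~
2T, and `etaSym_eq` concludes. -/
theorem IsInvolutionData.fixesEta {a b c s : ℂ} (h : IsInvolutionData a b c s) :
    FixesEta h.isKleinMatrix.perm := by
  have hpres := (IsKleinMatrix.isCurveAut_perm h.isKleinMatrix).preservesPrincipal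
  refine ⟨hpres, (IsKleinMatrix.isCurveAut_perm _).preservesPrincipal_symm, ?_⟩
  set D' := Finsupp.mapDomain h.isKleinMatrix.perm coordDiv with hD'
  have hmap (n : ℤ) : Finsupp.mapDomain h.isKleinMatrix.perm (n • coordDiv) = n • D' :=
    map_zsmul (Finsupp.mapDomain.addMonoidHom _) n coordDiv
  have hX := cutsOut_prod_X
  have hL := h.isKleinMatrix.cutsOut_aeval hX
  rw [hmap] at hL
  simp only [map_mul, aeval_X] at hL
  have hXL := hX.mul kleinQuartic_isSmoothQuartic hL
  set m : Poly3 := X 0 ^ 2 * X 1 + X 1 ^ 2 * X 2 + X 2 ^ 2 * X 0 + X 0 * X 1 * X 2 with hm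
  have hmh : m.IsHomogeneous 3 :=
    ((((isHomogeneous_X_pow _ _).mul (isHomogeneous_X _ _)).add
      ((isHomogeneous_X_pow _ _).mul (isHomogeneous_X _ _))).add
      ((isHomogeneous_X_pow _ _).mul (isHomogeneous_X _ _))).add
      (((isHomogeneous_X _ _).mul (isHomogeneous_X _ _)).mul (isHomogeneous_X _ _))
  have hmd : ¬ kleinQuartic ∣ m := by
    refine not_dvd_of_isHomogeneous kleinQuartic_isHomogeneous hmh (fun h0 => ?_) (by norm_num)
    have := congrArg (eval 1) h0
    simp [hm] at this
    norm_num at this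
  have hprod := h.prod_linearForm
  rw [← hm] at hprod
  have hcut : CutsOut kleinQuartic m 3 ((2 : ℤ) • coordDiv + (2 : ℤ) • D') := by
    refine ⟨hmh, hmd, fun p => ?_⟩
    have h1 := hXL.apply_eq p
    have h2 : ordAt kleinQuartic ((X 0 * X 1 * X 2) * (linearForm (involutionMatrix a b c 0) *
        linearForm (involutionMatrix a b c 1) * linearForm (involutionMatrix a b c 2))) p.1 =
        ordAt kleinQuartic (C (-s) * (m * m)) p.1 := by
      refine ordAt_congr _ ⟨C s * (X 0 * X 1 + X 1 * X 2 + X 2 * X 0), ?_⟩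
      rw [show involutionMatrix a b c 0 = ![a, b, c] from rfl,
        show involutionMatrix a b c 1 = ![b, c, a] from rfl,
        show involutionMatrix a b c 2 = ![c, a, b] from rfl, hprod, C_neg]
      ring
    rw [kleinQuartic_isSmoothQuartic.ordAt_mul p.2 (C (-s)),
      ordAt_C kleinQuartic_isSmoothQuartic p.2 (neg_ne_zero.2 h.ne_zero), zero_add] at h2
    rw [vanishingOrder_eq_toNat, h2, ← vanishingOrder_eq_toNat,
      kleinQuartic_isSmoothQuartic.vanishingOrder_mul p.2 hmd hmd] at h1
    simp only [Finsupp.add_apply, Finsupp.smul_apply, smul_eq_mul] at h1 ⊢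
    push_cast at h1
    linarith
  have hX1 := (((cutsOut_X 1).mul kleinQuartic_isSmoothQuartic (cutsOut_X 1)).mul
    kleinQuartic_isSmoothQuartic (cutsOut_X 1))
  have e1 := hX.kleinClass_eq hX1
  have e2 := hcut.kleinClass_eq hX1
  have e3 := kleinClass_lineSection (h.isKleinMatrix.cutsOut_aeval (cutsOut_X 1))
  have e4 := kleinClass_lineSection (cutsOut_X 1)
  rw [etaSym_eq, mapDomain_sub, hmap, map_sub, map_sub, e3, e4]
  simp only [map_add _ ((2 : ℤ) • coordDiv), map_zsmul] at e1 e2 ⊢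
  linear_combination (norm := module) e2 - e1

/-! ## Tangent lines -/

theorem eq_smul_of_cross_eq_zero {v w : Fin 3 → ℂ} (hw : w ≠ 0) (h : v ⨯₃ w = 0) :
    ∃ c : ℂ, v = c • w := by
  obtain ⟨i, hi⟩ : ∃ i, w i ≠ 0 := by
    by_contra! h
    exact hw (funext h)
  refine ⟨v i / w i, ?_⟩
  have h0 := congrFun h 0
  have h1 := congrFun h 1
  have h2 := congrFun h 2
  simp only [cross_apply, cons_val, Pi.zero_apply] at h0 h1 h2
  funext j
  rw [Pi.smul_apply, smul_eq_mul, div_mul_eq_mul_div, eq_div_iff hi]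
  fin_cases i <;> fin_cases j <;> simp <;> grind

namespace IsSmoothQuartic

variable {f : Poly3} (hf : IsSmoothQuartic f) {p : PPlane} (hp : VanishesAt f p)

include hf hp

theorem exists_gradientAt_eq {F : Poly3} {d : ℕ} (hF : F.IsHomogeneous d)
    (h : 2 ≤ ordAt f F p) : eval p.rep F = 0 ∧
      ∃ c : ℂ, gradientAt F p.rep = c • gradientAt f p.rep := by
  have h1 := hf.cross_eq_zero_of_two_le_ordAt p.rep_nonzero hp hF (by rwa [p.mk_rep])
  exact ⟨h1.1, eq_smul_of_cross_eq_zero (hf.gradientAt_ne_zero hp) h1.2⟩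

/-- Two tangent lines at the same point agree. -/
theorem exists_eq_C_mul {l l' : Poly3} (hl : l.IsHomogeneous 1) (hl' : l'.IsHomogeneous 1)
    (hl0 : l' ≠ 0) (h : 2 ≤ ordAt f l p) (h' : 2 ≤ ordAt f l' p) : ∃ c : ℂ, l = C c * l' := by
  obtain ⟨-, c, hc⟩ := hf.exists_gradientAt_eq hp hl h
  obtain ⟨-, c', hc'⟩ := hf.exists_gradientAt_eq hp hl' h'
  have hc0 : c' ≠ 0 := by
    rintro rfl
    apply hl0
    rw [eq_linearForm hl' p.rep, hc', zero_smul]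
    simp [linearForm]
  refine ⟨c / c', MvPolynomial.funext fun v => ?_⟩
  rw [map_mul, eval_C, eq_linearForm hl p.rep, eq_linearForm hl' p.rep, eval_linearForm,
    eval_linearForm, hc, hc', dotProduct_smul, dotProduct_smul, smul_eq_mul, smul_eq_mul]
  field_simp

theorem exists_tangent : ∃ l : Poly3, l.IsHomogeneous 1 ∧ l ≠ 0 ∧ 2 ≤ ordAt f l p := by
  have h0 := hf.gradientAt_ne_zero hp
  refine ⟨linearForm (gradientAt f p.rep), linearForm_isHomogeneous _, linearForm_ne_zero h0,
    hf.two_le_ordAt hp (linearForm_isHomogeneous _) ?_ (c := 1) ?_⟩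
  · rw [VanishesAt, eval_linearForm, dotProduct_gradientAt hf.homogeneous,
      show eval p.rep f = 0 from hp, mul_zero]
  · rw [gradientAt_linearForm, one_smul]

end IsSmoothQuartic

theorem gradientAt_mul (F G : Poly3) (v : Fin 3 → ℂ) :
    gradientAt (F * G) v = eval v F • gradientAt G v + eval v G • gradientAt F v := by
  funext i
  simp only [gradientAt, Derivation.leibniz, map_add, smul_eq_mul, map_mul, Pi.add_apply,
    Pi.smul_apply]

/-! ## Flexes -/

/-- The point `p` is a flex of the Klein quartic. -/
def IsFlex (p : CurvePt kleinQuartic) : Prop :=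
  ∃ l : Poly3, l.IsHomogeneous 1 ∧ l ≠ 0 ∧ 3 ≤ ordAt kleinQuartic l p.1

theorem not_dvd_of_isHomogeneous_of_lt {F : Poly3} {d : ℕ} (hF : F.IsHomogeneous d) (h0 : F ≠ 0)
    (hd : d < 4) : ¬ kleinQuartic ∣ F :=
  not_dvd_of_isHomogeneous kleinQuartic_isHomogeneous hF h0 hd

/-- The version of `exists_eq_mul_of_ordAt_le` for natural numbers. -/
theorem exists_eq_mul_of_vanishingOrder_le {F G : Poly3} {m n : ℕ} (hF : F.IsHomogeneous (m + n))
    (hG : G.IsHomogeneous n) (hF0 : ¬ kleinQuartic ∣ F) (hG0 : ¬ kleinQuartic ∣ G)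
    (h : ∀ p : CurvePt kleinQuartic,
      vanishingOrder kleinQuartic G p.1 ≤ vanishingOrder kleinQuartic F p.1) :
    ∃ a : Poly3, a.IsHomogeneous m ∧ ¬ kleinQuartic ∣ a ∧ kleinQuartic ∣ F - a * G ∧
      ∀ p : CurvePt kleinQuartic, vanishingOrder kleinQuartic F p.1 =
        vanishingOrder kleinQuartic a p.1 + vanishingOrder kleinQuartic G p.1 := by
  obtain ⟨a, ha, hd⟩ := exists_eq_mul_of_ordAt_le hF hG hG0 fun p hp => by
    rw [← kleinQuartic_isSmoothQuartic.coe_vanishingOrder hp hG0,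
      ← kleinQuartic_isSmoothQuartic.coe_vanishingOrder hp hF0]
    exact_mod_cast h ⟨p, hp⟩
  have ha0 : ¬ kleinQuartic ∣ a := fun h0 => hF0 ((dvd_sub_left (h0.mul_right G)).1 hd)
  refine ⟨a, ha, ha0, hd, fun p => ?_⟩
  rw [← kleinQuartic_isSmoothQuartic.vanishingOrder_mul p.2 ha0 hG0, vanishingOrder_eq_toNat,
    vanishingOrder_eq_toNat, ordAt_congr p.1 hd]

/-- By Riemann–Roch, a nonconstant function whose only pole is of order at most three at P puts P on
a line meeting the curve three times there. The proof below uses only completeness of the systems of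
forms: if the tangent l had contact exactly two, it would be proportional to a transversal line. -/
theorem isFlex_of_kleinClass_eq {P Q R : CurvePt kleinQuartic} (hQ : P ≠ Q) (hR : P ≠ R)
    (h : (2 : ℤ) • ptClass R + ptClass Q = (3 : ℤ) • ptClass P) : IsFlex P := by
  have hK := kleinQuartic_isSmoothQuartic
  obtain ⟨d, F, G, hF, hG, hF0, hG0, hFG⟩ : Finsupp.single R 2 + Finsupp.single Q 1 -
      Finsupp.single P 3 ∈ kleinQuartic_isSmoothQuartic.principalDivisors := by
    rw [← kleinClass_eq_iff, map_add, kleinClass_single, kleinClass_single, kleinClass_single,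
      one_smul, h]
  obtain ⟨l, hl, hl0, hl2⟩ := hK.exists_tangent P.2
  refine ⟨l, hl, hl0, ?_⟩
  by_contra hl3
  obtain ⟨l', hl', hl1'⟩ := hK.exists_ordAt_eq_one P.2
  have hl0' : l' ≠ 0 := by
    rintro rfl
    rw [(hK.ordAt_eq_top_iff P.2).2 (dvd_zero _)] at hl1'
    simp at hl1'
  have hd := not_dvd_of_isHomogeneous_of_lt hl hl0 (by norm_num)
  have hd' := not_dvd_of_isHomogeneous_of_lt hl' hl0' (by norm_num)
  have o2 : vanishingOrder kleinQuartic l P.1 = 2 := by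
    rw [← hK.coe_vanishingOrder P.2 hd] at hl2 hl3
    norm_cast at hl2 hl3
    omega
  have o1 : vanishingOrder kleinQuartic l' P.1 = 1 := by
    rw [← hK.coe_vanishingOrder P.2 hd'] at hl1'
    exact_mod_cast hl1'
  have hnn (p) : (0 : ℤ) ≤ (Finsupp.single R 2 + Finsupp.single Q 1 : CurveDiv kleinQuartic) p :=
    (add_nonneg (Finsupp.single_nonneg.2 (by norm_num)) (Finsupp.single_nonneg.2 (by norm_num)) :
      (0 : CurveDiv kleinQuartic) ≤ _) p
  have hP0 : (Finsupp.single R 2 + Finsupp.single Q 1 : CurveDiv kleinQuartic) P = 0 := by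
    rw [Finsupp.add_apply, Finsupp.single_eq_of_ne hQ, Finsupp.single_eq_of_ne hR, add_zero]
  have hll := hK.not_dvd_mul hd hd'
  have hFll := hK.not_dvd_mul hll hF0
  have hord (p : CurvePt kleinQuartic) : vanishingOrder kleinQuartic (l * l' * F) p.1 =
      vanishingOrder kleinQuartic l p.1 + vanishingOrder kleinQuartic l' p.1 +
        vanishingOrder kleinQuartic F p.1 := by
    rw [hK.vanishingOrder_mul p.2 hll hF0, hK.vanishingOrder_mul p.2 hd hd']
  -- The product l·l' vanishes at P to order 2 + 1 and absorbs the pole 3P, so l·l'·F/G is a conic a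
  -- that does not vanish at P.
  obtain ⟨a, ha, ha0, -, hao⟩ := exists_eq_mul_of_vanishingOrder_le (m := 2) (n := d)
    ((hl.mul hl').mul hF) hG hFll hG0 fun p => by
      have h1 := hFG p
      have h2 := hnn p
      rw [hord]
      rw [Finsupp.sub_apply] at h1
      by_cases hp : p = P
      · subst hp
        rw [hP0, Finsupp.single_eq_same] at h1
        omega
      · rw [Finsupp.single_eq_of_ne hp] at h1
        omega
  have haP : vanishingOrder kleinQuartic a P.1 = 0 := by
    have h1 := hFG P
    have h2 := hao P
    rw [hord, o1, o2] at h2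
    rw [Finsupp.sub_apply, hP0, Finsupp.single_eq_same] at h1
    omega
  -- The cubic a·l vanishes on the divisor of l', so a·l = b·l' modulo f, hence exactly, since the
  -- degree is below four.
  have hal := hK.not_dvd_mul ha0 hd
  obtain ⟨b, hb, -, hbd, -⟩ := exists_eq_mul_of_vanishingOrder_le (m := 2) (n := 1)
    (ha.mul hl) hl' hal hd' fun p => by
      have h1 := hFG p
      have h2 := hnn p
      have h3 := hao p
      rw [hord] at h3
      rw [Finsupp.sub_apply] at h1
      rw [hK.vanishingOrder_mul p.2 ha0 hd]
      by_cases hp : p = P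
      · subst hp
        omega
      · rw [Finsupp.single_eq_of_ne hp] at h1
        omega
  have heq : a * l = b * l' := by
    by_contra hne
    exact not_dvd_of_isHomogeneous_of_lt ((ha.mul hl).sub (hb.mul hl')) (sub_ne_zero.2 hne)
      (by norm_num) hbd
  have hlP : eval P.1.rep l = 0 := (hK.exists_gradientAt_eq P.2 hl hl2).1
  have hlP' : eval P.1.rep l' = 0 := by
    by_contra h0
    rw [(hK.ordAt_eq_zero_iff P.2 hl').2 h0] at hl1'
    simp at hl1'
  have haP' : eval P.1.rep a ≠ 0 := by
    refine (hK.ordAt_eq_zero_iff P.2 ha).1 ?_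
    rw [← hK.coe_vanishingOrder P.2 ha0, haP, Nat.cast_zero]
  -- Both lines pass through P, so the gradients at P give a(P)·l = b(P)·l', which contradicts the
  -- different orders of l and l'.
  have hgrad := congrArg (gradientAt · P.1.rep) heq
  simp only [gradientAt_mul, hlP, hlP', zero_smul, add_zero] at hgrad
  have hl4 : l' * C (eval P.1.rep b) = l * C (eval P.1.rep a) := by
    refine MvPolynomial.funext fun v => ?_
    have := congrArg (v ⬝ᵥ ·) hgrad
    simp only [dotProduct_smul, smul_eq_mul] at this
    rw [map_mul, map_mul, eval_C, eval_C, eq_linearForm hl P.1.rep, eq_linearForm hl' P.1.rep,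
      eval_linearForm, eval_linearForm]
    linear_combination -this
  have hbP : eval P.1.rep b ≠ 0 := by
    intro h0
    rw [h0, C_0, mul_zero, zero_eq_mul, C_eq_zero] at hl4
    exact hl4.elim hl0 haP'
  have h5 := congrArg (ordAt kleinQuartic · P.1) hl4
  simp only [hK.ordAt_mul P.2] at h5
  rw [ordAt_C hK P.2 hbP, ordAt_C hK P.2 haP', hl1', add_zero, add_zero] at h5
  rw [← h5] at hl2
  norm_num at hl2

/-! ## The flexes lie on the Hessian -/

/-- Restrict the relation expressing contact of order three to a line in the tangent direction. The
quadratic term of f along it must vanish, and on the curve this term is a multiple of z² times the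
Hessian. -/
theorem IsFlex.hessian_eq_zero {v : Fin 3 → ℂ} {hv : v ≠ 0} {h : eval v kleinQuartic = 0}
    (hP : IsFlex (kleinPt v hv h)) :
    v 2 ^ 2 * (v 0 * v 1 ^ 5 + v 1 * v 2 ^ 5 + v 2 * v 0 ^ 5 -
      5 * v 0 ^ 2 * v 1 ^ 2 * v 2 ^ 2) = 0 := by
  have hK := kleinQuartic_isSmoothQuartic
  obtain ⟨l, hl, hl0, h3⟩ := hP
  have hp := (kleinPt v hv h).2
  obtain ⟨s, hs, a, ha, g, hsa⟩ := (hK.le_ordAt_iff hp (n := 3)).1 (by exact_mod_cast h3)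
  -- Since s is not homogeneous, it is only known to be nonzero at some multiple of the vector; the
  -- computation moves to that multiple u.
  obtain ⟨t, ht, hst⟩ := exists_eval_ne_zero_of_notMem hs
  obtain ⟨c, hc, hrep⟩ := exists_rep_mk_eq hv
  obtain ⟨μ, hμ⟩ : ∃ μ, μ = t * c := ⟨_, rfl⟩
  have hμ0 : μ ≠ 0 := hμ ▸ mul_ne_zero ht hc
  have hsμ : eval (μ • v) s ≠ 0 := by
    rwa [hμ, mul_smul, ← hrep]
  have hmem {F : Poly3} (hF : F ∈ pointIdeal (kleinPt v hv h).1) : eval (μ • v) F = 0 := by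
    have := mem_pointIdeal.1 hF t
    rwa [hμ, mul_smul, ← hrep]
  obtain ⟨u, hu⟩ : ∃ u, u = μ • v := ⟨_, rfl⟩
  rw [← hu] at hsμ
  have hu0 : u ≠ 0 := hu ▸ smul_ne_zero hμ0 hv
  have huK : eval u kleinQuartic = 0 := by
    rw [hu, eval_smul_of_isHomogeneous kleinQuartic_isHomogeneous, h, mul_zero]
  have htan : eval u l = 0 ∧ gradientAt l u ⨯₃ gradientAt kleinQuartic u = 0 := by
    refine hK.cross_eq_zero_of_two_le_ordAt hu0 huK hl ?_
    have : Projectivization.mk ℂ u hu0 = (kleinPt v hv h).1 :=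
      (Projectivization.mk_eq_mk_iff' ..).2 ⟨μ, hu.symm⟩
    rw [this]
    exact le_trans (by norm_num) h3
  have hgK : gradientAt kleinQuartic u ≠ 0 := by
    have hp' := (vanishesAt_mk kleinQuartic_isHomogeneous hu0).2 huK
    obtain ⟨e, he, hre⟩ := exists_rep_mk_eq hu0
    have := hK.gradientAt_ne_zero hp'
    rw [hre, gradientAt_smul kleinQuartic_isHomogeneous] at this
    exact fun h0 => this (by rw [h0, smul_zero])
  obtain ⟨e, he⟩ := eq_smul_of_cross_eq_zero hgK htan.2
  let Φ (w : Fin 3 → ℂ) : Poly3 →ₐ[ℂ] Polynomial ℂ :=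
    aeval fun i => Polynomial.C (u i) + Polynomial.C (w i) * Polynomial.X
  have hΦ0 (w : Fin 3 → ℂ) (F : Poly3) : (Φ w F).eval 0 = eval u F := by
    have : (Polynomial.evalRingHom 0).comp (Φ w).toRingHom = eval u := by
      apply MvPolynomial.ringHom_ext
      · intro r; simp [Φ]
      · intro i; simp [Φ]
    exact RingHom.congr_fun this F
  have hΦa (w : Fin 3 → ℂ) : Polynomial.X ^ 3 ∣ Φ w a := by
    rw [← Ideal.mem_span_singleton, ← Ideal.span_singleton_pow]
    have h1 : (pointIdeal (kleinPt v hv h).1).map (Φ w).toRingHom ≤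
        Ideal.span {Polynomial.X} := by
      rw [Ideal.map_le_iff_le_comap]
      intro x hx
      rw [Ideal.mem_comap, Ideal.mem_span_singleton, Polynomial.X_dvd_iff,
        Polynomial.coeff_zero_eq_eval_zero]
      exact (hΦ0 w x).trans (hu ▸ hmem hx)
    refine Ideal.pow_right_mono h1 3 ?_
    rw [← Ideal.map_pow]
    exact Ideal.mem_map_of_mem _ ha
  have hΦl (w : Fin 3 → ℂ) : Φ w l = Polynomial.C (w ⬝ᵥ gradientAt l u) * Polynomial.X := by
    have h0 := htan.1
    rw [eq_linearForm hl u, eval_linearForm] at h0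
    conv_lhs => rw [eq_linearForm hl u]
    generalize gradientAt l u = b at h0
    simp only [linearForm, Φ, map_mul, aeval_X, Fin.sum_univ_three,
      dotProduct, map_add, algHom_C, Polynomial.algebraMap_eq] at h0 ⊢
    have h0' := congrArg Polynomial.C h0
    simp only [map_add, map_mul, map_zero] at h0'
    linear_combination h0'
  have hΦs (w : Fin 3 → ℂ) : Φ w s * Φ w l = Φ w a + Φ w g * Φ w kleinQuartic := by
    rw [← map_mul, hsa, map_add, map_mul]
  -- Otherwise s·l would vanish to second order at u along every direction, although s(u) ≠ 0 and l
  -- is a nonzero linear form.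
  have hg : eval u g ≠ 0 := by
    intro hg0
    obtain ⟨w, hw⟩ : ∃ w, w ⬝ᵥ gradientAt l u ≠ 0 := by
      by_contra! hw
      apply hl0
      rw [eq_linearForm hl u]
      refine MvPolynomial.funext fun w => ?_
      rw [eval_linearForm, hw, map_zero]
    have h1 : Polynomial.X ^ 2 ∣ Φ w s * Φ w l := by
      rw [hΦs, pow_two]
      refine dvd_add ((Dvd.intro_left Polynomial.X (by ring)).trans (hΦa w)) (mul_dvd_mul ?_ ?_)
      · rw [Polynomial.X_dvd_iff, Polynomial.coeff_zero_eq_eval_zero, hΦ0, hg0]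
      · rw [Polynomial.X_dvd_iff, Polynomial.coeff_zero_eq_eval_zero, hΦ0, huK]
    rw [hΦl, ← mul_assoc, pow_two] at h1
    have h2 := (mul_dvd_mul_iff_right Polynomial.X_ne_zero).1 h1
    rw [Polynomial.X_dvd_iff, Polynomial.coeff_zero_eq_eval_zero, Polynomial.eval_mul, hΦ0,
      Polynomial.eval_C] at h2
    exact mul_ne_zero hsμ hw h2
  have hgw := gradientAt_kleinQuartic u
  rw [eval_kleinQuartic] at huK
  obtain ⟨x, hx⟩ : ∃ x, x = u 0 := ⟨_, rfl⟩
  obtain ⟨y, hy⟩ : ∃ y, y = u 1 := ⟨_, rfl⟩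
  obtain ⟨z, hz⟩ : ∃ z, z = u 2 := ⟨_, rfl⟩
  rw [← hx, ← hy, ← hz] at hgw huK
  -- The direction (f_y, -f_x, 0) is tangent, so l vanishes identically along it.
  obtain ⟨p, hp⟩ : ∃ p, p = x ^ 3 + 3 * y ^ 2 * z := ⟨_, rfl⟩
  obtain ⟨q, hq⟩ : ∃ q, q = -(3 * x ^ 2 * y + z ^ 3) := ⟨_, rfl⟩
  have hl1 : Φ ![p, q, 0] l = 0 := by
    rw [hΦl, he, hgw, dotProduct_smul]
    simp only [dotProduct, Fin.sum_univ_three, cons_val, hp, hq]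
    rw [show ∀ r : ℂ, e • r = e * r from fun _ => rfl]
    have : e * ((x ^ 3 + 3 * y ^ 2 * z) * (3 * x ^ 2 * y + z ^ 3) +
      -(3 * x ^ 2 * y + z ^ 3) * (x ^ 3 + 3 * y ^ 2 * z) + 0 * (y ^ 3 + 3 * z ^ 2 * x)) = 0 := by
      ring
    rw [this, Polynomial.C_0, zero_mul]
  have hKw : ∃ r, Φ ![p, q, 0] kleinQuartic = Polynomial.X ^ 2 * (Polynomial.C
      (3 * (x * y * p ^ 2 + x ^ 2 * p * q + y * z * q ^ 2)) + Polynomial.X * r) := by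
    have hlin : 3 * x ^ 2 * y * p + x ^ 3 * q + 3 * y ^ 2 * z * q + z ^ 3 * p = 0 := by
      rw [hp, hq]
      ring
    have hlin' := congrArg Polynomial.C hlin
    have huK' := congrArg Polynomial.C huK
    refine ⟨Polynomial.C (y * p ^ 3 + 3 * x * p ^ 2 * q + z * q ^ 3) +
      Polynomial.X * Polynomial.C (p ^ 3 * q), ?_⟩
    simp only [Φ, kleinQuartic, map_add, map_mul, map_pow, aeval_X, cons_val, ← hx, ← hy, ← hz,
      map_zero, zero_mul, map_ofNat] at hlin' huK' ⊢
    linear_combination huK' + Polynomial.X * hlin'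
  obtain ⟨r, hr⟩ := hKw
  have h1 := hΦs ![p, q, 0]
  rw [hl1, mul_zero, hr] at h1
  have h2 : Polynomial.X ^ 3 ∣ Φ ![p, q, 0] g * (Polynomial.X ^ 2 * (Polynomial.C
      (3 * (x * y * p ^ 2 + x ^ 2 * p * q + y * z * q ^ 2)) + Polynomial.X * r)) :=
    (dvd_add_right (hΦa _)).1 (h1 ▸ dvd_zero _)
  rw [mul_left_comm, pow_succ, mul_dvd_mul_iff_left (pow_ne_zero 2 Polynomial.X_ne_zero),
    Polynomial.X_dvd_iff, Polynomial.coeff_zero_eq_eval_zero, Polynomial.eval_mul, hΦ0] at h2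
  have h4 := (mul_eq_zero.1 h2).resolve_left hg
  simp only [Polynomial.eval_add, Polynomial.eval_C, Polynomial.eval_mul, Polynomial.eval_X,
    zero_mul, add_zero] at h4
  have h5 : z ^ 2 * (x * y ^ 5 + y * z ^ 5 + z * x ^ 5 - 5 * x ^ 2 * y ^ 2 * z ^ 2) = 0 := by
    rw [hp, hq] at h4
    linear_combination h4 / 3 - (8 * x * y ^ 2 * z - 2 * x ^ 4) * huK
  rw [hx, hy, hz, hu] at h5
  simp only [Pi.smul_apply, smul_eq_mul] at h5
  refine (mul_eq_zero.1 (?_ : μ ^ 8 * _ = 0)).resolve_left (pow_ne_zero 8 hμ0)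
  linear_combination h5

/-! ## The flexes are the images of a coordinate point -/

theorem exists_fixesEta_coordPt (k : Fin 3) : ∃ g, FixesEta g ∧ g (coordPt 0) = coordPt k := by
  have h1 := fixesEta_rotation
  fin_cases k
  · refine ⟨_, (h1.trans h1).trans h1, ?_⟩
    simp only [Equiv.trans_apply, perm_rotationMatrix_coordPt]
    rfl
  · exact ⟨_, h1, perm_rotationMatrix_coordPt 0⟩
  · refine ⟨_, h1.trans h1, ?_⟩
    simp only [Equiv.trans_apply, perm_rotationMatrix_coordPt]
    rfl

/-- The roots x/z are the values of the invariant x²y/z³ at the three images of A, B, C under the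
involution. -/
theorem IsInvolutionData.cubic_eq {a b c s : ℂ} (h : IsInvolutionData a b c s) (x z : ℂ) :
    (c ^ 3 * x - a ^ 2 * b * z) * (a ^ 3 * x - b ^ 2 * c * z) * (b ^ 3 * x - c ^ 2 * a * z) =
      s ^ 3 * (x ^ 3 + 8 * x ^ 2 * z + 5 * x * z ^ 2 - z ^ 3) := by
  have e1 : a ^ 5 * b ^ 4 + b ^ 5 * c ^ 4 + c ^ 5 * a ^ 4 = 56 * s := by
    obtain ⟨h1, h2, h3, h4, h5⟩ := h
    grind
  have e2 : a ^ 5 * c + b ^ 5 * a + c ^ 5 * b = -35 := by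
    obtain ⟨h1, h2, h3, h4, h5⟩ := h
    grind
  have h3 : (a * b * c) ^ 3 = s ^ 3 := by rw [h.mul_eq]
  have h4 : a * b * c * (a ^ 5 * c + b ^ 5 * a + c ^ 5 * b) = s * -35 := by rw [h.mul_eq, e2]
  linear_combination (x ^ 3 - z ^ 3) * h3 - x ^ 2 * z * e1 + x * z ^ 2 * h4 -
    (8 * s * x ^ 2 * z + 5 * s * x * z ^ 2) * h.sq_eq

theorem IsInvolutionData.exists_perm_coordPt {a b c s : ℂ} (h : IsInvolutionData a b c s)
    (k : Fin 3) {w : Fin 3 → ℂ} (hw : involutionMatrix a b c *ᵥ Pi.single k 1 = w) :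
    ∃ hw0 hwK, h.isKleinMatrix.perm (coordPt k) = kleinPt w hw0 hwK := by
  subst hw
  refine ⟨h.isKleinMatrix.symm.mulVec_ne_zero (single_one_ne_zero k),
    h.isKleinMatrix.eval_eq_zero' _ (eval_single_kleinQuartic k), ?_⟩
  rw [coordPt, IsKleinMatrix.perm_kleinPt]
  exact kleinPt_eq_iff.2 ⟨-1 / 7, (smul_mulVec ..).symm⟩

/-- Off the coordinate points the quartic and the Hessian leave a cubic equation for x²y/z³. By
`cubic_eq` its roots belong to the involution's images of A, B, C, and this invariant separates
orbits of φ. -/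
theorem IsFlex.exists_fixesEta {ζ : ℂ} (hζ : IsPrimitiveRoot ζ 7) {P : CurvePt kleinQuartic}
    (hP : IsFlex P) : ∃ g, FixesEta g ∧ g (coordPt 0) = P := by
  by_cases hc : ∃ k, P = coordPt k
  · obtain ⟨k, rfl⟩ := hc
    exact exists_fixesEta_coordPt k
  obtain ⟨v, hv, hvK, rfl⟩ := exists_eq_kleinPt P
  have hv0 : ∀ i, v i ≠ 0 := fun i hi => hc (exists_apply_eq_zero_iff.2 ⟨i, hi⟩)
  have hess := (mul_eq_zero.1 hP.hessian_eq_zero).resolve_left (pow_ne_zero 2 (hv0 2))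
  have hK := hvK
  rw [eval_kleinQuartic] at hK
  -- Elimination: x times the cubic is a combination of the quartic and of y²z² times the Hessian.
  have hcub : (v 0 ^ 2 * v 1) ^ 3 + 8 * (v 0 ^ 2 * v 1) ^ 2 * v 2 ^ 3 +
      5 * (v 0 ^ 2 * v 1) * (v 2 ^ 3) ^ 2 - (v 2 ^ 3) ^ 3 = 0 := by
    refine (mul_eq_zero.1 (?_ : v 0 * _ = 0)).resolve_left (hv0 0)
    linear_combination (-v 2 ^ 6 - v 0 * v 1 ^ 4 * v 2 + 6 * v 0 ^ 2 * v 1 * v 2 ^ 3 +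
      v 0 ^ 4 * v 1 ^ 2) * hK + v 1 ^ 2 * v 2 ^ 2 * hess
  obtain ⟨a, b, c, s, h⟩ := exists_isInvolutionData hζ
  have habc : a ≠ 0 ∧ b ≠ 0 ∧ c ≠ 0 := by
    have := h.ne_zero
    rw [← h.mul_eq] at this
    simpa [and_assoc] using this
  obtain ⟨ha, hb, hc⟩ := habc
  have key (k : Fin 3) (w : Fin 3 → ℂ) (hw : involutionMatrix a b c *ᵥ Pi.single k 1 = w)
      (hw0 : ∀ i, w i ≠ 0) (heq : w 2 ^ 3 * (v 0 ^ 2 * v 1) - w 0 ^ 2 * w 1 * v 2 ^ 3 = 0) :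
      ∃ g, FixesEta g ∧ g (coordPt 0) = kleinPt v hv hvK := by
    obtain ⟨hw1, hwK, hk⟩ := h.exists_perm_coordPt k hw
    obtain ⟨g, hg, hgk⟩ := exists_fixesEta_coordPt k
    obtain ⟨i, hi⟩ := exists_phiPerm_eq hζ (hv := hw1) (h := hwK) (hw := hv) (h' := hvK) hw0 hv0
      (by linear_combination -heq)
    refine ⟨_, (hg.trans h.fixesEta).trans (fixesEta_phiPerm hζ i), ?_⟩
    rw [Equiv.trans_apply, Equiv.trans_apply, hgk, hk, hi]
  have hprod := h.cubic_eq (v 0 ^ 2 * v 1) (v 2 ^ 3)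
  rw [hcub, mul_zero, mul_eq_zero, mul_eq_zero] at hprod
  rcases hprod with (h1 | h1) | h1
  · refine key 0 ![a, b, c] ?_ (fun i => by fin_cases i <;> assumption) h1
    rw [involutionMatrix_mulVec]
    simp
  · refine key 1 ![b, c, a] ?_ (fun i => by fin_cases i <;> assumption) h1
    rw [involutionMatrix_mulVec]
    simp
  · refine key 2 ![c, a, b] ?_ (fun i => by fin_cases i <;> assumption) h1
    rw [involutionMatrix_mulVec]
    simp

/-! ## Invariance of the theta characteristic -/

theorem two_smul_ptClass_coordPt (k : Fin 3) :
    (2 : ℤ) • ptClass (coordPt (k + 2)) + ptClass (coordPt (k + 1)) =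
      (3 : ℤ) • ptClass (coordPt k) := by
  have h1 := hClass_eq_zero_two.symm.trans hClass_eq_two_one
  have h2 := hClass_eq_zero_two.symm.trans hClass_eq_one_zero
  fin_cases k
  · show (2 : ℤ) • ptClass (coordPt 2) + ptClass (coordPt 1) = (3 : ℤ) • ptClass (coordPt 0)
    linear_combination (norm := module) -h1
  · show (2 : ℤ) • ptClass (coordPt 0) + ptClass (coordPt 2) = (3 : ℤ) • ptClass (coordPt 1)
    linear_combination (norm := module) h2
  · show (2 : ℤ) • ptClass (coordPt 1) + ptClass (coordPt 0) = (3 : ℤ) • ptClass (coordPt 2)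
    linear_combination (norm := module) h1 - h2

namespace PreservesPrincipal

variable {σ : Equiv.Perm (CurvePt kleinQuartic)} (hσ : PreservesPrincipal σ)

include hσ

theorem two_smul_ptClass (k : Fin 3) :
    (2 : ℤ) • ptClass (σ (coordPt (k + 2))) + ptClass (σ (coordPt (k + 1))) =
      (3 : ℤ) • ptClass (σ (coordPt k)) := by
  have h := hσ.kleinClass_eq (D := Finsupp.single (coordPt (k + 2)) 2 +
    Finsupp.single (coordPt (k + 1)) 1) (E := Finsupp.single (coordPt k) 3) (by
      rw [map_add, kleinClass_single, kleinClass_single, kleinClass_single, one_smul,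
        two_smul_ptClass_coordPt])
  rwa [Finsupp.mapDomain_add, Finsupp.mapDomain_single, Finsupp.mapDomain_single,
    Finsupp.mapDomain_single, map_add, kleinClass_single, kleinClass_single, kleinClass_single,
    one_smul] at h

/-- Being a flex follows from a relation between classes, which σ transports. -/
theorem isFlex (k : Fin 3) : IsFlex (σ (coordPt k)) := by
  refine isFlex_of_kleinClass_eq (fun h => ?_) (fun h => ?_) (hσ.two_smul_ptClass k)
  all_goals
    have := coordPt_injective (σ.injective h)
    fin_cases k <;> simp at this

end PreservesPrincipal

theorem CutsOut.eq_of_two_le {l l' : Poly3} {D D' : CurveDiv kleinQuartic}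
    (hl : CutsOut kleinQuartic l 1 D) (hl' : CutsOut kleinQuartic l' 1 D')
    {p : CurvePt kleinQuartic} (h : 2 ≤ D p) (h' : 2 ≤ D' p) : D = D' := by
  have hK := kleinQuartic_isSmoothQuartic
  have key {l : Poly3} {D : CurveDiv kleinQuartic} (hl : CutsOut kleinQuartic l 1 D)
      (h : 2 ≤ D p) : 2 ≤ ordAt kleinQuartic l p.1 := by
    rw [hl.apply_eq] at h
    rw [← hK.coe_vanishingOrder p.2 hl.not_dvd]
    exact_mod_cast h
  obtain ⟨c, rfl⟩ := hK.exists_eq_C_mul p.2 hl.homogeneous hl'.homogeneous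
    (fun h0 => hl'.not_dvd (h0 ▸ dvd_zero _)) (key hl h) (key hl' h')
  have hc : c ≠ 0 := by
    rintro rfl
    exact hl.not_dvd (by simp)
  ext q
  rw [hl.apply_eq, hl'.apply_eq, vanishingOrder_eq_toNat, vanishingOrder_eq_toNat,
    hK.ordAt_mul q.2, ordAt_C hK q.2 hc, zero_add]

/-- Rigidity: a permutation that respects linear equivalence and fixes A also fixes B and C, so the
divisor itself is unchanged. -/
theorem PreservesPrincipal.mapDomain_etaSym_eq {τ : Equiv.Perm (CurvePt kleinQuartic)}
    (hτ : PreservesPrincipal τ) (h0 : τ (coordPt 0) = coordPt 0) :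
    Finsupp.mapDomain τ etaSym = etaSym := by
  have hK := kleinQuartic_isSmoothQuartic
  have hne {i j : Fin 3} (hij : i ≠ j) : coordPt i ≠ coordPt j := fun h => hij (coordPt_injective h)
  have hrel := hτ.two_smul_ptClass 0
  rw [h0, show (0 + 2 : Fin 3) = 2 from rfl, show (0 + 1 : Fin 3) = 1 from rfl] at hrel
  obtain ⟨d, F, G, hF, hG, hF0, hG0, hFG⟩ : Finsupp.single (τ (coordPt 2)) 2 +
      Finsupp.single (τ (coordPt 1)) 1 - Finsupp.single (coordPt 0) 3 ∈
      kleinQuartic_isSmoothQuartic.principalDivisors := by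
    rw [← kleinClass_eq_iff, map_add, kleinClass_single, kleinClass_single, kleinClass_single,
      one_smul, hrel]
  have hX := cutsOut_X 1
  rw [show (1 + 2 : Fin 3) = 0 from rfl, show (1 + 1 : Fin 3) = 2 from rfl] at hX
  -- From 2τ(C) + τ(B) ~ 3A and 3A + C ~ H, the effective divisor E has class H; by completeness a
  -- line l cuts it out.
  obtain ⟨E, hE⟩ : ∃ E : CurveDiv kleinQuartic, E = Finsupp.single (τ (coordPt 2)) 2 +
    Finsupp.single (τ (coordPt 1)) 1 + Finsupp.single (coordPt 2) 1 := ⟨_, rfl⟩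
  have hEnn (p) : 0 ≤ E p := by
    rw [hE]
    exact (add_nonneg (add_nonneg (Finsupp.single_nonneg.2 (by norm_num))
      (Finsupp.single_nonneg.2 (by norm_num))) (Finsupp.single_nonneg.2 (by norm_num)) :
      (0 : CurveDiv kleinQuartic) ≤ _) p
  have hXF := hK.not_dvd_mul hX.not_dvd hF0
  have hord (p : CurvePt kleinQuartic) : (vanishingOrder kleinQuartic (X 1 * F) p.1 : ℤ) =
      E p + vanishingOrder kleinQuartic G p.1 := by
    have h1 := hFG p
    have h2 := hX.apply_eq p
    rw [hK.vanishingOrder_mul p.2 hX.not_dvd hF0, hE]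
    simp only [Finsupp.add_apply, Finsupp.sub_apply] at h1 h2 ⊢
    push_cast
    linarith
  obtain ⟨l, hl, hl0, -, hlo⟩ := exists_eq_mul_of_vanishingOrder_le (m := 1) (n := d)
    (hX.homogeneous.mul hF) hG hXF hG0 fun p => by
      have h1 := hord p
      have h2 := hEnn p
      omega
  have hcut : CutsOut kleinQuartic l 1 E := ⟨hl, hl0, fun p => by
    have h1 := hord p
    have h2 := hlo p
    omega⟩
  have hE2 : 2 ≤ E (τ (coordPt 2)) := by
    have hnn : (0 : CurveDiv kleinQuartic) ≤ Finsupp.single (τ (coordPt 1)) 1 +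
      Finsupp.single (coordPt 2) 1 :=
      add_nonneg (Finsupp.single_nonneg.2 (by norm_num)) (Finsupp.single_nonneg.2 (by norm_num))
    have := hnn (τ (coordPt 2))
    rw [hE, add_assoc, Finsupp.add_apply, Finsupp.single_eq_same]
    simpa using this
  -- The line l is tangent at τ(C), which is a flex, so E has multiplicity at least three there. As
  -- τ(B) ≠ τ(C), the third point must be C.
  have hC : τ (coordPt 2) = coordPt 2 := by
    by_contra hne'
    obtain ⟨t, ht, ht0, ht3⟩ := hτ.isFlex 2
    obtain ⟨c, rfl⟩ := hK.exists_eq_C_mul (τ (coordPt 2)).2 ht hl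
      (fun h0 => hl0 (h0 ▸ dvd_zero _)) (le_trans (by norm_num) ht3) (by
        rw [hcut.apply_eq] at hE2
        rw [← hK.coe_vanishingOrder (τ (coordPt 2)).2 hl0]
        exact_mod_cast hE2)
    have hc : c ≠ 0 := by
      rintro rfl
      exact ht0 (by simp)
    rw [hK.ordAt_mul (τ (coordPt 2)).2, ordAt_C hK (τ (coordPt 2)).2 hc, zero_add,
      ← hK.coe_vanishingOrder (τ (coordPt 2)).2 hl0] at ht3
    have h3 : 3 ≤ E (τ (coordPt 2)) := by
      rw [hcut.apply_eq]
      exact_mod_cast ht3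
    rw [hE, Finsupp.add_apply, Finsupp.add_apply, Finsupp.single_eq_same,
      Finsupp.single_eq_of_ne (τ.injective.ne (hne (by decide))),
      Finsupp.single_eq_of_ne hne'] at h3
    norm_num at h3
  rw [hC] at hE2 hE
  have hX0 := cutsOut_X 0
  rw [show (0 + 2 : Fin 3) = 2 from rfl, show (0 + 1 : Fin 3) = 1 from rfl] at hX0
  -- Now E = 3C + τ(B) comes from the tangent at C, the line x = 0, whose divisor is 3C + B.
  have hEX := hcut.eq_of_two_le hX0 hE2 (by
    rw [Finsupp.add_apply, Finsupp.single_eq_same, Finsupp.single_eq_of_ne (hne (by decide))]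
    norm_num)
  have hB : τ (coordPt 1) = coordPt 1 := by
    by_contra hne'
    have := DFunLike.congr_fun hEX (coordPt 1)
    rw [hE, Finsupp.add_apply, Finsupp.add_apply, Finsupp.add_apply, Finsupp.single_eq_same,
      Finsupp.single_eq_of_ne (Ne.symm hne'), Finsupp.single_eq_of_ne (hne (by decide)),
      Finsupp.single_eq_of_ne (hne (by decide)), Finsupp.single_eq_of_ne (hne (by decide))] at this
    norm_num at this
  rw [mapDomain_etaSym, h0, hB, hC, etaSym]

/-- Choose an explicit g with g(A) = σ(A). Then g⁻¹σ fixes A, so it fixes η, and g fixes the class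
of η. -/
theorem isAutInvariant_etaSym {ζ : ℂ} (hζ : IsPrimitiveRoot ζ 7) :
    IsAutInvariant kleinQuartic etaSym := by
  intro σ hσ
  have hpres := hσ.preservesPrincipal
  obtain ⟨g, hg, hgA⟩ := (hpres.isFlex 0).exists_fixesEta hζ
  have hτ := (hpres.trans hg.preservesPrincipal_symm).mapDomain_etaSym_eq (by
    rw [Equiv.trans_apply, ← hgA, Equiv.symm_apply_apply])
  have hmap : Finsupp.mapDomain σ etaSym = Finsupp.mapDomain g etaSym := by
    conv_rhs => rw [← hτ, ← Finsupp.mapDomain_comp]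
    congr 1
    funext p
    simp
  rw [linEquiv_iff_kleinClass, hmap, hg.kleinClass_eq]

/-! ## Seventh roots of unity -/

section RootsOfUnity

variable {ζ : ℂ} (hζ : IsPrimitiveRoot ζ 7)

include hζ in
theorem pow_val_add (i j : ZMod 7) : ζ ^ (i + j).val = ζ ^ i.val * ζ ^ j.val := by
  rw [ZMod.val_add, ← pow_eq_pow_mod _ hζ.pow_eq_one, pow_add]

include hζ in
theorem pow_val_neg_mul (i : ZMod 7) : ζ ^ (-i).val * ζ ^ i.val = 1 := by
  rw [← pow_val_add hζ, neg_add_cancel, ZMod.val_zero, pow_zero]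

include hζ in
theorem pow_val_ne_zero (i : ZMod 7) : ζ ^ i.val ≠ 0 := pow_ne_zero _ (hζ.ne_zero (by norm_num))

/-- The sum of three distinct seventh roots of unity is not zero. -/
theorem add_add_ne_zero_of_pow_seven {x y z : ℂ} (hx : x ^ 7 = 1) (hy : y ^ 7 = 1) (hz : z ^ 7 = 1)
    (hxy : x ≠ y) : x + y + z ≠ 0 := by
  intro h
  have hconj {w : ℂ} (hw : w ^ 7 = 1) : w * starRingEnd ℂ w = 1 := by
    rw [Complex.mul_conj, Complex.normSq_eq_norm_sq,
      Complex.norm_eq_one_of_pow_eq_one hw (by norm_num)]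
    norm_num
  have hc := congrArg (starRingEnd ℂ) h
  rw [map_add, map_add, map_zero] at hc
  -- Complex conjugation inverts roots of unity, so the sum of the inverses vanishes too. Then x³ =
  -- y³ = z³, which is impossible for distinct seventh roots.
  have h2 : x * y + y * z + z * x = 0 := by
    linear_combination (x * y * z) * hc - y * z * hconj hx - x * z * hconj hy - x * y * hconj hz
  refine hxy (eq_of_pow_three_eq hx hy ?_)
  linear_combination (x ^ 2 - y ^ 2) * h - (x - y) * h2

include hζ in
/-- A polynomial function of degree at most six that vanishes at the seventh roots of unity. -/
theorem eq_zero_of_forall_sum_pow_val {c : Fin 7 → ℂ}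
    (h : ∀ i : ZMod 7, ∑ r : Fin 7, (ζ ^ i.val) ^ (r : ℕ) * c r = 0) : c = 0 :=
  eq_zero_of_forall_index_sum_pow_mul_eq_zero (f := fun i : Fin 7 => ζ ^ (i : ℕ))
    (fun i j hij => Fin.ext (hζ.pow_inj i.2 j.2 hij)) fun i => h i

end RootsOfUnity

/-! ## The lines of the heptagon -/

/-- The coordinates of the lines of the heptagon. -/
noncomputable def heptLine (ζ x y : ℂ) (i : ZMod 7) : Fin 3 → ℂ :=
  ![(ζ ^ (-i).val) ^ 4 * y, (ζ ^ (-i).val) ^ 2 * x, ζ ^ (-i).val * (x * y)]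

/-- The intersection point of the lines with the labels `0` and `a`, where `θ = ζ ^ (-a)`. -/
noncomputable def heptPt (x y θ : ℂ) : Fin 3 → ℂ :=
  ![(θ - θ ^ 2) * x, (θ ^ 4 - θ) * y, θ ^ 2 - θ ^ 4]

section Heptagon

variable {ζ : ℂ} (hζ : IsPrimitiveRoot ζ 7) {x y : ℂ} (hx : x ≠ 0) (hy : y ≠ 0)

include hζ in
-- The lines are moved by the dual action, hence the exponent -i. The intersections with a fixed
-- difference of labels form one orbit of φ.
theorem heptLine_cross (i a : ZMod 7) : heptLine ζ x y i ⨯₃ heptLine ζ x y (i + a) =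
    (x * y) • (kleinDiag (ζ ^ i.val) *ᵥ heptPt x y (ζ ^ (-a).val)) := by
  have h7 := pow_val_pow_seven hζ (-i)
  have h1 := pow_val_neg_mul hζ i
  rw [kleinDiag_mulVec, heptLine, heptLine, neg_add, pow_val_add hζ, heptPt, cross_apply]
  obtain ⟨w, hw⟩ : ∃ w, w = ζ ^ (-i).val := ⟨_, rfl⟩
  obtain ⟨θ, hθ⟩ : ∃ θ, θ = ζ ^ (-a).val := ⟨_, rfl⟩
  obtain ⟨u, hu⟩ : ∃ u, u = ζ ^ i.val := ⟨_, rfl⟩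
  rw [← hw, ← hu] at h1
  rw [← hw] at h7
  rw [← hw, ← hu, ← hθ]
  have hu' : u = w ^ 6 := by linear_combination w ^ 6 * h1 - u * h7
  funext k
  fin_cases k
  · simp only [Fin.zero_eta, Fin.isValue, cons_val_zero, cons_val, Pi.smul_apply, smul_eq_mul]
    rw [hu']
    linear_combination (-x ^ 2 * y * (θ - θ ^ 2) * w ^ 3 * (w ^ 14 + w ^ 7 + 1)) * h7
  · simp only [Fin.mk_one, Fin.isValue, cons_val_one, cons_val, Pi.smul_apply, smul_eq_mul]
    rw [hu']
    linear_combination (-x * y ^ 2 * (θ ^ 4 - θ) * w ^ 5) * h7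
  · simp only [Fin.reduceFinMk, Fin.isValue, cons_val, Pi.smul_apply, smul_eq_mul]
    rw [hu']
    ring

include hζ hx hy in
theorem heptLine_ne_zero (i : ZMod 7) : heptLine ζ x y i ≠ 0 := fun h =>
  mul_ne_zero (pow_val_ne_zero hζ (-i)) (mul_ne_zero hx hy) (congrFun h 2)

include hζ hx hy in
theorem mk_heptLine_injective : Function.Injective fun i =>
    Projectivization.mk ℂ (heptLine ζ x y i) (heptLine_ne_zero hζ hx hy i) := by
  intro i j hij
  obtain ⟨c, hc⟩ := (Projectivization.mk_eq_mk_iff' ..).1 hij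
  have e0 : c * (ζ ^ (-j).val) ^ 4 = (ζ ^ (-i).val) ^ 4 :=
    mul_right_cancel₀ hy (by rw [mul_assoc]; exact congrFun hc 0)
  have e2 : c * ζ ^ (-j).val = ζ ^ (-i).val :=
    mul_right_cancel₀ (mul_ne_zero hx hy) (by rw [mul_assoc]; exact congrFun hc 2)
  refine neg_injective (pow_val_injective hζ (eq_of_pow_three_eq (pow_val_pow_seven hζ _)
    (pow_val_pow_seven hζ _) (mul_left_cancel₀ (pow_val_ne_zero hζ (-i)) ?_)))
  linear_combination (norm := ring1) -e0 + (ζ ^ (-j).val) ^ 3 * e2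

include hζ hx hy in
theorem heptLine_not_concurrent {i j k : ZMod 7} (hij : i ≠ j) (hik : i ≠ k) (hjk : j ≠ k)
    {v : Fin 3 → ℂ} (hv : v ≠ 0) (hi : v ⬝ᵥ heptLine ζ x y i = 0)
    (hj : v ⬝ᵥ heptLine ζ x y j = 0) (hk : v ⬝ᵥ heptLine ζ x y k = 0) : False := by
  have hne {i j : ZMod 7} (h : i ≠ j) : ζ ^ (-i).val ≠ ζ ^ (-j).val := fun h' =>
    h (neg_injective (pow_val_injective hζ h'))
  -- The labels of lines through v are roots of a cubic without quadratic term, so three distinct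
  -- ones would have sum zero.
  have key {i : ZMod 7} (h : v ⬝ᵥ heptLine ζ x y i = 0) :
      (ζ ^ (-i).val) ^ 3 * (v 0 * y) + ζ ^ (-i).val * (v 1 * x) + v 2 * (x * y) = 0 := by
    refine mul_left_cancel₀ (pow_val_ne_zero hζ (-i)) ?_
    rw [heptLine, dotProduct, Fin.sum_univ_three] at h
    simp only [cons_val] at h
    linear_combination (norm := ring1) h
  have h1 := key hi
  have h2 := key hj
  have h3 := key hk
  have n12 := sub_ne_zero.2 (hne hij)
  have n13 := sub_ne_zero.2 (hne hik)
  have n23 := sub_ne_zero.2 (hne hjk)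
  have hs := add_add_ne_zero_of_pow_seven (pow_val_pow_seven hζ (-i)) (pow_val_pow_seven hζ (-j))
    (pow_val_pow_seven hζ (-k)) (hne hij)
  generalize ζ ^ (-i).val = r at *
  generalize ζ ^ (-j).val = s at *
  generalize ζ ^ (-k).val = t at *
  have a1 : (r ^ 2 + r * s + s ^ 2) * (v 0 * y) + v 1 * x = 0 :=
    mul_left_cancel₀ n12 (by linear_combination h1 - h2)
  have a2 : (r ^ 2 + r * t + t ^ 2) * (v 0 * y) + v 1 * x = 0 :=
    mul_left_cancel₀ n13 (by linear_combination h1 - h3)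
  have a3 : (r + s + t) * (v 0 * y) = 0 :=
    mul_left_cancel₀ n23 (by linear_combination a1 - a2)
  have b0 : v 0 = 0 := by simpa [hs, hy] using a3
  have b1 : v 1 = 0 := by simpa [b0, hx] using a1
  have b2 : v 2 = 0 := by simpa [b0, b1, hx, hy] using h1
  exact hv (funext fun i => by fin_cases i <;> assumption)

/-- The heptagon whose lines are an orbit of the automorphism of order seven. -/
noncomputable def kleinHeptagon : Heptagon where
  line i := Projectivization.mk ℂ (heptLine ζ x y i) (heptLine_ne_zero hζ hx hy i)
  line_injective := mk_heptLine_injective hζ hx hy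
  no_three_concurrent := by
    rintro i j k hij hik hjk ⟨p, hi, hj, hk⟩
    rw [← p.mk_rep] at hi hj hk
    rw [Projectivization.orthogonal_mk] at hi hj hk
    exact heptLine_not_concurrent hζ hx hy hij hik hjk p.rep_nonzero hi hj hk

theorem cross_kleinHeptagon {a : ZMod 7} (h : heptPt x y (ζ ^ (-a).val) ≠ 0)
    (hK : eval (heptPt x y (ζ ^ (-a).val)) kleinQuartic = 0) (i : ZMod 7) :
    Projectivization.cross ((kleinHeptagon hζ hx hy).line i)
      ((kleinHeptagon hζ hx hy).line (i + a)) = (phiPerm hζ i (kleinPt _ h hK)).1 := by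
  have hM := isKleinMatrix_kleinDiag (pow_val_pow_seven hζ i)
  have hc := heptLine_cross hζ (x := x) (y := y) i a
  have h0 : heptLine ζ x y i ⨯₃ heptLine ζ x y (i + a) ≠ 0 :=
    hc ▸ smul_ne_zero (mul_ne_zero hx hy) (hM.mulVec_ne_zero h)
  rw [phiPerm, IsKleinMatrix.perm_kleinPt, kleinHeptagon,
    Projectivization.cross_mk_of_cross_ne_zero (heptLine_ne_zero hζ hx hy i)
      (heptLine_ne_zero hζ hx hy (i + a)) h0]
  exact (Projectivization.mk_eq_mk_iff' ..).2 ⟨x * y, hc.symm⟩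

end Heptagon

/-! ## Quartic forms -/

theorem eval_eq_sum_of_isHomogeneous {g : Poly3} {d : ℕ} (hg : g.IsHomogeneous d)
    (v : Fin 3 → ℂ) : eval v g = ∑ i ∈ Finset.range (d + 1), ∑ j ∈ Finset.range (d - i + 1),
      coeff (Finsupp.equivFunOnFinite.symm ![i, j, d - i - j]) g *
        (v 0 ^ i * v 1 ^ j * v 2 ^ (d - i - j)) := by
  have hdeg {e : Fin 3 →₀ ℕ} (he : e ∈ g.support) : e 0 + e 1 + e 2 = d := by
    have := hg (mem_support_iff.1 he)
    simpa [Finsupp.weight_apply, Finsupp.sum_fintype, Fin.sum_univ_three] using this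
  have heq {e : Fin 3 →₀ ℕ} (he : e ∈ g.support) :
      Finsupp.equivFunOnFinite.symm ![e 0, e 1, d - e 0 - e 1] = e := by
    have := hdeg he
    ext k
    fin_cases k
    · rfl
    · rfl
    · show d - e 0 - e 1 = e 2
      omega
  rw [eval_eq', Finset.sum_sigma']
  refine Finset.sum_of_injOn (fun e => ⟨e 0, e 1⟩) ?_ ?_ ?_ ?_
  · intro e he e' he' h
    obtain ⟨h0, h1⟩ := Sigma.mk.inj_iff.1 h
    rw [← heq he, ← heq he', h0, eq_of_heq h1]
  · intro e he
    have := hdeg he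
    simp only [Finset.coe_sigma, Set.mem_sigma_iff, Finset.coe_range, Set.mem_Iio]
    omega
  · rintro ⟨i, j⟩ - hij
    dsimp only
    by_contra h
    refine hij ⟨_, mem_support_iff.2 (left_ne_zero_of_mul h), rfl⟩
  · intro e he
    have := hdeg he
    rw [heq he, Fin.prod_univ_three, show d - e 0 - e 1 = e 2 by omega]

/-- Here c i j is the coefficient of x^i·y^j·z^(4-i-j). -/
theorem eval_quartic {g : Poly3} (hg : g.IsHomogeneous 4) : ∃ c : ℕ → ℕ → ℂ, ∀ v : Fin 3 → ℂ,
    eval v g = c 0 0 * v 2 ^ 4 + c 0 1 * (v 1 * v 2 ^ 3) + c 0 2 * (v 1 ^ 2 * v 2 ^ 2) +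
      c 0 3 * (v 1 ^ 3 * v 2) + c 0 4 * v 1 ^ 4 + c 1 0 * (v 0 * v 2 ^ 3) +
      c 1 1 * (v 0 * v 1 * v 2 ^ 2) + c 1 2 * (v 0 * v 1 ^ 2 * v 2) + c 1 3 * (v 0 * v 1 ^ 3) +
      c 2 0 * (v 0 ^ 2 * v 2 ^ 2) + c 2 1 * (v 0 ^ 2 * v 1 * v 2) + c 2 2 * (v 0 ^ 2 * v 1 ^ 2) +
      c 3 0 * (v 0 ^ 3 * v 2) + c 3 1 * (v 0 ^ 3 * v 1) + c 4 0 * v 0 ^ 4 := by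
  refine ⟨fun i j => coeff (Finsupp.equivFunOnFinite.symm ![i, j, 4 - i - j]) g, fun v => ?_⟩
  rw [eval_eq_sum_of_isHomogeneous hg]
  simp only [Finset.sum_range_succ, Finset.sum_range_zero, Nat.reduceAdd, Nat.reduceSub,
    Nat.sub_zero]
  ring

/-- A quartic form that vanishes on an orbit of `φ`, split into its isotypic components. -/
theorem components_eq_zero {ζ : ℂ} (hζ : IsPrimitiveRoot ζ 7) {g : Poly3} {c : ℕ → ℕ → ℂ}
    (hc : ∀ v : Fin 3 → ℂ,
      eval v g = c 0 0 * v 2 ^ 4 + c 0 1 * (v 1 * v 2 ^ 3) + c 0 2 * (v 1 ^ 2 * v 2 ^ 2) +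
      c 0 3 * (v 1 ^ 3 * v 2) + c 0 4 * v 1 ^ 4 + c 1 0 * (v 0 * v 2 ^ 3) +
      c 1 1 * (v 0 * v 1 * v 2 ^ 2) + c 1 2 * (v 0 * v 1 ^ 2 * v 2) + c 1 3 * (v 0 * v 1 ^ 3) +
      c 2 0 * (v 0 ^ 2 * v 2 ^ 2) + c 2 1 * (v 0 ^ 2 * v 1 * v 2) + c 2 2 * (v 0 ^ 2 * v 1 ^ 2) +
      c 3 0 * (v 0 ^ 3 * v 2) + c 3 1 * (v 0 ^ 3 * v 1) + c 4 0 * v 0 ^ 4)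
    {v : Fin 3 → ℂ} (hv : ∀ i : ZMod 7, eval (kleinDiag (ζ ^ i.val) *ᵥ v) g = 0) :
    (c 3 1 * (v 0 ^ 3 * v 1) + c 0 3 * (v 1 ^ 3 * v 2) + c 1 0 * (v 0 * v 2 ^ 3) = 0 ∧
      c 1 1 * (v 0 * v 1 * v 2 ^ 2) + c 0 4 * v 1 ^ 4 = 0 ∧
      c 4 0 * v 0 ^ 4 + c 1 2 * (v 0 * v 1 ^ 2 * v 2) = 0 ∧
      c 2 0 * (v 0 ^ 2 * v 2 ^ 2) + c 1 3 * (v 0 * v 1 ^ 3) = 0) ∧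
      c 2 1 * (v 0 ^ 2 * v 1 * v 2) + c 0 0 * v 2 ^ 4 = 0 ∧
      c 2 2 * (v 0 ^ 2 * v 1 ^ 2) + c 0 1 * (v 1 * v 2 ^ 3) = 0 ∧
      c 3 0 * (v 0 ^ 3 * v 2) + c 0 2 * (v 1 ^ 2 * v 2 ^ 2) = 0 := by
  -- Entry r collects the monomials x^i·y^j·z^k with 4i + 2j + k ≡ r modulo 7; the Vandermonde
  -- argument separates the entries.
  have h := eq_zero_of_forall_sum_pow_val hζ (c := ![
      c 3 1 * (v 0 ^ 3 * v 1) + c 0 3 * (v 1 ^ 3 * v 2) + c 1 0 * (v 0 * v 2 ^ 3),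
      c 1 1 * (v 0 * v 1 * v 2 ^ 2) + c 0 4 * v 1 ^ 4,
      c 4 0 * v 0 ^ 4 + c 1 2 * (v 0 * v 1 ^ 2 * v 2),
      c 2 0 * (v 0 ^ 2 * v 2 ^ 2) + c 1 3 * (v 0 * v 1 ^ 3),
      c 2 1 * (v 0 ^ 2 * v 1 * v 2) + c 0 0 * v 2 ^ 4,
      c 2 2 * (v 0 ^ 2 * v 1 ^ 2) + c 0 1 * (v 1 * v 2 ^ 3),
      c 3 0 * (v 0 ^ 3 * v 2) + c 0 2 * (v 1 ^ 2 * v 2 ^ 2)]) fun i => by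
    have h1 := hv i
    have h7 := pow_val_pow_seven hζ i
    rw [hc, kleinDiag_mulVec] at h1
    rw [Fin.sum_univ_seven]
    simp only [cons_val] at h1 ⊢
    generalize ζ ^ i.val = w at *
    simp only [Fin.isValue, Fin.coe_ofNat_eq_mod, Nat.reduceMod]
    linear_combination h1 - (c 0 3 * (v 1 ^ 3 * v 2) + c 1 0 * (v 0 * v 2 ^ 3) +
      w * (c 0 4 * v 1 ^ 4 + c 1 1 * (v 0 * v 1 * v 2 ^ 2)) +
      w ^ 2 * (c 1 2 * (v 0 * v 1 ^ 2 * v 2)) + w ^ 3 * (c 1 3 * (v 0 * v 1 ^ 3) +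
        c 2 0 * (v 0 ^ 2 * v 2 ^ 2)) + w ^ 4 * (c 2 1 * (v 0 ^ 2 * v 1 * v 2)) +
      w ^ 5 * (c 2 2 * (v 0 ^ 2 * v 1 ^ 2)) + w ^ 6 * (c 3 0 * (v 0 ^ 3 * v 2)) +
      (w ^ 7 + 1) * (c 3 1 * (v 0 ^ 3 * v 1)) + (w ^ 7 + 1) * w ^ 2 * (c 4 0 * v 0 ^ 4)) * h7
  refine ⟨⟨congrFun h 0, congrFun h 1, congrFun h 2, congrFun h 3⟩, congrFun h 4, congrFun h 5,
    congrFun h 6⟩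

theorem eq_zero_of_two_by_two {a b p q p' q' : ℂ} (h : a * p + b * q = 0)
    (h' : a * p' + b * q' = 0) (hd : p * q' - q * p' ≠ 0) : a = 0 ∧ b = 0 := by
  constructor
  · refine (mul_eq_zero.1 (?_ : (p * q' - q * p') * a = 0)).resolve_left hd
    linear_combination q' * h - q * h'
  · refine (mul_eq_zero.1 (?_ : (p * q' - q * p') * b = 0)).resolve_left hd
    linear_combination p * h' - p' * h

section Uniqueness

variable {ζ : ℂ} (hζ : IsPrimitiveRoot ζ 7)

include hζ

theorem heptPt_two (x y : ℂ) : heptPt x y (ζ ^ (-2 : ZMod 7).val) =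
    ![(ζ ^ 5 - ζ ^ 3) * x, (ζ ^ 6 - ζ ^ 5) * y, ζ ^ 3 - ζ ^ 6] := by
  have h7 := hζ.pow_eq_one
  rw [show (-2 : ZMod 7).val = 5 from rfl, heptPt, show (ζ ^ 5) ^ 2 = ζ ^ 3 by grind,
    show (ζ ^ 5) ^ 4 = ζ ^ 6 by grind]

theorem heptPt_three (x y : ℂ) : heptPt x y (ζ ^ (-3 : ZMod 7).val) =
    ![(ζ ^ 4 - ζ) * x, (ζ ^ 2 - ζ ^ 4) * y, ζ - ζ ^ 2] := by
  have h7 := hζ.pow_eq_one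
  rw [show (-3 : ZMod 7).val = 4 from rfl, heptPt, show (ζ ^ 4) ^ 2 = ζ by grind,
    show (ζ ^ 4) ^ 4 = ζ ^ 2 by grind]

/-- For each weight, the determinant of two monomials of that weight at the two points, with the
powers of x and y removed. In weight zero the third monomial is eliminated by subtracting a multiple
of the quartic. -/
theorem residual_det_ne_zero {p q r p' q' r' : ℂ} (hp : p = ζ ^ 5 - ζ ^ 3)
    (hq : q = ζ ^ 6 - ζ ^ 5) (hr : r = ζ ^ 3 - ζ ^ 6) (hp' : p' = ζ ^ 4 - ζ)
    (hq' : q' = ζ ^ 2 - ζ ^ 4) (hr' : r' = ζ - ζ ^ 2) :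
    (p ^ 3 * q * (q' ^ 3 * r') - q ^ 3 * r * (p' ^ 3 * q') ≠ 0 ∧
      p * q * r ^ 2 * q' ^ 4 - q ^ 4 * (p' * q' * r' ^ 2) ≠ 0 ∧
      p ^ 4 * (p' * q' ^ 2 * r') - p * q ^ 2 * r * p' ^ 4 ≠ 0 ∧
      p ^ 2 * r ^ 2 * (p' * q' ^ 3) - p * q ^ 3 * (p' ^ 2 * r' ^ 2) ≠ 0) ∧
      p ^ 2 * q * r * r' ^ 4 - r ^ 4 * (p' ^ 2 * q' * r') ≠ 0 ∧
      p ^ 2 * q ^ 2 * (q' * r' ^ 3) - q * r ^ 3 * (p' ^ 2 * q' ^ 2) ≠ 0 ∧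
      p ^ 3 * r * (q' ^ 2 * r' ^ 2) - q ^ 2 * r ^ 2 * (p' ^ 3 * r') ≠ 0 := by
  have h := hζ.sum_pow_seven
  clear hζ
  refine ⟨⟨?_, ?_, ?_, ?_⟩, ?_, ?_, ?_⟩ <;> intro h0 <;> grind

/-- The quartics through the two orbits of residual points are multiples of the Klein quartic. -/
theorem eq_C_mul_kleinQuartic_of_vanish {x y : ℂ} (hx : x ≠ 0) (hy : y ≠ 0)
    (h2 : eval (heptPt x y (ζ ^ (-2 : ZMod 7).val)) kleinQuartic = 0)
    (h3 : eval (heptPt x y (ζ ^ (-3 : ZMod 7).val)) kleinQuartic = 0)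
    {g : Poly3} (hg : g.IsHomogeneous 4)
    (hg2 : ∀ i : ZMod 7,
      eval (kleinDiag (ζ ^ i.val) *ᵥ heptPt x y (ζ ^ (-2 : ZMod 7).val)) g = 0)
    (hg3 : ∀ i : ZMod 7,
      eval (kleinDiag (ζ ^ i.val) *ᵥ heptPt x y (ζ ^ (-3 : ZMod 7).val)) g = 0) :
    ∃ c : ℂ, g = C c * kleinQuartic := by
  obtain ⟨c, hc⟩ := eval_quartic hg
  obtain ⟨⟨k0, k1, k2, k3⟩, k4, k5, k6⟩ := components_eq_zero hζ hc hg2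
  obtain ⟨⟨m0, m1, m2, m3⟩, m4, m5, m6⟩ := components_eq_zero hζ hc hg3
  rw [eval_kleinQuartic] at h2 h3
  rw [heptPt_two hζ] at h2 k0 k1 k2 k3 k4 k5 k6
  rw [heptPt_three hζ] at h3 m0 m1 m2 m3 m4 m5 m6
  simp only [cons_val] at h2 k0 k1 k2 k3 k4 k5 k6 h3 m0 m1 m2 m3 m4 m5 m6
  obtain ⟨p, hp⟩ : ∃ p, p = ζ ^ 5 - ζ ^ 3 := ⟨_, rfl⟩
  obtain ⟨q, hq⟩ : ∃ q, q = ζ ^ 6 - ζ ^ 5 := ⟨_, rfl⟩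
  obtain ⟨r, hr⟩ : ∃ r, r = ζ ^ 3 - ζ ^ 6 := ⟨_, rfl⟩
  obtain ⟨p', hp'⟩ : ∃ p', p' = ζ ^ 4 - ζ := ⟨_, rfl⟩
  obtain ⟨q', hq'⟩ : ∃ q', q' = ζ ^ 2 - ζ ^ 4 := ⟨_, rfl⟩
  obtain ⟨r', hr'⟩ : ∃ r', r' = ζ - ζ ^ 2 := ⟨_, rfl⟩
  rw [← hp, ← hq, ← hr] at h2 k0 k1 k2 k3 k4 k5 k6
  rw [← hp', ← hq', ← hr'] at h3 m0 m1 m2 m3 m4 m5 m6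
  obtain ⟨⟨d0, d1, d2, d3⟩, d4, d5, d6⟩ := residual_det_ne_zero hζ hp hq hr hp' hq' hr'
  -- Subtracting c 1 0 times the Klein quartic removes the monomial xz³ and leaves two unknowns.
  have c0 := eq_zero_of_two_by_two (a := (c 3 1 - c 1 0) * (x ^ 3 * y))
    (b := (c 0 3 - c 1 0) * y ^ 3) (p := p ^ 3 * q) (q := q ^ 3 * r) (p' := p' ^ 3 * q')
    (q' := q' ^ 3 * r') (by linear_combination k0 - c 1 0 * h2)
    (by linear_combination m0 - c 1 0 * h3) d0
  have c1 := eq_zero_of_two_by_two (a := c 1 1 * (x * y)) (b := c 0 4 * y ^ 4)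
    (p := p * q * r ^ 2) (q := q ^ 4) (p' := p' * q' * r' ^ 2) (q' := q' ^ 4)
    (by linear_combination k1) (by linear_combination m1) d1
  have c2 := eq_zero_of_two_by_two (a := c 4 0 * x ^ 4) (b := c 1 2 * (x * y ^ 2))
    (p := p ^ 4) (q := p * q ^ 2 * r) (p' := p' ^ 4) (q' := p' * q' ^ 2 * r')
    (by linear_combination k2) (by linear_combination m2) d2
  have c3 := eq_zero_of_two_by_two (a := c 2 0 * x ^ 2) (b := c 1 3 * (x * y ^ 3))
    (p := p ^ 2 * r ^ 2) (q := p * q ^ 3) (p' := p' ^ 2 * r' ^ 2) (q' := p' * q' ^ 3)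
    (by linear_combination k3) (by linear_combination m3) d3
  have c4 := eq_zero_of_two_by_two (a := c 2 1 * (x ^ 2 * y)) (b := c 0 0)
    (p := p ^ 2 * q * r) (q := r ^ 4) (p' := p' ^ 2 * q' * r') (q' := r' ^ 4)
    (by linear_combination k4) (by linear_combination m4) d4
  have c5 := eq_zero_of_two_by_two (a := c 2 2 * (x ^ 2 * y ^ 2)) (b := c 0 1 * y)
    (p := p ^ 2 * q ^ 2) (q := q * r ^ 3) (p' := p' ^ 2 * q' ^ 2) (q' := q' * r' ^ 3)
    (by linear_combination k5) (by linear_combination m5) d5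
  have c6 := eq_zero_of_two_by_two (a := c 3 0 * x ^ 3) (b := c 0 2 * y ^ 2)
    (p := p ^ 3 * r) (q := q ^ 2 * r ^ 2) (p' := p' ^ 3 * r') (q' := q' ^ 2 * r' ^ 2)
    (by linear_combination k6) (by linear_combination m6) d6
  simp only [mul_eq_zero, pow_eq_zero_iff, ne_eq, OfNat.ofNat_ne_zero, not_false_eq_true, hx, hy,
    or_false, or_self, sub_eq_zero] at c0 c1 c2 c3 c4 c5 c6
  refine ⟨c 1 0, MvPolynomial.funext fun v => ?_⟩
  rw [hc, map_mul, eval_C, eval_kleinQuartic]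
  simp only [c0, c1, c2, c3, c4, c5, c6]
  ring

end Uniqueness

/-! ## The residual points -/

theorem Heptagon.mem_residual_iff (P : Heptagon) {p : PPlane} : p ∈ P.residual ↔
    ∃ i, Projectivization.cross (P.line i) (P.line (i + 2)) = p ∨
      Projectivization.cross (P.line i) (P.line (i + 3)) = p := by
  -- Two labels that are neither equal nor consecutive differ by ±2 or ±3.
  have hcases : ∀ i j : ZMod 7, i ≠ j ∧ j ≠ i + 1 ∧ i ≠ j + 1 →
      j = i + 2 ∨ j = i + 3 ∨ i = j + 2 ∨ i = j + 3 := by decide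
  have h2 : ∀ i : ZMod 7, i ≠ i + 2 ∧ i + 2 ≠ i + 1 ∧ i ≠ i + 2 + 1 := by decide
  have h3 : ∀ i : ZMod 7, i ≠ i + 3 ∧ i + 3 ≠ i + 1 ∧ i ≠ i + 3 + 1 := by decide
  classical
  rw [Heptagon.residual, Finset.mem_image]
  constructor
  · rintro ⟨⟨i, j⟩, hij, rfl⟩
    rcases hcases i j (Finset.mem_filter.1 hij).2 with h | h | h | h <;> dsimp only
    · exact ⟨i, Or.inl (by rw [h])⟩
    · exact ⟨i, Or.inr (by rw [h])⟩
    · exact ⟨j, Or.inl (by rw [h, Projectivization.cross_comm])⟩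
    · exact ⟨j, Or.inr (by rw [h, Projectivization.cross_comm])⟩
  · rintro ⟨i, rfl | rfl⟩
    · exact ⟨(i, i + 2), Finset.mem_filter.2 ⟨Finset.mem_univ _, h2 i⟩, rfl⟩
    · exact ⟨(i, i + 3), Finset.mem_filter.2 ⟨Finset.mem_univ _, h3 i⟩, rfl⟩

section Residual

variable {ζ : ℂ} (hζ : IsPrimitiveRoot ζ 7)

/-- The residual divisor counts a set without multiplicities, so it must be known that the fourteen
points are distinct. -/
theorem sum_single_eq_orbitDiv_add {P Q : CurvePt kleinQuartic} {s : Finset (CurvePt kleinQuartic)}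
    (hs : ∀ p, p ∈ s ↔ ∃ i, phiPerm hζ i P = p ∨ phiPerm hζ i Q = p)
    (hP : Function.Injective fun i => phiPerm hζ i P)
    (hQ : Function.Injective fun i => phiPerm hζ i Q)
    (hPQ : ∀ i j, phiPerm hζ i P ≠ phiPerm hζ j Q) :
    ∑ p ∈ s, Finsupp.single p (1 : ℤ) = orbitDiv hζ P + orbitDiv hζ Q := by
  classical
  have : s = Finset.univ.image (fun i => phiPerm hζ i P) ∪
      Finset.univ.image fun i => phiPerm hζ i Q := by
    ext p
    simp [hs, exists_or]
  rw [this, Finset.sum_union, Finset.sum_image fun i _ j _ h => hP h,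
    Finset.sum_image fun i _ j _ h => hQ h, orbitDiv, orbitDiv]
  rw [Finset.disjoint_left]
  intro p hp hq
  obtain ⟨i, -, rfl⟩ := Finset.mem_image.1 hp
  obtain ⟨j, -, hj⟩ := Finset.mem_image.1 hq
  exact hPQ i j hj.symm

theorem phiPerm_ne_phiPerm {i j : ZMod 7} {v w : Fin 3 → ℂ} {hv : v ≠ 0} {hw : w ≠ 0}
    {h : eval v kleinQuartic = 0} {h' : eval w kleinQuartic = 0} (hv2 : v 2 ≠ 0)
    (hne : v 0 ^ 2 * v 1 * w 2 ^ 3 - w 0 ^ 2 * w 1 * v 2 ^ 3 ≠ 0) :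
    phiPerm hζ i (kleinPt v hv h) ≠ phiPerm hζ j (kleinPt w hw h') := by
  intro heq
  have h1 := pow_val_pow_seven hζ i
  have h2 := pow_val_pow_seven hζ j
  have hω := pow_val_ne_zero hζ i
  have hτ := pow_val_ne_zero hζ j
  simp only [phiPerm, IsKleinMatrix.perm_kleinPt, kleinPt_eq_iff, kleinDiag_mulVec] at heq
  generalize ζ ^ i.val = ω at *
  generalize ζ ^ j.val = τ at *
  obtain ⟨c, hc⟩ := heq
  have e0 : c * (τ ^ 4 * w 0) = ω ^ 4 * v 0 := congrFun hc 0
  have e1 : c * (τ ^ 2 * w 1) = ω ^ 2 * v 1 := congrFun hc 1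
  have e2 : c * (τ * w 2) = ω * v 2 := congrFun hc 2
  have hc0 : c ≠ 0 := by
    rintro rfl
    rw [zero_mul, zero_eq_mul] at e2
    exact e2.elim hω hv2
  have a1 : ω ^ 3 * (v 0 ^ 2 * v 1) = c ^ 3 * τ ^ 3 * (w 0 ^ 2 * w 1) := by
    calc ω ^ 3 * (v 0 ^ 2 * v 1) = (ω ^ 4 * v 0) ^ 2 * (ω ^ 2 * v 1) := by
          linear_combination (-ω ^ 3 * v 0 ^ 2 * v 1) * h1
      _ = c ^ 3 * τ ^ 3 * (w 0 ^ 2 * w 1) := by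
          rw [← e0, ← e1]
          linear_combination (c ^ 3 * τ ^ 3 * w 0 ^ 2 * w 1) * h2
  have a2 : c ^ 3 * τ ^ 3 * w 2 ^ 3 = ω ^ 3 * v 2 ^ 3 := by
    calc c ^ 3 * τ ^ 3 * w 2 ^ 3 = (c * (τ * w 2)) ^ 3 := by ring
      _ = ω ^ 3 * v 2 ^ 3 := by rw [e2]; ring
  refine hne (mul_left_cancel₀ (mul_ne_zero (pow_ne_zero 3 hω)
    (mul_ne_zero (pow_ne_zero 3 hc0) (pow_ne_zero 3 hτ))) ?_)
  linear_combination (c ^ 3 * τ ^ 3 * w 2 ^ 3) * a1 + (c ^ 3 * τ ^ 3 * (w 0 ^ 2 * w 1)) * a2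

theorem phiPerm_add_one (i : ZMod 7) (p : CurvePt kleinQuartic) :
    (phiPerm hζ (i + 1) p).1 = kleinPhi ζ (hζ.ne_zero (by norm_num)) (phiPerm hζ i p).1 := by
  obtain ⟨v, hv, h, rfl⟩ := exists_eq_kleinPt p
  have h1 : ζ ^ (i + 1).val = ζ * ζ ^ i.val := by
    rw [pow_val_add hζ, show (1 : ZMod 7).val = 1 from rfl, pow_one, mul_comm]
  rw [phiPerm, phiPerm, IsKleinMatrix.perm_kleinPt, IsKleinMatrix.perm_kleinPt, kleinPt, kleinPt,
    kleinPhi, Projectivization.map_mk, Projectivization.mk_eq_mk_iff']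
  refine ⟨1, ?_⟩
  rw [one_smul, kleinPhiLinear, toLin'_apply, ← kleinDiag, mulVec_mulVec, kleinDiag_mul, h1]

include hζ

/-- The values of x²y and y³/x solve the two linear equations that put the residual orbits on the
curve. With y = α/x² they amount to one equation x⁷ = α³/β. -/
theorem exists_heptagon_coordinates : ∃ x y : ℂ, x ≠ 0 ∧ y ≠ 0 ∧ x ^ 2 * y = 2 + ζ ^ 2 + ζ ^ 5 ∧
    y ^ 3 = (1 - ζ ^ 2 - 2 * ζ ^ 3 - 2 * ζ ^ 4 - ζ ^ 5) * x := by
  have h := hζ.sum_pow_seven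
  have h1 : 2 + ζ ^ 2 + ζ ^ 5 ≠ 0 := by
    clear hζ
    grind
  have h2 : 1 - ζ ^ 2 - 2 * ζ ^ 3 - 2 * ζ ^ 4 - ζ ^ 5 ≠ 0 := by
    clear hζ
    grind
  generalize 2 + ζ ^ 2 + ζ ^ 5 = a at *
  generalize 1 - ζ ^ 2 - 2 * ζ ^ 3 - 2 * ζ ^ 4 - ζ ^ 5 = b at *
  obtain ⟨x, hx⟩ := IsAlgClosed.exists_pow_nat_eq (a ^ 3 / b) (n := 7) (by norm_num)
  have hx0 : x ≠ 0 := by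
    rintro rfl
    rw [zero_pow (by norm_num)] at hx
    exact div_ne_zero (pow_ne_zero 3 h1) h2 hx.symm
  rw [eq_div_iff h2] at hx
  refine ⟨x, a / x ^ 2, hx0, div_ne_zero h1 (pow_ne_zero 2 hx0), ?_, ?_⟩
  · field_simp
  · field_simp
    linear_combination -hx

/-- In order: the coordinates are nonzero, so both orbits are free; the values of x²y/z³ differ, so
the orbits are disjoint; and both points satisfy the equation of the curve divided by x. -/
theorem residual_point_conditions {p q r p' q' r' : ℂ} (hp : p = ζ ^ 5 - ζ ^ 3)
    (hq : q = ζ ^ 6 - ζ ^ 5) (hr : r = ζ ^ 3 - ζ ^ 6) (hp' : p' = ζ ^ 4 - ζ)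
    (hq' : q' = ζ ^ 2 - ζ ^ 4) (hr' : r' = ζ - ζ ^ 2) :
    (((p ≠ 0 ∧ q ≠ 0) ∧ r ≠ 0) ∧ (p' ≠ 0 ∧ q' ≠ 0) ∧ r' ≠ 0) ∧
      p ^ 2 * q * r' ^ 3 - p' ^ 2 * q' * r ^ 3 ≠ 0 ∧
      p ^ 3 * q * (2 + ζ ^ 2 + ζ ^ 5) +
        q ^ 3 * r * (1 - ζ ^ 2 - 2 * ζ ^ 3 - 2 * ζ ^ 4 - ζ ^ 5) + r ^ 3 * p = 0 ∧
      p' ^ 3 * q' * (2 + ζ ^ 2 + ζ ^ 5) +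
        q' ^ 3 * r' * (1 - ζ ^ 2 - 2 * ζ ^ 3 - 2 * ζ ^ 4 - ζ ^ 5) + r' ^ 3 * p' = 0 := by
  have h := hζ.sum_pow_seven
  clear hζ
  refine ⟨⟨⟨⟨?_, ?_⟩, ?_⟩, ⟨?_, ?_⟩, ?_⟩, ?_, ?_, ?_⟩ <;> grind

/-- A heptagon with the required properties, built from an orbit. -/
theorem exists_heptagon : ∃ P : Heptagon, P.IsAdjoint kleinQuartic ∧
    P.IsAssociatedTheta kleinQuartic etaSym ∧
    ∃ p : ZMod 7 → PPlane, Function.Injective p ∧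
      (∀ i, VanishesAt kleinQuartic (p i)) ∧
      (∀ i, p (i + 1) = kleinPhi ζ (hζ.ne_zero (by norm_num)) (p i)) ∧
      ∀ i, (p i).orthogonal (P.line i) ∧ (p (i - 2)).orthogonal (P.line i) := by
  obtain ⟨x, y, hx, hy, hxy, hyx⟩ := exists_heptagon_coordinates hζ
  obtain ⟨p, hp⟩ : ∃ p, p = ζ ^ 5 - ζ ^ 3 := ⟨_, rfl⟩
  obtain ⟨q, hq⟩ : ∃ q, q = ζ ^ 6 - ζ ^ 5 := ⟨_, rfl⟩
  obtain ⟨r, hr⟩ : ∃ r, r = ζ ^ 3 - ζ ^ 6 := ⟨_, rfl⟩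
  obtain ⟨p', hp'⟩ : ∃ p', p' = ζ ^ 4 - ζ := ⟨_, rfl⟩
  obtain ⟨q', hq'⟩ : ∃ q', q' = ζ ^ 2 - ζ ^ 4 := ⟨_, rfl⟩
  obtain ⟨r', hr'⟩ : ∃ r', r' = ζ - ζ ^ 2 := ⟨_, rfl⟩
  obtain ⟨hnz, hu, hKk, hKm⟩ := residual_point_conditions hζ hp hq hr hp' hq' hr'
  obtain ⟨⟨⟨p0, q0⟩, r0⟩, ⟨p0', q0'⟩, r0'⟩ := hnz
  have hv := heptPt_two hζ x y
  have hw := heptPt_three hζ x y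
  rw [← hp, ← hq, ← hr] at hv
  rw [← hp', ← hq', ← hr'] at hw
  have hv0 : ∀ i, heptPt x y (ζ ^ (-2 : ZMod 7).val) i ≠ 0 := by
    rw [hv]
    intro i
    fin_cases i
    exacts [mul_ne_zero p0 hx, mul_ne_zero q0 hy, r0]
  have hw0 : ∀ i, heptPt x y (ζ ^ (-3 : ZMod 7).val) i ≠ 0 := by
    rw [hw]
    intro i
    fin_cases i
    exacts [mul_ne_zero p0' hx, mul_ne_zero q0' hy, r0']
  have hvK : eval (heptPt x y (ζ ^ (-2 : ZMod 7).val)) kleinQuartic = 0 := by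
    rw [hv, eval_kleinQuartic]
    simp only [cons_val]
    linear_combination p ^ 3 * q * x * hxy + q ^ 3 * r * hyx + x * hKk
  have hwK : eval (heptPt x y (ζ ^ (-3 : ZMod 7).val)) kleinQuartic = 0 := by
    rw [hw, eval_kleinQuartic]
    simp only [cons_val]
    linear_combination p' ^ 3 * q' * x * hxy + q' ^ 3 * r' * hyx + x * hKm
  have hv1 : heptPt x y (ζ ^ (-2 : ZMod 7).val) ≠ 0 := fun h => hv0 0 (congrFun h 0)
  have hw1 : heptPt x y (ζ ^ (-3 : ZMod 7).val) ≠ 0 := fun h => hw0 0 (congrFun h 0)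
  have hcv := cross_kleinHeptagon hζ hx hy hv1 hvK
  have hcw := cross_kleinHeptagon hζ hx hy hw1 hwK
  have hinj := phiPerm_injective hζ (hv := hv1) (h := hvK) hv0
  have hinj' := phiPerm_injective hζ (hv := hw1) (h := hwK) hw0
  have hne (i j : ZMod 7) : phiPerm hζ i (kleinPt _ hv1 hvK) ≠ phiPerm hζ j (kleinPt _ hw1 hwK) :=
    phiPerm_ne_phiPerm hζ (hv0 2) (by
      rw [hv, hw]
      simp only [cons_val]
      have : x ^ 2 * y * (p ^ 2 * q * r' ^ 3 - p' ^ 2 * q' * r ^ 3) ≠ 0 :=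
        mul_ne_zero (mul_ne_zero (pow_ne_zero 2 hx) hy) hu
      convert this using 1
      ring)
  have hres (p : PPlane) : p ∈ (kleinHeptagon hζ hx hy).residual ↔
      ∃ i, (phiPerm hζ i (kleinPt _ hv1 hvK)).1 = p ∨
        (phiPerm hζ i (kleinPt _ hw1 hwK)).1 = p := by
    simp only [Heptagon.mem_residual_iff, hcv, hcw]
  refine ⟨kleinHeptagon hζ hx hy, ⟨kleinQuartic_prime.ne_zero, kleinQuartic_isHomogeneous,
    fun p hp => ?_, fun g hg hgv => ?_⟩, ⟨_, (cutsOut_X 1).isLineSection, ?_⟩,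
    fun i => (phiPerm hζ i (kleinPt _ hv1 hvK)).1, fun i j hij => hinj (Subtype.ext hij),
    fun i => (phiPerm hζ i _).2, fun i => phiPerm_add_one hζ i _, fun i => ?_⟩
  · obtain ⟨i, rfl | rfl⟩ := (hres p).1 hp
    exacts [(phiPerm hζ i _).2, (phiPerm hζ i _).2]
  · refine eq_C_mul_kleinQuartic_of_vanish hζ hx hy hvK hwK hg (fun i => ?_) fun i => ?_
    · have h1 := hgv _ ((hres _).2 ⟨i, Or.inl rfl⟩)
      rw [phiPerm, IsKleinMatrix.perm_kleinPt] at h1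
      exact (vanishesAt_mk hg _).1 h1
    · have h1 := hgv _ ((hres _).2 ⟨i, Or.inr rfl⟩)
      rw [phiPerm, IsKleinMatrix.perm_kleinPt] at h1
      exact (vanishesAt_mk hg _).1 h1
  -- Each orbit has class 7A, and 14A ~ 3H + η follows from 3A + C ~ 3C + B.
  · have hR : (kleinHeptagon hζ hx hy).residualDivisor kleinQuartic =
        orbitDiv hζ (kleinPt _ hv1 hvK) + orbitDiv hζ (kleinPt _ hw1 hwK) := by
      classical
      refine sum_single_eq_orbitDiv_add hζ (fun p => ?_) hinj hinj' hne
      refine Finset.mem_subtype.trans ((hres _).trans (exists_congr fun i => or_congr ?_ ?_))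
      · exact Subtype.ext_iff.symm
      · exact Subtype.ext_iff.symm
    have h1 := hClass_eq_zero_two.symm.trans hClass_eq_two_one
    rw [linEquiv_iff_kleinClass, hR, map_add, kleinClass_orbitDiv, kleinClass_orbitDiv, map_add,
      map_nsmul, kleinClass_lineSection (cutsOut_X 1), kleinClass_etaSym, hClass]
    linear_combination (norm := module) (2 : ℤ) • h1
  -- The orbit is p i = L i ∩ L (i+2), so L i passes through p i and p (i-2).
  · have horth (i : ZMod 7) : Projectivization.orthogonal
        (phiPerm hζ i (kleinPt _ hv1 hvK)).1 ((kleinHeptagon hζ hx hy).line i) ∧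
        Projectivization.orthogonal (phiPerm hζ i (kleinPt _ hv1 hvK)).1
          ((kleinHeptagon hζ hx hy).line (i + 2)) := by
      rw [phiPerm, IsKleinMatrix.perm_kleinPt]
      have hc := heptLine_cross hζ (x := x) (y := y) i 2
      have h0 (u : Fin 3 → ℂ) (hu : heptLine ζ x y i ⨯₃ heptLine ζ x y (i + 2) ⬝ᵥ u = 0) :
          kleinDiag (ζ ^ i.val) *ᵥ heptPt x y (ζ ^ (-2 : ZMod 7).val) ⬝ᵥ u = 0 := by
        rw [hc, smul_dotProduct, smul_eq_mul] at hu
        exact (mul_eq_zero.1 hu).resolve_left (mul_ne_zero hx hy)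
      constructor
      · refine (Projectivization.orthogonal_mk _ _).2 (h0 _ ?_)
        rw [dotProduct_comm, dot_self_cross]
      · refine (Projectivization.orthogonal_mk _ _).2 (h0 _ ?_)
        rw [dotProduct_comm, dot_cross_self]
    refine ⟨(horth i).1, ?_⟩
    have := (horth (i - 2)).2
    rwa [sub_add_cancel] at this

end Residual

end

theorem mainTheorem3 (ζ : ℂ) (hζ : IsPrimitiveRoot ζ 7) :
    IsSmoothForm kleinQuartic ∧
    ∃ η : CurveDiv kleinQuartic,
      (IsEvenTheta kleinQuartic η ∧ IsAutInvariant kleinQuartic η ∧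
        ∀ η' : CurveDiv kleinQuartic, IsEvenTheta kleinQuartic η' →
          IsAutInvariant kleinQuartic η' → LinEquiv kleinQuartic η' η) ∧
      ∃ P : Heptagon, P.IsAdjoint kleinQuartic ∧ P.IsAssociatedTheta kleinQuartic η ∧
        ∃ p : ZMod 7 → PPlane, Function.Injective p ∧
          (∀ i, VanishesAt kleinQuartic (p i)) ∧
          (∀ i, p (i + 1) = kleinPhi ζ (hζ.ne_zero (by norm_num)) (p i)) ∧
          ∀ i, (p i).orthogonal (P.line i) ∧ (p (i - 2)).orthogonal (P.line i) := by
  refine ⟨kleinQuartic_isSmoothForm, etaSym, ⟨isEvenTheta_etaSym, isAutInvariant_etaSym hζ,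
    fun η' h h' => ?_⟩, exists_heptagon hζ⟩
  -- Parity plays no role in uniqueness: η is the only invariant theta characteristic, even or odd.
  obtain ⟨hdeg, h2⟩ := isTheta_iff.1 h.1
  exact linEquiv_iff_kleinClass.2 (kleinClass_eq_of_isAutInvariant hζ h'
    (isAutInvariant_etaSym hζ) (hdeg.trans divDegree_etaSym.symm)
    (h2.trans two_smul_kleinClass_etaSym.symm))
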